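/- Let $p$ be an odd prime, $F$ a finite extension of $\mathbb{Q}_p$ with ramification index $e$, and $D$ a central division algebra of degree $d\ge 2$ over $F$ with ring of integers $O_D$. Let $W\subset D$ be a maximal subfield unramified over $F$, $\pi$ a uniformizer of $D$ and $\sigma$ a generator of $\mathrm{Gal}(W/F)$ with $\pi w\pi^{-1}=\sigma(w)$ for $w\in W$; put $\tau=\pi^d$, a uniformizer of $F$. Let $W_{ur}$, $F_{ur}$ be the maximal unramified extensions of $\mathbb{Q}_p$ in $W$, $F$, let $O$, $O_{F_{ur}}$ be their rings of integers, and write $\tau^e=p\sum_{k=0}^{e-1}c_k\tau^k$ with (unique) $c_k\in O_{F_{ur}}$. Let $\mathbf w=W_{ur}/O$, $\mathbf f=F_{ur}/O_{F_{ur}}\subset\mathbf w$, and let $\mathrm{tr}:\mathbf w\to\mathbb{Q}_p/\mathbb{Z}_p$ and $\mathrm{Tr}:\mathbf w\to\mathbf f$ be the maps induced by the field traces. For $\lambda\in\mathbf w$ and $i\ge 0$ let $\lambda(i)=\lambda+\sigma(\lambda)+\dots+\sigma^{i-1}(\lambda)$. Let $O_i=O$ if $d\nmid i$ and $O_i=\{\alpha\in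 O:\mathrm{tr}_{W/F}(\alpha)=0\}$ if $d\mid i$. Let $\mathfrak g_N$ be the $\mathbb{Z}_p$-Lie algebra of elements of reduced trace $0$ in $\pi^N O_D$, and let $\Delta$ be the group of roots of unity $g\in W$ of order prime to $p$ with $N_{W/F}(g)=1$, acting on $\mathfrak g_N$ by $u^g=g^{-1}ug$. Let $C:\mathfrak g_N\times\mathfrak g_N\to\mathbb{Q}_p/\mathbb{Z}_p$ be $\mathbb{Z}_p$-bilinear. It is a 2-cocycle if $C(x,x)=0$ and $C([x,y],z)+C([y,z],x)+C([z,x],y)=0$ for all $x,y,z$; it is $\Delta$-invariant if $C(u^g,v^g)=C(u,v)$ for all $u,v$ and $g\in\Delta$. For $i,j\ge N$ and $\lambda\in\mathbf w$ write $\lambda_{i,j}(C)=\lambda$ if $C(\alpha\pi^i,\beta\pi^j)=\mathrm{tr}(\lambda\alpha\sigma^i(\beta))$ for all $\alpha\in O_i$, $\beta\in O_j$ and, in case $d=2$ and $i,j$ are both even, $\lambda\in\mathbf f$ (such a $\lambda$ is unique if it exists). Let $f\ge 0$ and $N=df+1$. A sequence $\{\kappa_n\}_{n\ge 2f+1}$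 in $\mathbf w$ is a defining sequence of $C$ if for all $i,j\ge N$ one has $\lambda_{i,j}(C)=\kappa_{(i+j)/d}(i)$ when $d\mid i+j$ and $\lambda_{i,j}(C)=0$ when $d\nmid i+j$; $C$ is regular if it has a defining sequence. The sequence is compatible if for all $n\ge 2f+1$ (C1) $\kappa_{n+e}=p\sum_{k=0}^{e-1}c_k\kappa_{n+k}$, and (C2) $n\,\mathrm{Tr}(\kappa_n)=0$. Theorem. Every compatible sequence $\{\kappa_n\}_{n\ge 2f+1}$ in $\mathbf w$ is a defining sequence of some regular $\Delta$-invariant 2-cocycle of $\mathfrak g_{df+1}$. Conversely, unless $d=2$ and $p\mid 2f+1$, every defining sequence of a regular $\Delta$-invariant 2-cocycle of $\mathfrak g_{df+1}$ is compatible. (So, outside this exceptional case, a sequence is a defining sequence of a regular $\Delta$-invariant 2-cocycle of $\mathfrak g_{df+1}$ if and only if it is compatible.) -/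

import Mathlib

set_option linter.unusedSectionVars false

noncomputable section

namespace NormOne

section Integers
variable {p : ℕ} [Fact p.Prime]

theorem isIntegral_iff_coeff {K : Type*} [Field K] [Algebra ℚ_[p] K] [Algebra ℤ_[p] K]
    [IsScalarTower ℤ_[p] ℚ_[p] K] [FiniteDimensional ℚ_[p] K] (x : K) :
    IsIntegral ℤ_[p] x ↔ ‖(minpoly ℚ_[p] x).coeff 0‖ ≤ 1 := by
  have hx : IsIntegral ℚ_[p] x := Algebra.IsIntegral.isIntegral x
  constructor
  · intro h
    rw [minpoly.isIntegrallyClosed_eq_field_fractions' ℚ_[p] h, Polynomial.coeff_map]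
    exact PadicInt.norm_le_one _
  · intro h
    have h1 : spectralNorm ℚ_[p] K x ≤ 1 := by
      rw [spectralNorm.spectralNorm_eq_norm_coeff_zero_rpow]
      exact Real.rpow_le_one (norm_nonneg _) h (by positivity)
    have h2 : ∀ n : ℕ, ‖(minpoly ℚ_[p] x).coeff n‖ ≤ 1 :=
      (spectralValue_le_one_iff (minpoly.monic hx)).1 h1
    have h3 : minpoly ℚ_[p] x ∈ Polynomial.lifts (algebraMap ℤ_[p] ℚ_[p]) := by
      rw [Polynomial.lifts_iff_coeff_lifts]
      intro n
      exact ⟨⟨_, h2 n⟩, rfl⟩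
    obtain ⟨q, hq, -, hm⟩ :=
      Polynomial.lifts_and_degree_eq_and_monic h3 (minpoly.monic hx)
    refine ⟨q, hm, ?_⟩
    rw [← Polynomial.aeval_def, ← Polynomial.aeval_map_algebraMap ℚ_[p], hq, minpoly.aeval]

theorem norm_le_one_iff_coeff {K : Type*} [Field K] [Algebra ℚ_[p] K]
    [FiniteDimensional ℚ_[p] K] (x : K) :
    ‖Algebra.norm ℚ_[p] x‖ ≤ 1 ↔ ‖(minpoly ℚ_[p] x).coeff 0‖ ≤ 1 := by
  have hx : IsIntegral ℚ_[p] x := Algebra.IsIntegral.isIntegral x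
  have h := Algebra.norm_eq_norm_adjoin ℚ_[p] x
  have h2 := Algebra.PowerBasis.norm_gen_eq_coeff_zero_minpoly
    (IntermediateField.adjoin.powerBasis hx)
  rw [IntermediateField.adjoin.powerBasis_gen, IntermediateField.minpoly_gen] at h2
  rw [h, h2, norm_pow, norm_mul, norm_pow, norm_neg, norm_one, one_pow, one_mul]
  exact pow_le_one_iff_of_nonneg (norm_nonneg _) (Module.finrank_pos).ne'

variable {D : Type*} [DivisionRing D] [Algebra ℚ_[p] D] [Algebra ℤ_[p] D]
  [IsScalarTower ℤ_[p] ℚ_[p] D] [FiniteDimensional ℚ_[p] D]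

theorem isIntegral_iff_norm_aux {K : Type*} [Field K] [Algebra ℚ_[p] K]
    [FiniteDimensional ℚ_[p] K] (φ : K →ₐ[ℚ_[p]] D) (r : K) :
    (IsIntegral ℤ_[p] (φ r) ↔ ‖Algebra.norm ℚ_[p] (φ r)‖ ≤ 1) ∧
      (IsIntegral ℤ_[p] (φ r) → IsIntegral ℤ_[p] (φ r + 1)) := by
  let _ : Algebra ℤ_[p] K := ((algebraMap ℚ_[p] K).comp (algebraMap ℤ_[p] ℚ_[p])).toAlgebra
  have _ : IsScalarTower ℤ_[p] ℚ_[p] K := IsScalarTower.of_algebraMap_eq' rfl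
  have hint : ∀ y : K, IsIntegral ℤ_[p] (φ y) ↔ IsIntegral ℤ_[p] y := fun y =>
    isIntegral_algHom_iff (φ.restrictScalars ℤ_[p]) φ.toRingHom.injective
  let _ : Module K D := Module.compHom D φ.toRingHom
  have hs : ∀ (a : K) (y : D), a • y = φ a * y := fun _ _ => rfl
  have _ : IsScalarTower ℚ_[p] K D := ⟨fun a b c => by
    rw [hs, hs, map_smul, smul_mul_assoc]⟩
  have _ : Module.Finite K D := Module.Finite.of_restrictScalars_finite ℚ_[p] K D
  have hN : Algebra.norm ℚ_[p] (φ r) = (Algebra.norm ℚ_[p] r) ^ Module.finrank K D := by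
    have h1 := LinearMap.det_restrictScalars (R := ℚ_[p])
      (f := (r • LinearMap.id : D →ₗ[K] D))
    rw [LinearMap.det_smul, LinearMap.det_id, mul_one, map_pow] at h1
    rw [← h1, Algebra.norm_apply]
    congr 1
  refine ⟨?_, fun h => ?_⟩
  · rw [hint, isIntegral_iff_coeff, ← norm_le_one_iff_coeff, hN, norm_pow]
    exact (pow_le_one_iff_of_nonneg (norm_nonneg _) (Module.finrank_pos).ne').symm
  · rw [hint] at h
    rw [← map_one φ, ← map_add, hint]
    exact h.add isIntegral_one

theorem isIntegral_iff_norm_and (x : D) :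
    (IsIntegral ℤ_[p] x ↔ ‖Algebra.norm ℚ_[p] x‖ ≤ 1) ∧
      (IsIntegral ℤ_[p] x → IsIntegral ℤ_[p] (x + 1)) := by
  have hx : IsIntegral ℚ_[p] x := Algebra.IsIntegral.isIntegral x
  have : Fact (Irreducible (minpoly ℚ_[p] x)) := ⟨minpoly.irreducible hx⟩
  have : FiniteDimensional ℚ_[p] (AdjoinRoot (minpoly ℚ_[p] x)) :=
    (AdjoinRoot.powerBasis (minpoly.ne_zero hx)).finite
  let φ : AdjoinRoot (minpoly ℚ_[p] x) →ₐ[ℚ_[p]] D :=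
    Ideal.Quotient.liftₐ _ (Polynomial.aeval x) (by
      intro a ha
      obtain ⟨b, rfl⟩ := Ideal.mem_span_singleton.1 ha
      simp)
  have hr : φ (AdjoinRoot.root _) = x := by
    change Polynomial.aeval x Polynomial.X = x
    simp
  have h := isIntegral_iff_norm_aux φ (AdjoinRoot.root _)
  rwa [hr] at h

theorem isIntegral_iff_norm_le_one (x : D) :
    IsIntegral ℤ_[p] x ↔ ‖Algebra.norm ℚ_[p] x‖ ≤ 1 := (isIntegral_iff_norm_and x).1

theorem isIntegral_mul' {x y : D} (hx : IsIntegral ℤ_[p] x) (hy : IsIntegral ℤ_[p] y) :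
    IsIntegral ℤ_[p] (x * y) := by
  rw [isIntegral_iff_norm_le_one] at *
  rw [map_mul, norm_mul]
  exact mul_le_one₀ hx (norm_nonneg _) hy

theorem isIntegral_add_aux {x y : D} (hy : IsIntegral ℤ_[p] y) (hy0 : y ≠ 0)
    (h : ‖Algebra.norm ℚ_[p] x‖ ≤ ‖Algebra.norm ℚ_[p] y‖) :
    IsIntegral ℤ_[p] (x + y) := by
  have h0 : Algebra.norm ℚ_[p] y ≠ 0 := fun h => hy0 (Algebra.norm_eq_zero_iff.1 h)
  have h1 : IsIntegral ℤ_[p] (x * y⁻¹) := by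
    rw [isIntegral_iff_norm_le_one]
    have h2 : Algebra.norm ℚ_[p] (x * y⁻¹) * Algebra.norm ℚ_[p] y = Algebra.norm ℚ_[p] x := by
      rw [← map_mul, mul_assoc, inv_mul_cancel₀ hy0, mul_one]
    rw [← h2, norm_mul] at h
    exact le_of_mul_le_mul_right (by simpa using h) (norm_pos_iff.2 h0)
  have h3 := isIntegral_mul' ((isIntegral_iff_norm_and _).2 h1) hy
  rwa [add_mul, mul_assoc, inv_mul_cancel₀ hy0, mul_one, one_mul] at h3

theorem isIntegral_add' {x y : D} (hx : IsIntegral ℤ_[p] x) (hy : IsIntegral ℤ_[p] y) :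
    IsIntegral ℤ_[p] (x + y) := by
  rcases eq_or_ne x 0 with rfl | hx0
  · simpa using hy
  rcases eq_or_ne y 0 with rfl | hy0
  · simpa using hx
  rcases le_total ‖Algebra.norm ℚ_[p] x‖ ‖Algebra.norm ℚ_[p] y‖ with h | h
  · exact isIntegral_add_aux hy hy0 h
  · rw [add_comm]
    exact isIntegral_add_aux hx hx0 h

end Integers

/-! Integers, uniformizers and unramified extensions.  For a finite extension, or a
finite-dimensional division algebra, `A` of `ℚ_[p]`, the ring of integers of `A` consists of the
elements that are integral over `ℤ_[p]`. -/

section Local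

variable (p : ℕ) [Fact p.Prime]

/-- `ϖ` generates the maximal ideal of the ring of integers of `A`, i.e. the set of non-units. -/
def IsUniformizer {A : Type*} [DivisionRing A] [Algebra ℤ_[p] A] (ϖ : A) : Prop :=
  ∀ x : A, (IsIntegral ℤ_[p] x ∧ ¬ (x ≠ 0 ∧ IsIntegral ℤ_[p] x⁻¹)) ↔
    ∃ y : A, IsIntegral ℤ_[p] y ∧ x = ϖ * y

/-- `L/K` is unramified: the maximal ideal of the integers of `K` generates that of `L`. -/
def IsUnramifiedExt (K L : Type*) [Field K] [Field L] [Algebra ℤ_[p] K] [Algebra ℤ_[p] L]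
    [Algebra K L] : Prop :=
  ∀ ϖ : K, IsUniformizer p ϖ → IsUniformizer p (algebraMap K L ϖ)

/-- `e` is the ramification index of `K` over `ℚ_[p]`. -/
def IsRamificationIndex (K : Type*) [Field K] [Algebra ℤ_[p] K] (e : ℕ) : Prop :=
  ∃ ϖ u : K, IsUniformizer p ϖ ∧ u ≠ 0 ∧ IsIntegral ℤ_[p] u ∧ IsIntegral ℤ_[p] u⁻¹ ∧
    (p : K) = u * ϖ ^ e

/-- The maximal unramified extension of `ℚ_[p]` inside `K`. -/
def maxUnramified (K : Type*) [Field K] [Algebra ℚ_[p] K] [Algebra ℤ_[p] K]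
    [IsScalarTower ℤ_[p] ℚ_[p] K] : IntermediateField ℚ_[p] K :=
  sSup {E : IntermediateField ℚ_[p] K | IsUnramifiedExt p ℚ_[p] E}

variable {p}

theorem IsUniformizer.map_equiv {A B : Type*} [Field A] [Field B] [Algebra ℤ_[p] A]
    [Algebra ℤ_[p] B] (φ : A ≃ₐ[ℤ_[p]] B) {ϖ : A} (h : IsUniformizer p ϖ) :
    IsUniformizer p (φ ϖ) := by
  have hint : ∀ y : A, IsIntegral ℤ_[p] (φ y) ↔ IsIntegral ℤ_[p] y := fun y =>
    isIntegral_algEquiv φ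
  intro x
  obtain ⟨x, rfl⟩ := φ.surjective x
  rw [← map_inv₀, hint, hint, map_ne_zero, h x]
  constructor
  · rintro ⟨y, hy, rfl⟩
    exact ⟨φ y, (hint y).2 hy, map_mul _ _ _⟩
  · rintro ⟨y, hy, h⟩
    obtain ⟨y, rfl⟩ := φ.surjective y
    exact ⟨y, (hint y).1 hy, φ.injective (by rw [h, map_mul])⟩

section Maps

variable {K L : Type*} [Field K] [Field L] [Algebra ℚ_[p] K] [Algebra ℤ_[p] K]
  [IsScalarTower ℤ_[p] ℚ_[p] K] [Algebra ℚ_[p] L] [Algebra ℤ_[p] L]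
  [IsScalarTower ℤ_[p] ℚ_[p] L]

theorem maxUnramified_le_comap (φ : K →ₐ[ℚ_[p]] L) :
    maxUnramified p K ≤ (maxUnramified p L).comap φ := by
  refine sSup_le fun E hE => ?_
  rw [← IntermediateField.map_le_iff_le_comap]
  refine le_sSup (a := E.map φ) fun ϖ hϖ => ?_
  have h := (hE ϖ hϖ).map_equiv ((E.equivMap φ).restrictScalars ℤ_[p])
  convert h using 1
  exact ((E.equivMap φ).commutes ϖ).symm

/-- An embedding `K → L` over `ℚ_[p]` restricts to the maximal unramified subextensions. -/
def urMap (φ : K →ₐ[ℚ_[p]] L) : maxUnramified p K →ₐ[ℚ_[p]] maxUnramified p L :=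
  AlgHom.codRestrict (φ.comp (maxUnramified p K).val) (maxUnramified p L).toSubalgebra
    fun x => maxUnramified_le_comap φ x.2

end Maps

variable (p) in
/-- The group `K / O_K`, a module over the ring of integers `O_K`. -/
abbrev ModInt (K : Type*) [Field K] [Algebra ℤ_[p] K] : Type _ :=
  K ⧸ (1 : Submodule (integralClosure ℤ_[p] K) K)

instance ModInt.instModule (K : Type*) [Field K] [Algebra ℤ_[p] K] :
    Module (integralClosure ℤ_[p] K) (ModInt p K) :=
  Submodule.Quotient.module (1 : Submodule (integralClosure ℤ_[p] K) K)

instance ModInt.instSMul (K : Type*) [Field K] [Algebra ℤ_[p] K] :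
    SMul (integralClosure ℤ_[p] K) (ModInt p K) :=
  (ModInt.instModule K).toSMul

theorem ModInt.smul_mk {K : Type*} [Field K] [Algebra ℤ_[p] K] (a : integralClosure ℤ_[p] K)
    (x : K) : a • (Submodule.Quotient.mk x : ModInt p K) = Submodule.Quotient.mk ((a : K) * x) :=
  rfl

/-- The map `K / O_K → L / O_L` induced by a map `K → L` that sends `O_K` into `O_L`. -/
def ModInt.map {K L : Type*} [Field K] [Algebra ℤ_[p] K] [Field L] [Algebra ℤ_[p] L]
    (f : K →ₗ[ℤ_[p]] L) (hf : ∀ x, IsIntegral ℤ_[p] x → IsIntegral ℤ_[p] (f x)) :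
    ModInt p K →ₗ[ℤ_[p]] ModInt p L :=
  (Submodule.Quotient.restrictScalarsEquiv ℤ_[p]
      (1 : Submodule (integralClosure ℤ_[p] L) L)).toLinearMap ∘ₗ
    Submodule.mapQ _ _ f (by
      intro x hx
      obtain ⟨y, rfl⟩ := Submodule.mem_one.1 hx
      exact Submodule.mem_one.2 ⟨⟨_, hf _ y.2⟩, rfl⟩) ∘ₗ
    (Submodule.Quotient.restrictScalarsEquiv ℤ_[p]
      (1 : Submodule (integralClosure ℤ_[p] K) K)).symm.toLinearMap

theorem ModInt.map_mk {K L : Type*} [Field K] [Algebra ℤ_[p] K] [Field L] [Algebra ℤ_[p] L]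
    (f : K →ₗ[ℤ_[p]] L) (hf : ∀ x, IsIntegral ℤ_[p] x → IsIntegral ℤ_[p] (f x)) (x : K) :
    ModInt.map f hf (Submodule.Quotient.mk x) = Submodule.Quotient.mk (f x) := rfl

/-- The map `K / O_K → L / O_L` induced by a field embedding. -/
def ModInt.mapHom {K L : Type*} [Field K] [Algebra ℤ_[p] K] [Field L] [Algebra ℤ_[p] L]
    (φ : K →ₐ[ℤ_[p]] L) : ModInt p K →ₗ[ℤ_[p]] ModInt p L :=
  ModInt.map φ.toLinearMap fun _ hx => hx.map φ

variable (p) in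
/-- The trace `L / O_L → K / O_K`, `x + O_L ↦ tr_{L/K} x + O_K`. -/
def ModInt.trace (K L : Type*) [Field K] [Algebra ℤ_[p] K] [Field L] [Algebra ℤ_[p] L]
    [Algebra K L] [IsScalarTower ℤ_[p] K L] [FiniteDimensional K L] :
    ModInt p L →ₗ[ℤ_[p]] ModInt p K :=
  ModInt.map ((Algebra.trace K L).restrictScalars ℤ_[p])
    fun _ hx => Algebra.isIntegral_trace hx

end Local

/-! The division algebra. -/

attribute [local instance] LieRing.ofAssociativeRing

variable (p : ℕ) [Fact p.Prime] (F W D : Type*)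
  [Field F] [Algebra ℚ_[p] F] [Algebra ℤ_[p] F] [IsScalarTower ℤ_[p] ℚ_[p] F]
  [FiniteDimensional ℚ_[p] F]
  [Field W] [Algebra F W] [Algebra ℚ_[p] W] [Algebra ℤ_[p] W] [IsScalarTower ℤ_[p] ℚ_[p] W]
  [IsScalarTower ℚ_[p] F W] [FiniteDimensional ℚ_[p] W]
  [DivisionRing D] [Algebra F D] [Algebra ℚ_[p] D] [Algebra ℤ_[p] D]
  [IsScalarTower ℤ_[p] ℚ_[p] D] [IsScalarTower ℚ_[p] F D] [FiniteDimensional ℚ_[p] D]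

/-- The choices made for a division algebra `D` over `F`: a maximal subfield `W` of `D` (given
with its embedding) that is unramified over `F`, a uniformizer `π` of `D`, and a generator `σ` of
`Gal(W/F)` such that `π w π⁻¹ = σ w` for `w` in `W`. -/
structure Frame where
  emb : W →ₐ[F] D
  finrank_eq : Module.finrank F D = Module.finrank F W ^ 2
  unramified : IsUnramifiedExt p F W
  π : D
  isUniformizer : IsUniformizer p π
  σ : W ≃ₐ[F] W
  generates : ∀ g : W ≃ₐ[F] W, g ∈ Subgroup.zpowers σ
  conj : ∀ w : W, π * emb w * π⁻¹ = emb (σ w)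

namespace Frame

variable {p F W D}
variable (S : Frame p F W D)

/-- The degree `d` of `D`. -/
def d (_S : Frame p F W D) : ℕ := Module.finrank F W

theorem isIntegral_π : IsIntegral ℤ_[p] S.π :=
  ((S.isUniformizer S.π).2 ⟨1, isIntegral_one, (mul_one _).symm⟩).1

/-- `D` as a left vector space over `W`. -/
abbrev leftModule : Module W D := Module.compHom D S.emb.toRingHom

/-- The reduced trace of `a`: the trace of the endomorphism `x ↦ x a` of the left `W`-vector
space `D`. -/
def trd (a : D) : W :=
  letI : Module W D := S.leftModule
  LinearMap.trace W D
    { toFun := fun x => x * a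
      map_add' := fun x y => add_mul x y a
      map_smul' := fun w x => mul_assoc (S.emb w) x a }

theorem trd_add (a b : D) : S.trd (a + b) = S.trd a + S.trd b := by
  let _ : Module W D := S.leftModule
  unfold trd
  rw [← map_add]
  congr 1
  ext x
  exact mul_add x a b

theorem trd_smul (z : ℤ_[p]) (a : D) : S.trd (z • a) = algebraMap ℤ_[p] W z * S.trd a := by
  let _ : Module W D := S.leftModule
  unfold trd
  rw [← smul_eq_mul, ← map_smul]
  congr 1
  ext x
  change x * (z • a) = S.emb (algebraMap ℤ_[p] W z) * (x * a)
  rw [mul_smul_comm, Algebra.smul_def, IsScalarTower.algebraMap_apply ℤ_[p] ℚ_[p] W,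
    IsScalarTower.algebraMap_apply ℚ_[p] F W, AlgHom.commutes,
    ← IsScalarTower.algebraMap_apply ℚ_[p] F D, ← IsScalarTower.algebraMap_apply ℤ_[p] ℚ_[p] D]

theorem trd_mul_comm (a b : D) : S.trd (a * b) = S.trd (b * a) := by
  let _ : Module W D := S.leftModule
  let R : D → D →ₗ[W] D := fun c =>
    { toFun := fun x => x * c
      map_add' := fun x y => add_mul x y c
      map_smul' := fun w x => mul_assoc (S.emb w) x c }
  have h : ∀ c c' : D, S.trd (c * c') = LinearMap.trace W D (R c' * R c) := by
    intro c c'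
    unfold trd
    congr 1
    ext x
    exact (mul_assoc x c c').symm
  rw [h, h, LinearMap.trace_mul_comm]

theorem trd_sub (a b : D) : S.trd (a - b) = S.trd a - S.trd b := by
  rw [eq_sub_iff_add_eq, ← trd_add, sub_add_cancel]

/-- The `ℤ_[p]`-Lie algebra `𝔤_N` of the elements of reduced trace zero in `π ^ N O_D`. -/
def lieAlg (N : ℕ) : LieSubalgebra ℤ_[p] D where
  carrier := {x | (∃ y, IsIntegral ℤ_[p] y ∧ x = S.π ^ N * y) ∧ S.trd x = 0}
  zero_mem' := by
    refine ⟨⟨0, isIntegral_zero, (mul_zero _).symm⟩, ?_⟩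
    simpa using S.trd_smul 0 0
  add_mem' := by
    rintro _ _ ⟨⟨a, ha, rfl⟩, ha'⟩ ⟨⟨b, hb, rfl⟩, hb'⟩
    exact ⟨⟨a + b, isIntegral_add' ha hb, (mul_add _ _ _).symm⟩, by
      rw [trd_add, ha', hb', add_zero]⟩
  smul_mem' := by
    rintro z _ ⟨⟨a, ha, rfl⟩, ha'⟩
    exact ⟨⟨z • a, ha.smul z, (mul_smul_comm _ _ _).symm⟩, by rw [trd_smul, ha', mul_zero]⟩
  lie_mem' := by
    rintro _ _ ⟨⟨a, ha, rfl⟩, -⟩ ⟨⟨b, hb, rfl⟩, -⟩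
    have hπ : IsIntegral ℤ_[p] (S.π ^ N) := by
      induction N with
      | zero => simpa using isIntegral_one
      | succ n ih => rw [pow_succ]; exact isIntegral_mul' ih S.isIntegral_π
    refine ⟨⟨a * (S.π ^ N * b) - b * (S.π ^ N * a), ?_, ?_⟩, ?_⟩
    · rw [sub_eq_add_neg]
      exact isIntegral_add' (isIntegral_mul' ha (isIntegral_mul' hπ hb))
        (isIntegral_mul' hb (isIntegral_mul' hπ ha)).neg
    · rw [LieRing.of_associative_ring_bracket, mul_sub, mul_assoc, mul_assoc]
    · rw [LieRing.of_associative_ring_bracket, trd_sub, trd_mul_comm, sub_self]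

/-- The group `Δ`: the roots of unity in `W` that have order prime to `p` and norm `1` over `F`. -/
def delta (_S : Frame p F W D) : Set W :=
  {g | (∃ m : ℕ, 0 < m ∧ m.Coprime p ∧ g ^ m = 1) ∧ Algebra.norm F g = 1}

/-- The ring of integers `O` of the maximal unramified extension `W_ur` of `ℚ_[p]` in `W`. -/
abbrev O (_S : Frame p F W D) : Type _ := integralClosure ℤ_[p] (maxUnramified p W)

/-- The ring of integers of the maximal unramified extension `F_ur` of `ℚ_[p]` in `F`. -/
abbrev OF (_S : Frame p F W D) : Type _ := integralClosure ℤ_[p] (maxUnramified p F)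

/-- `W_ur / O`. -/
abbrev qW (_S : Frame p F W D) : Type _ := ModInt p (maxUnramified p W)

/-- `F_ur / O_{F_ur}`. -/
abbrev qF (_S : Frame p F W D) : Type _ := ModInt p (maxUnramified p F)

/-- The embedding `F_ur → W_ur`. -/
def inc (_S : Frame p F W D) : maxUnramified p F →ₐ[ℚ_[p]] maxUnramified p W :=
  urMap (IsScalarTower.toAlgHom ℚ_[p] F W)

/-- The embedding `O_{F_ur} → O`. -/
def incO : S.OF →ₐ[ℤ_[p]] S.O := (S.inc.restrictScalars ℤ_[p]).mapIntegralClosure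

/-- The embedding `F_ur / O_{F_ur} → W_ur / O`. -/
def incw : S.qF →ₗ[ℤ_[p]] S.qW := ModInt.mapHom (S.inc.restrictScalars ℤ_[p])

/-- `σ ^ i` on `W_ur`. -/
def sig (i : ℕ) : maxUnramified p W →ₐ[ℚ_[p]] maxUnramified p W :=
  urMap ((S.σ ^ i).toAlgHom.restrictScalars ℚ_[p])

/-- `σ ^ i` on `O`. -/
def sigO (i : ℕ) : S.O →ₐ[ℤ_[p]] S.O := ((S.sig i).restrictScalars ℤ_[p]).mapIntegralClosure

/-- `σ ^ i` on `W_ur / O`. -/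
def sigw (i : ℕ) : S.qW →ₗ[ℤ_[p]] S.qW := ModInt.mapHom ((S.sig i).restrictScalars ℤ_[p])

/-- The trace `tr : W_ur / O → ℚ_p / ℤ_p`. -/
def tr : S.qW →ₗ[ℤ_[p]] ModInt p ℚ_[p] := ModInt.trace p ℚ_[p] (maxUnramified p W)

/-- The trace `Tr : W_ur / O → F_ur / O_{F_ur}`. -/
def Tr : S.qW →ₗ[ℤ_[p]] S.qF :=
  letI : Algebra (maxUnramified p F) (maxUnramified p W) := S.inc.toRingHom.toAlgebra
  haveI : IsScalarTower ℚ_[p] (maxUnramified p F) (maxUnramified p W) :=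
    IsScalarTower.of_algebraMap_eq fun x => (S.inc.commutes x).symm
  haveI : IsScalarTower ℤ_[p] (maxUnramified p F) (maxUnramified p W) :=
    IsScalarTower.of_algebraMap_eq fun x => ((S.inc.restrictScalars ℤ_[p]).commutes x).symm
  haveI : FiniteDimensional (maxUnramified p F) (maxUnramified p W) :=
    Module.Finite.of_restrictScalars_finite ℚ_[p] _ _
  ModInt.trace p (maxUnramified p F) (maxUnramified p W)

/-- `λ(i) = λ + σ(λ) + ⋯ + σ ^ (i - 1) (λ)`. -/
def partialTrace (lam : S.qW) (i : ℕ) : S.qW := ∑ l ∈ Finset.range i, S.sigw l lam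

/-- The inclusion `O ⊆ W ⊆ D`. -/
def toD (α : S.O) : D := S.emb ((α : maxUnramified p W) : W)

/-- `O_i`: all of `O` if `d ∤ i`, and the elements of `O` whose trace to `F` is zero
if `d ∣ i`. -/
def Oi (i : ℕ) : Set S.O :=
  {α | S.d ∣ i → Algebra.trace F W ((α : maxUnramified p W) : W) = 0}

section Forms

variable {N : ℕ}

/-- `ℤ_[p]`-bilinear maps `𝔤_N × 𝔤_N → ℚ_p / ℤ_p`. -/
abbrev Form (N : ℕ) : Type _ := S.lieAlg N →ₗ[ℤ_[p]] S.lieAlg N →ₗ[ℤ_[p]] ModInt p ℚ_[p]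

variable {S}

/-- The 2-cocycles of `𝔤_N` with values in the trivial module `ℚ_p / ℤ_p`. -/
def IsTwoCocycle (C : S.Form N) : Prop :=
  (∀ x, C x x = 0) ∧ ∀ x y z, C ⁅x, y⁆ z + C ⁅y, z⁆ x + C ⁅z, x⁆ y = 0

/-- `C(u^g, v^g) = C(u, v)` for `g` in `Δ`, where `u^g = g⁻¹ u g`. -/
def IsDeltaInvariant (C : S.Form N) : Prop :=
  ∀ g ∈ S.delta, ∀ u v u' v' : S.lieAlg N,
    (u' : D) = (S.emb g)⁻¹ * u * S.emb g → (v' : D) = (S.emb g)⁻¹ * v * S.emb g →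
      C u' v' = C u v

/-- `(i, j)` is a regular pair for `C` and `λ_{i,j}(C) = lam`: for all `α` in `O_i` and `β`
in `O_j` one has `C(α π ^ i, β π ^ j) = tr(lam α σ ^ i (β))`, and in the case where this does not
determine `lam` (namely `d = 2`, and both `i` and `j` are even), `lam` is the solution in
`F_ur / O_{F_ur}`. -/
def IsLambda (C : S.Form N) (i j : ℕ) (lam : S.qW) : Prop :=
  (∀ α ∈ S.Oi i, ∀ β ∈ S.Oi j, ∀ u v : S.lieAlg N,
    (u : D) = S.toD α * S.π ^ i → (v : D) = S.toD β * S.π ^ j →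
      C u v = S.tr ((α * S.sigO i β) • lam)) ∧
  (S.d = 2 → S.d ∣ i → S.d ∣ j → lam ∈ LinearMap.range S.incw)

/-- `κ_n`, `n ≥ 2 f + 1`, is a defining sequence of the form `C` on `𝔤_{df+1}`. -/
def IsDefiningSequence {f : ℕ} (C : S.Form (S.d * f + 1)) (κ : ℕ → S.qW) : Prop :=
  ∀ i j : ℕ, S.d * f + 1 ≤ i → S.d * f + 1 ≤ j →
    IsLambda C i j (if S.d ∣ i + j then S.partialTrace (κ ((i + j) / S.d)) i else 0)

/-- The regular forms on `𝔤_{df+1}`. -/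
def IsRegular {f : ℕ} (C : S.Form (S.d * f + 1)) : Prop :=
  ∃ κ : ℕ → S.qW, IsDefiningSequence C κ

end Forms

/-- Compatible sequences `κ_n`, `n ≥ 2 f + 1`, with respect to the coefficients `c_k` of the
equation `τ ^ e = p ∑ c_k τ ^ k`. -/
def IsCompatible (f : ℕ) {e : ℕ} (c : Fin e → S.OF) (κ : ℕ → S.qW) : Prop :=
  ∀ n : ℕ, 2 * f + 1 ≤ n →
    κ (n + e) = p • ∑ k : Fin e, S.incO (c k) • κ (n + k) ∧ n • S.Tr (κ n) = 0

end Frame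

end NormOne

end

/-! Every element of `π ^ N O_D` is uniquely `∑ α_i π ^ (N + i)`, `0 ≤ i < d e`, with `α_i` in `O`
(`monoSum_bijective`). A bilinear form can therefore be prescribed freely on pairs of monomials with
exponents in that range. The prescription is `tr(κ_n(i) α σ ^ i (β))` when `i + j = d n`, and `0`
when `d ∤ i + j`. The same formula holds for all exponents provided it respects `τ ^ e = p ∑ c_k τ ^
k` in each argument. On the right this is (C1). On the left the partial trace also changes, `κ(i + d
k) = κ(i) + k Tr(κ)`; by (C2) `k Tr(κ_{n+k}) = -n Tr(κ_{n+k})`, whose factor is independent of `k`,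
so (C1) applies again (`lam_add_left`, `form_mono`).

The remaining identities come from `λ(i + j) = λ(i) + σ ^ i (λ(j))`, `λ(d n) = n Tr(λ)` and the
`σ`-invariance of `tr`. On monomials both `B(x, y) + B(y, x)` and `B(xy, z) + B(yz, x) + B(zx, y)`
reduce to `tr` of multiples of `n Tr(κ_n) = 0`. The cyclic identity for the associative product
implies the cocycle identity for the commutator, and `p` odd turns antisymmetry into alternation.

Conversely, if `d ∤ i` then `α π ^ i` has reduced trace zero for every `α` in `O`, and the trace
pairing of `W_ur` is perfect, so identities for `C` become identities in `W_ur / O`. Alternation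
gives (C2). Evaluating `C` on the relation for `τ` shows that the defect `ε` of (C1) at `n`
satisfies `ε(i) = n Tr(ε)` for all admissible `i` (`partialTrace_defect`). If `d ≥ 3`, comparing `i
= d f + 1` with `i = d f + 2` gives `σ(ε) = 0`. If `d = 2`, admissible `i` are odd: two of them give
`Tr(ε) = 0` and then `ε = 0`, but for `n = 2 f + 1` there is only one, and it yields just `(2 f + 1)
ε = 0`, whence the exception.

The arithmetic input is that `W_ur` is generated by a root of unity of order prime to `p`, and that
`p` has the value of `π ^ (d e)` in `D` (`val_p_eq`), which rests on the commutativity of the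
residue ring of `D`. -/

noncomputable section
namespace NormOne
open scoped NNReal
open IntermediateField
-- The norm valuation and its finite residue field
section Valuation
variable {p : ℕ} [Fact p.Prime]

variable {A : Type*} [DivisionRing A] [Algebra ℚ_[p] A] [Algebra ℤ_[p] A]
  [IsScalarTower ℤ_[p] ℚ_[p] A] [FiniteDimensional ℚ_[p] A]

variable (p A) in
/-- The valuation `x ↦ |N(x)|` of a finite-dimensional division algebra over `ℚ_[p]`. -/
def val : Valuation A ℝ≥0 where
  toFun x := ‖Algebra.norm ℚ_[p] x‖₊
  map_zero' := by simp
  map_one' := by simp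
  map_mul' x y := by simp
  map_add_le_max' x y := by
    -- Dividing by the larger element reduces the ultrametric inequality to the integrality of `z +
    -- 1` for integral `z`.
    have key : ∀ x y : A, ‖Algebra.norm ℚ_[p] x‖ ≤ ‖Algebra.norm ℚ_[p] y‖ →
        ‖Algebra.norm ℚ_[p] (x + y)‖ ≤ ‖Algebra.norm ℚ_[p] y‖ := by
      intro x y h
      rcases eq_or_ne y 0 with rfl | hy
      · have : x = 0 := by
          rw [← Algebra.norm_eq_zero_iff (R := ℚ_[p]), ← norm_le_zero_iff]
          simpa using h
        simp [this]
      have h0 : Algebra.norm ℚ_[p] y ≠ 0 := fun h => hy (Algebra.norm_eq_zero_iff.1 h)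
      have h2 : Algebra.norm ℚ_[p] (x * y⁻¹) * Algebra.norm ℚ_[p] y = Algebra.norm ℚ_[p] x := by
        rw [← map_mul, mul_assoc, inv_mul_cancel₀ hy, mul_one]
      have h1 : IsIntegral ℤ_[p] (x * y⁻¹) := by
        rw [isIntegral_iff_norm_le_one]
        rw [← h2, norm_mul] at h
        exact le_of_mul_le_mul_right (by simpa using h) (norm_pos_iff.2 h0)
      have h3 := (isIntegral_iff_norm_le_one _).1 (isIntegral_add' h1 isIntegral_one)
      have h4 : Algebra.norm ℚ_[p] (x * y⁻¹ + 1) * Algebra.norm ℚ_[p] y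
          = Algebra.norm ℚ_[p] (x + y) := by
        rw [← map_mul, add_mul, mul_assoc, inv_mul_cancel₀ hy, mul_one, one_mul]
      rw [← h4, norm_mul]
      exact mul_le_of_le_one_left (norm_nonneg _) h3
    rcases le_total ‖Algebra.norm ℚ_[p] x‖ ‖Algebra.norm ℚ_[p] y‖ with h | h
    · exact le_max_of_le_right (key x y h)
    · rw [add_comm]
      exact le_max_of_le_left (key y x h)

theorem val_apply (x : A) : val p A x = ‖Algebra.norm ℚ_[p] x‖₊ := rfl

theorem val_le_one_iff {x : A} : val p A x ≤ 1 ↔ IsIntegral ℤ_[p] x := by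
  rw [isIntegral_iff_norm_le_one]; rfl

theorem val_p_lt_one : val p A (p : A) < 1 := by
  have : (p : A) = algebraMap ℚ_[p] A p := by simp
  rw [this, val_apply, Algebra.norm_algebraMap, nnnorm_pow]
  refine pow_lt_one₀ (by positivity) ?_ Module.finrank_pos.ne'
  exact Padic.norm_p_lt_one

include p in
variable (p A) in
theorem natCast_prime_ne_zero : (p : A) ≠ 0 := by
  have : CharZero A := charZero_of_injective_algebraMap (algebraMap ℚ_[p] A).injective
  exact_mod_cast (Fact.out : p.Prime).ne_zero


theorem val_lt_one_iff {x : A} :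
    val p A x < 1 ↔ IsIntegral ℤ_[p] x ∧ ¬ (x ≠ 0 ∧ IsIntegral ℤ_[p] x⁻¹) := by
  rw [← val_le_one_iff, ← val_le_one_iff, map_inv₀]
  rcases eq_or_ne x 0 with rfl | hx
  · simp
  have h0 : 0 < val p A x := by simpa [zero_lt_iff] using hx
  rw [inv_le_one₀ h0]
  constructor
  · intro h
    exact ⟨h.le, fun h' => h.not_ge h'.2⟩
  · intro h
    by_contra! h'
    exact h.2 ⟨hx, h'⟩

/-- Divisibility among integers is comparison of values, so a generator of the maximal ideal is an
element of largest value below `1`. It is nonzero because `p` is a nonzero non-unit. -/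
theorem isUniformizer_iff {ϖ : A} :
    IsUniformizer p ϖ ↔ ϖ ≠ 0 ∧ val p A ϖ < 1 ∧ ∀ x, val p A x < 1 → val p A x ≤ val p A ϖ := by
  unfold IsUniformizer
  simp only [← val_lt_one_iff]
  simp only [← val_le_one_iff]
  constructor
  · intro h
    have h1 : ∀ x, val p A x < 1 → val p A x ≤ val p A ϖ := by
      intro x hx
      obtain ⟨y, hy, rfl⟩ := (h x).1 hx
      rw [map_mul]
      exact mul_le_of_le_one_right' hy
    refine ⟨?_, (h ϖ).2 ⟨1, by simp, by simp⟩, h1⟩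
    rintro rfl
    have := h1 p val_p_lt_one
    simp [natCast_prime_ne_zero p A] at this
  · rintro ⟨h0, h1, h2⟩ x
    constructor
    · intro hx
      refine ⟨ϖ⁻¹ * x, ?_, by rw [mul_inv_cancel_left₀ h0]⟩
      have h3 : 0 < val p A ϖ := by simpa [zero_lt_iff] using h0
      rw [map_mul, map_inv₀, inv_mul_le_iff₀ h3, mul_one]
      exact h2 x hx
    · rintro ⟨y, hy, rfl⟩
      rw [map_mul]
      exact (mul_le_of_le_one_right' hy).trans_lt h1

theorem IsUniformizer.ne_zero {ϖ : A} (h : IsUniformizer p ϖ) : ϖ ≠ 0 := (isUniformizer_iff.1 h).1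

theorem IsUniformizer.val_lt_one {ϖ : A} (h : IsUniformizer p ϖ) : val p A ϖ < 1 :=
  (isUniformizer_iff.1 h).2.1

theorem IsUniformizer.val_pos {ϖ : A} (h : IsUniformizer p ϖ) : 0 < val p A ϖ := by
  simpa [zero_lt_iff] using h.ne_zero

/-- Multiplying by a power of `ϖ` moves the value into `(val ϖ, 1]`, and by maximality no value lies
strictly between `val ϖ` and `1`. -/
theorem IsUniformizer.exists_zpow {ϖ : A} (h : IsUniformizer p ϖ) {x : A} (hx : x ≠ 0) :
    ∃ n : ℤ, val p A x = val p A ϖ ^ n := by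
  have hx0 : 0 < val p A x := by simpa [zero_lt_iff] using hx
  obtain ⟨n, hn1, hn2⟩ := exists_mem_Ioc_zpow (x := (val p A x)) hx0
    ((one_lt_inv₀ h.val_pos).2 h.val_lt_one)
  have hv : val p A (x * ϖ ^ (n + 1)) = val p A x * val p A ϖ ^ (n + 1) := by simp
  have h1 : val p A (x * ϖ ^ (n + 1)) ≤ 1 := by
    rw [hv]
    rw [inv_zpow] at hn2
    have := mul_le_mul_left hn2 (val p A ϖ ^ (n + 1))
    rwa [inv_mul_cancel₀ (zpow_ne_zero _ h.val_pos.ne')] at this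
  have h2 : val p A ϖ < val p A (x * ϖ ^ (n + 1)) := by
    rw [hv]
    rw [inv_zpow] at hn1
    have := mul_lt_mul_of_pos_right hn1 (zpow_pos h.val_pos (n + 1))
    rwa [zpow_add_one₀ h.val_pos.ne', inv_mul_cancel_left₀ (zpow_ne_zero _ h.val_pos.ne'),
      ← zpow_add_one₀ h.val_pos.ne'] at this
  have h3 : val p A (x * ϖ ^ (n + 1)) = 1 := by
    refine le_antisymm h1 (not_lt.1 fun h4 => ?_)
    exact h2.not_ge ((isUniformizer_iff.1 h).2.2 _ h4)
  refine ⟨-(n + 1), ?_⟩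
  rw [hv] at h3
  rw [zpow_neg]
  exact eq_inv_of_mul_eq_one_left h3

/-! The residue ring is finite. -/

variable (p A) in
/-- The maximal ideal of the valuation ring. -/
def maxIdeal : Ideal (val p A).integer where
  carrier := {x | val p A x < 1}
  zero_mem' := by simp
  add_mem' {x y} hx hy := by
    exact (val p A).map_add_lt hx hy
  smul_mem' c x hx := by
    change val p A (c * x) < 1
    rw [map_mul]
    exact (mul_le_of_le_one_left' c.2).trans_lt hx

theorem mem_maxIdeal {x : (val p A).integer} : x ∈ maxIdeal p A ↔ val p A x < 1 := Iff.rfl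

instance : (maxIdeal p A).IsTwoSided := ⟨fun {x} c hx => by
  rw [mem_maxIdeal] at *
  change val p A (x * c) < 1
  rw [map_mul]
  exact (mul_le_of_le_one_right' c.2).trans_lt hx⟩

variable (p A) in
/-- The residue ring of the valuation ring. -/
abbrev ResRing : Type _ := (val p A).integer ⧸ maxIdeal p A

instance : Nontrivial (ResRing p A) :=
  Ideal.Quotient.nontrivial_iff.2 (by
    intro h
    have : (1 : (val p A).integer) ∈ maxIdeal p A := by rw [h]; trivial
    rw [mem_maxIdeal] at this
    simp at this)

instance : NoZeroDivisors (ResRing p A) where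
  eq_zero_or_eq_zero_of_mul_eq_zero {a b} h := by
    obtain ⟨a, rfl⟩ := Ideal.Quotient.mk_surjective a
    obtain ⟨b, rfl⟩ := Ideal.Quotient.mk_surjective b
    rw [← map_mul, Ideal.Quotient.eq_zero_iff_mem, mem_maxIdeal] at h
    rw [Ideal.Quotient.eq_zero_iff_mem, Ideal.Quotient.eq_zero_iff_mem, mem_maxIdeal, mem_maxIdeal]
    by_contra! h'
    have h1 := mul_le_mul' h'.1 h'.2
    rw [← map_mul, one_mul] at h1
    exact h1.not_gt h

instance : CharP (ResRing p A) p := by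
  have h : ringChar (ResRing p A) = p := by
    refine CharP.ringChar_of_prime_eq_zero Fact.out ?_
    rw [← map_natCast (Ideal.Quotient.mk (maxIdeal p A)), Ideal.Quotient.eq_zero_iff_mem,
      mem_maxIdeal]
    exact_mod_cast val_p_lt_one
  exact ringChar.of_eq h

theorem val_algebraMap_le (a : ℤ_[p]) : val p A (algebraMap ℤ_[p] A a) ≤ 1 :=
  val_le_one_iff.2 isIntegral_algebraMap

theorem val_algebraMap_sub_toZMod (a : ℤ_[p]) :
    val p A (algebraMap ℤ_[p] A a - ((PadicInt.toZMod a).val : A)) < 1 := by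
  have h := PadicInt.toZMod_spec a
  rw [PadicInt.maximalIdeal_eq_span_p, Ideal.mem_span_singleton] at h
  obtain ⟨b, hb⟩ := h
  have h2 : algebraMap ℤ_[p] A a - ((PadicInt.toZMod a).val : A) = p * algebraMap ℤ_[p] A b := by
    rw [← map_natCast (algebraMap ℤ_[p] A), ← map_sub, ZMod.natCast_val, hb, map_mul, map_natCast]
  rw [h2, map_mul]
  exact (mul_le_of_le_one_right' (val_algebraMap_le b)).trans_lt val_p_lt_one

-- Lifts of independent residues stay independent over `ℚ_[p]`: a relation scaled so that its
-- largest coefficient is `1` would reduce to a nontrivial relation over `ZMod p`. This bounds the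
-- size of the residue ring.
attribute [local instance] ZMod.algebra in
theorem finite_resRing_aux (s : Finset (ResRing p A))
    (hs : LinearIndependent (ZMod p) (fun i : s => (i : ResRing p A))) :
    s.card ≤ Module.finrank ℚ_[p] A := by
  choose x hx using fun i : s => Ideal.Quotient.mk_surjective (I := maxIdeal p A) i.1
  suffices h : LinearIndependent ℚ_[p] (fun i => (x i : A)) by
    simpa using h.fintype_card_le_finrank
  rw [Fintype.linearIndependent_iff] at hs ⊢
  intro g hg
  by_contra! hne
  obtain ⟨i₁, hi₁⟩ := hne
  obtain ⟨i₀, -, hi₀⟩ := Finset.exists_max_image Finset.univ (fun i => ‖g i‖) ⟨i₁, Finset.mem_univ _⟩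
  have hg0 : 0 < ‖g i₀‖ := (norm_pos_iff.2 hi₁).trans_le (hi₀ i₁ (Finset.mem_univ _))
  have hle : ∀ i, ‖g i / g i₀‖ ≤ 1 := fun i => by
    rw [norm_div, div_le_one hg0]
    exact hi₀ i (Finset.mem_univ _)
  let b : s → ℤ_[p] := fun i => ⟨g i / g i₀, hle i⟩
  have hb : ∀ i, algebraMap ℤ_[p] A (b i) * x i = (g i₀)⁻¹ • (g i • (x i : A)) := by
    intro i
    rw [smul_smul, IsScalarTower.algebraMap_apply ℤ_[p] ℚ_[p] A, ← Algebra.smul_def]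
    congr 1
    change g i / g i₀ = _
    rw [div_eq_inv_mul]
  have hsum : ∑ i, algebraMap ℤ_[p] A (b i) * x i = 0 := by
    simp_rw [hb, ← Finset.smul_sum, hg, smul_zero]
  have hb0 : b i₀ = 1 := Subtype.ext (div_self (norm_pos_iff.1 hg0))
  have := hs (fun i => PadicInt.toZMod (b i)) ?_ i₀
  · simp [hb0] at this
  · have h1 : ∑ i, PadicInt.toZMod (b i) • (i : ResRing p A)
        = Ideal.Quotient.mk (maxIdeal p A) (∑ i, ((PadicInt.toZMod (b i)).val : (val p A).integer) * x i) := by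
      rw [map_sum]
      refine Finset.sum_congr rfl fun i _ => ?_
      rw [map_mul, hx, Algebra.smul_def, map_natCast]
      congr 1
      rw [← map_natCast (algebraMap (ZMod p) (ResRing p A)), ZMod.natCast_zmod_val]
    rw [h1, Ideal.Quotient.eq_zero_iff_mem, mem_maxIdeal]
    have h2 : ((∑ i, ((PadicInt.toZMod (b i)).val : (val p A).integer) * x i : (val p A).integer) : A)
        = - ∑ i, (algebraMap ℤ_[p] A (b i) - ((PadicInt.toZMod (b i)).val : A)) * x i := by
      simp_rw [sub_mul, Finset.sum_sub_distrib, hsum]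
      simp
    rw [h2, Valuation.map_neg]
    refine (val p A).map_sum_lt one_ne_zero fun i _ => ?_
    rw [map_mul]
    exact (mul_le_of_le_one_right' (x i).2).trans_lt (val_algebraMap_sub_toZMod _)

instance : Finite (ResRing p A) := by
  let _ : Algebra (ZMod p) (ResRing p A) := ZMod.algebra _ p
  have h : Module.rank (ZMod p) (ResRing p A) ≤ (Module.finrank ℚ_[p] A : ℕ) :=
    rank_le finite_resRing_aux
  have : Module.Finite (ZMod p) (ResRing p A) := by
    rw [← Module.rank_lt_aleph0_iff]
    exact h.trans_lt (Cardinal.natCast_lt_aleph0)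
  exact Module.finite_of_finite (ZMod p)

/-- Wedderburn's little theorem. Its point is commutativity when `A` is the division algebra. -/
theorem isField_resRing : IsField (ResRing p A) := by
  have : IsDomain (ResRing p A) := NoZeroDivisors.to_isDomain _
  exact Finite.isDomain_to_isField _

theorem val_mul_sub_mul_lt {x y : A} (hx : val p A x ≤ 1) (hy : val p A y ≤ 1) :
    val p A (x * y - y * x) < 1 := by
  have h := isField_resRing.mul_comm (Ideal.Quotient.mk (maxIdeal p A) ⟨x, hx⟩)
    (Ideal.Quotient.mk (maxIdeal p A) ⟨y, hy⟩)
  rw [← map_mul, ← map_mul, Ideal.Quotient.eq, mem_maxIdeal] at h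
  exact h

variable (p A) in
/-- Some power of `p` acts as a Frobenius that is trivial on the residue ring. -/
theorem exists_pow_sub_lt : ∃ s : ℕ, 0 < s ∧ ∀ x : A, val p A x ≤ 1 →
    val p A (x ^ p ^ s - x) < 1 := by
  let _ : Field (ResRing p A) := isField_resRing.toField
  let _ : Fintype (ResRing p A) := Fintype.ofFinite _
  obtain ⟨s, hs⟩ := FiniteField.card (ResRing p A) p
  refine ⟨s, s.pos, fun x hx => ?_⟩
  have h := FiniteField.pow_card (Ideal.Quotient.mk (maxIdeal p A) ⟨x, hx⟩)
  rw [hs.2, ← map_pow, Ideal.Quotient.eq, mem_maxIdeal] at h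
  exact h

end Valuation

/-! ### Comparison of values under embeddings -/

section Maps
variable {p : ℕ} [Fact p.Prime]
variable {A : Type*} [DivisionRing A] [Algebra ℚ_[p] A] [Algebra ℤ_[p] A]
  [IsScalarTower ℤ_[p] ℚ_[p] A] [FiniteDimensional ℚ_[p] A]
variable {B : Type*} [DivisionRing B] [Algebra ℚ_[p] B] [Algebra ℤ_[p] B]
  [IsScalarTower ℤ_[p] ℚ_[p] B] [FiniteDimensional ℚ_[p] B]

/-- An embedding changes the norm valuation by a power, so only comparisons of values are
transported; they all follow from this invariance of integrality. -/
theorem val_map_le_one_iff (φ : A →ₐ[ℚ_[p]] B) {x : A} : val p B (φ x) ≤ 1 ↔ val p A x ≤ 1 := by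
  rw [val_le_one_iff, val_le_one_iff]
  exact isIntegral_algHom_iff (φ.restrictScalars ℤ_[p]) φ.toRingHom.injective

theorem val_map_lt_one_iff (φ : A →ₐ[ℚ_[p]] B) {x : A} : val p B (φ x) < 1 ↔ val p A x < 1 := by
  rcases eq_or_ne x 0 with rfl | hx
  · simp
  have h := val_map_le_one_iff φ (x := x⁻¹)
  have h1 : 0 < val p A x := by simpa [zero_lt_iff] using hx
  have h2 : 0 < val p B (φ x) := by simpa [zero_lt_iff] using hx
  rw [map_inv₀, map_inv₀, map_inv₀, inv_le_one₀ h1, inv_le_one₀ h2] at h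
  rw [← not_le, ← not_le, h]

theorem val_map_le_iff (φ : A →ₐ[ℚ_[p]] B) {x y : A} :
    val p B (φ x) ≤ val p B (φ y) ↔ val p A x ≤ val p A y := by
  rcases eq_or_ne y 0 with rfl | hy
  · simp
  have h := val_map_le_one_iff φ (x := x * y⁻¹)
  have h1 : 0 < val p A y := by simpa [zero_lt_iff] using hy
  have h2 : 0 < val p B (φ y) := by simpa [zero_lt_iff] using hy
  rwa [map_mul, map_mul, map_mul, map_inv₀, map_inv₀, map_inv₀, mul_inv_le_iff₀ h1,
    mul_inv_le_iff₀ h2, one_mul, one_mul] at h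

theorem val_map_eq_iff (φ : A →ₐ[ℚ_[p]] B) {x y : A} :
    val p B (φ x) = val p B (φ y) ↔ val p A x = val p A y := by
  rw [le_antisymm_iff, le_antisymm_iff, val_map_le_iff, val_map_le_iff]

theorem val_map_eq_one_iff (φ : A →ₐ[ℚ_[p]] B) {x : A} : val p B (φ x) = 1 ↔ val p A x = 1 := by
  simpa using val_map_eq_iff φ (x := x) (y := 1)

end Maps

/-! ### Teichmüller representatives -/

section Teichmuller
variable {p : ℕ} [Fact p.Prime]
variable {K : Type*} [Field K] [Algebra ℚ_[p] K] [Algebra ℤ_[p] K]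
  [IsScalarTower ℤ_[p] ℚ_[p] K] [FiniteDimensional ℚ_[p] K]

/-- Links `val` to a norm for which `K` is complete, so that limits can be taken. -/
theorem spectralNorm_le_one_iff {x : K} : spectralNorm ℚ_[p] K x ≤ 1 ↔ val p K x ≤ 1 := by
  rw [val_le_one_iff, isIntegral_iff_coeff, spectralNorm.spectralNorm_eq_norm_coeff_zero_rpow]
  have hx : IsIntegral ℚ_[p] x := Algebra.IsIntegral.isIntegral x
  have h := Real.rpow_le_rpow_iff (norm_nonneg ((minpoly ℚ_[p] x).coeff 0)) zero_le_one
    (z := 1 / ((minpoly ℚ_[p] x).natDegree : ℝ))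
    (one_div_pos.2 (Nat.cast_pos.2 (minpoly.natDegree_pos hx)))
  rwa [Real.one_rpow] at h

theorem exists_pow_add (a b : K) (ha : val p K a ≤ 1) (hb : val p K b ≤ 1) (n : ℕ) :
    ∃ k : K, val p K k ≤ 1 ∧ (a + b) ^ n = a ^ n + n * a ^ (n - 1) * b + k * b ^ 2 := by
  obtain ⟨k, hk⟩ := Polynomial.powAddExpansion (⟨a, val_le_one_iff.1 ha⟩ : integralClosure ℤ_[p] K)
    ⟨b, val_le_one_iff.1 hb⟩ n
  exact ⟨k, val_le_one_iff.2 k.2, congrArg Subtype.val hk⟩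

/-- The representative is the limit of `x ^ q ^ n` with `q = p ^ s`, because raising to the power
`q` contracts the successive differences. -/
theorem exists_teichmuller {s : ℕ} (hs : 0 < s) {x : K} (hx : val p K x ≤ 1)
    (hx' : val p K (x ^ p ^ s - x) < 1) : ∃ t : K, t ^ p ^ s = t ∧ val p K (t - x) < 1 := by
  let _ : NormedField K := spectralNorm.normedField ℚ_[p] K
  have _ : CompleteSpace K := spectralNorm.completeSpace ℚ_[p] K
  have hle : ∀ y : K, ‖y‖ ≤ 1 ↔ val p K y ≤ 1 := fun y => spectralNorm_le_one_iff
  have hlt : ∀ y : K, ‖y‖ < 1 ↔ val p K y < 1 := by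
    intro y
    rcases eq_or_ne y 0 with rfl | hy
    · simp
    have h := hle y⁻¹
    rw [map_inv₀, norm_inv, inv_le_one₀ (norm_pos_iff.2 hy),
      inv_le_one₀ (by simpa [zero_lt_iff] using hy)] at h
    rw [← not_le, ← not_le, h]
  have hna : ∀ y z : K, ‖y + z‖ ≤ max ‖y‖ ‖z‖ := isNonarchimedean_spectralNorm
  set q := p ^ s with hq
  -- The bound `c` dominates the first difference and the linear factor `q` in `(u + δ) ^ q = u ^ q
  -- + q u ^ (q - 1) δ + k δ ^ 2`; the quadratic term is handled by `‖δ‖ ≤ c`.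
  set c : ℝ := max ‖(q : K)‖ ‖x ^ q - x‖ with hc
  have hc0 : 0 ≤ c := le_max_of_le_left (norm_nonneg _)
  have hc1 : c < 1 := by
    refine max_lt ?_ ((hlt _).2 hx')
    rw [hlt, hq, Nat.cast_pow, map_pow]
    exact pow_lt_one₀ zero_le val_p_lt_one hs.ne'
  let u : ℕ → K := fun n => x ^ q ^ n
  have hu1 : ∀ n, ‖u n‖ ≤ 1 := fun n => by
    rw [norm_pow]
    exact pow_le_one₀ (norm_nonneg _) ((hle _).2 hx)
  have hus : ∀ n, u (n + 1) = u n ^ q := fun n => by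
    change x ^ q ^ (n + 1) = (x ^ q ^ n) ^ q
    rw [pow_succ q n, pow_mul]
  have hstep : ∀ n, ‖u (n + 1) - u n‖ ≤ c ^ (n + 1) := by
    intro n
    induction n with
    | zero =>
      simp only [u, zero_add, pow_one, pow_zero]
      exact le_max_right _ _
    | succ n ih =>
      have hd1 : ‖u (n + 1) - u n‖ ≤ 1 := ih.trans (pow_le_one₀ hc0 hc1.le)
      obtain ⟨k, hk, hk'⟩ := exists_pow_add (u n) (u (n + 1) - u n) ((hle _).1 (hu1 n))
        ((hle _).1 hd1) q
      rw [add_sub_cancel, ← hus, ← hus] at hk'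
      have h3 : u (n + 1 + 1) - u (n + 1)
          = q * u n ^ (q - 1) * (u (n + 1) - u n) + k * (u (n + 1) - u n) ^ 2 := by
        rw [hk']; ring
      rw [h3]
      refine (hna _ _).trans (max_le ?_ ?_)
      · rw [norm_mul, norm_mul, pow_succ' c]
        refine mul_le_mul ?_ ih (norm_nonneg _) hc0
        refine (mul_le_of_le_one_right (norm_nonneg _) ?_).trans (le_max_left _ _)
        rw [norm_pow]
        exact pow_le_one₀ (norm_nonneg _) (hu1 n)
      · rw [norm_mul, norm_pow]
        refine (mul_le_of_le_one_left (by positivity) ((hle _).2 hk)).trans ?_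
        rw [pow_two, pow_succ' c]
        refine mul_le_mul (ih.trans ?_) ih (norm_nonneg _) hc0
        exact pow_le_of_le_one hc0 hc1.le (Nat.succ_ne_zero _)
  have hcau : CauchySeq u := by
    refine cauchySeq_of_le_geometric c c hc1 fun n => ?_
    rw [dist_comm, dist_eq_norm, ← pow_succ']
    exact hstep n
  obtain ⟨t, ht⟩ := cauchySeq_tendsto_of_complete hcau
  refine ⟨t, ?_, ?_⟩
  · have h1 := (Filter.tendsto_add_atTop_iff_nat 1).2 ht
    simp_rw [hus] at h1
    exact tendsto_nhds_unique (ht.pow q) h1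
  · rw [← hlt]
    refine lt_of_le_of_lt (b := c) ?_ hc1
    have hdist : ∀ n, ‖u n - x‖ ≤ c := by
      intro n
      induction n with
      | zero => simpa [u] using hc0
      | succ n ih =>
        rw [← sub_add_sub_cancel _ (u n)]
        exact (hna _ _).trans
          (max_le ((hstep n).trans (pow_le_of_le_one hc0 hc1.le (Nat.succ_ne_zero _))) ih)
    exact le_of_tendsto ((ht.sub_const x).norm) (Filter.Eventually.of_forall hdist)

/-- Roots of unity of order prime to `p` are determined by their residues. -/
theorem eq_one_of_val_sub_one_lt {x : K} {m : ℕ} (hm : m.Coprime p) (hx : x ^ m = 1)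
    (h : val p K (x - 1) < 1) : x = 1 := by
  -- Expanding `(1 + (x - 1)) ^ m = 1` gives `(m + k (x - 1)) (x - 1) = 0`, and the first factor is
  -- nonzero since `m` is prime to `p`.
  obtain ⟨k, hk, hk'⟩ := exists_pow_add (p := p) 1 (x - 1) (by simp) h.le m
  rw [add_sub_cancel, hx, one_pow, one_pow, mul_one, add_assoc, left_eq_add, pow_two, ← mul_assoc,
    ← add_mul] at hk'
  rcases mul_eq_zero.1 hk' with h0 | h0
  · exfalso
    have h1 : val p K (m : K) < 1 := by
      rw [eq_neg_of_add_eq_zero_left h0, Valuation.map_neg, map_mul]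
      exact (mul_le_of_le_one_left' hk).trans_lt h
    obtain ⟨a, b, hab⟩ : ∃ a b : ℤ, a * m + b * p = 1 := by
      have := Int.isCoprime_iff_gcd_eq_one.2 (by simpa using hm : Int.gcd m p = 1)
      exact this
    have hint : ∀ a : ℤ, val p K (a : K) ≤ 1 := fun a => by
      rw [val_le_one_iff, ← map_intCast (algebraMap ℤ_[p] K)]
      exact isIntegral_algebraMap
    have h2 : val p K ((a : K) * m + b * p) < 1 := by
      refine (val p K).map_add_lt ?_ ?_
      · rw [map_mul]; exact (mul_le_of_le_one_left' (hint a)).trans_lt h1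
      · rw [map_mul]; exact (mul_le_of_le_one_left' (hint b)).trans_lt val_p_lt_one
    have h3 : (a : K) * m + b * p = 1 := by exact_mod_cast congrArg (Int.cast (R := K)) hab
    simp [h3] at h2
  · exact sub_eq_zero.1 h0

variable (p K) in
/-- There is a root of unity of order prime to `p` whose powers represent all nonzero residues. -/
theorem exists_primitiveRoot : ∃ (ζ : K) (n : ℕ), 0 < n ∧ n.Coprime p ∧ IsPrimitiveRoot ζ n ∧
    ∀ x : K, val p K x = 1 → ∃ i : ℕ, val p K (ζ ^ i - x) < 1 := by
  obtain ⟨s, hs, hq⟩ := exists_pow_sub_lt p K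
  have hp1 : 1 < p ^ s := Nat.one_lt_pow hs.ne' (Fact.out : p.Prime).one_lt
  have : NeZero (p ^ s - 1) := ⟨by omega⟩
  -- The Teichmüller representatives of units are roots of unity of order dividing `p ^ s - 1`,
  -- which form a cyclic group.
  obtain ⟨ζ, hζ⟩ := IsCyclic.exists_generator (α := rootsOfUnity (p ^ s - 1) K)
  have hcop : (p ^ s - 1).Coprime p := by
    have h := (Nat.coprime_self_sub_left (m := 1) (n := p ^ s) hp1.le).2 (Nat.coprime_one_left _)
    exact Nat.Coprime.coprime_dvd_right (dvd_pow_self p hs.ne') h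
  refine ⟨((ζ : Kˣ) : K), orderOf ((ζ : Kˣ) : K), ?_, ?_, IsPrimitiveRoot.orderOf _, ?_⟩
  · rw [orderOf_pos_iff, isOfFinOrder_iff_pow_eq_one]
    exact ⟨p ^ s - 1, by omega, by
      have := ζ.2
      rw [mem_rootsOfUnity'] at this
      exact this⟩
  · refine Nat.Coprime.coprime_dvd_left ?_ hcop
    rw [orderOf_dvd_iff_pow_eq_one]
    exact (mem_rootsOfUnity' _ _).1 ζ.2
  · intro x hx
    obtain ⟨t, ht, htx⟩ := exists_teichmuller hs hx.le (hq x hx.le)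
    have ht0 : t ≠ 0 := by
      rintro rfl
      rw [zero_sub, Valuation.map_neg, hx] at htx
      exact lt_irrefl _ htx
    have ht1 : t ^ (p ^ s - 1) = 1 := by
      have : t ^ (p ^ s - 1) * t = 1 * t := by
        rw [← pow_succ, Nat.sub_add_cancel hp1.le, ht, one_mul]
      exact mul_right_cancel₀ ht0 this
    obtain ⟨i, hi⟩ := (mem_powers_iff_mem_zpowers.2 (hζ (rootsOfUnity.mkOfPowEq t ht1)))
    refine ⟨i, ?_⟩
    have := congrArg (fun z : rootsOfUnity (p ^ s - 1) K => ((z : Kˣ) : K)) hi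
    simp at this
    rwa [this]

end Teichmuller

/-! ### The maximal unramified subfield and roots of unity -/

section Unramified
variable {p : ℕ} [Fact p.Prime]

section
variable {A : Type*} [DivisionRing A] [Algebra ℚ_[p] A] [Algebra ℤ_[p] A]
  [IsScalarTower ℤ_[p] ℚ_[p] A] [FiniteDimensional ℚ_[p] A]

theorem IsUniformizer.of_val_eq {ϖ ϖ' : A} (h : IsUniformizer p ϖ) (h' : val p A ϖ' = val p A ϖ) :
    IsUniformizer p ϖ' := by
  rw [isUniformizer_iff] at *
  refine ⟨?_, h' ▸ h.2.1, h' ▸ h.2.2⟩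
  rintro rfl
  rw [map_zero, eq_comm, map_eq_zero] at h'
  exact h.1 h'

theorem IsUniformizer.val_eq {ϖ ϖ' : A} (h : IsUniformizer p ϖ) (h' : IsUniformizer p ϖ') :
    val p A ϖ' = val p A ϖ :=
  le_antisymm ((isUniformizer_iff.1 h).2.2 _ h'.val_lt_one)
    ((isUniformizer_iff.1 h').2.2 _ h.val_lt_one)

theorem val_pos_iff {x : A} : 0 < val p A x ↔ x ≠ 0 := by simp [zero_lt_iff]

theorem exists_eq_mul_of_val_le {x y : A} (hy : y ≠ 0) (h : val p A x ≤ val p A y) :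
    ∃ z, val p A z ≤ 1 ∧ x = y * z :=
  ⟨y⁻¹ * x, by rwa [map_mul, map_inv₀, inv_mul_le_iff₀ (val_pos_iff.2 hy), mul_one],
    (mul_inv_cancel_left₀ hy x).symm⟩
end

variable {K : Type*} [Field K] [Algebra ℚ_[p] K] [Algebra ℤ_[p] K]
  [IsScalarTower ℤ_[p] ℚ_[p] K] [FiniteDimensional ℚ_[p] K]

section Adjoin
variable {g : K} {m : ℕ}

theorem exists_pow_mul_mem_adjoin (hg : ℚ_[p]⟮g⟯ = ⊤) (x : K) :
    ∃ k : ℕ, (p : K) ^ k * x ∈ Algebra.adjoin ℤ_[p] {g} := by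
  have hx : x ∈ Algebra.adjoin ℚ_[p] {g} := by
    rw [← IntermediateField.adjoin_simple_toSubalgebra_of_isAlgebraic
      (Algebra.IsAlgebraic.isAlgebraic g), hg]
    trivial
  have hp : ∀ k : ℕ, (p : K) ^ k ∈ Algebra.adjoin ℤ_[p] {g} := fun k => pow_mem (_root_.natCast_mem _ _) _
  induction hx using Algebra.adjoin_induction with
  | mem x hx => exact ⟨0, by simpa using Algebra.subset_adjoin hx⟩
  | algebraMap r =>
    obtain ⟨k, a, ha⟩ : ∃ (k : ℕ) (a : ℤ_[p]), (p : ℚ_[p]) ^ k * r = a := by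
      rcases eq_or_ne r 0 with rfl | hr
      · exact ⟨0, 0, by simp⟩
      obtain ⟨k, hk⟩ := exists_pow_lt_of_lt_one (inv_pos.2 (norm_pos_iff.2 hr))
        (Padic.norm_p_lt_one (p := p))
      refine ⟨k, ⟨p ^ k * r, ?_⟩, rfl⟩
      rw [norm_mul, norm_pow]
      have := mul_le_mul_of_nonneg_right hk.le (norm_nonneg r)
      rwa [inv_mul_cancel₀ (norm_ne_zero_iff.2 hr)] at this
    refine ⟨k, ?_⟩
    rw [← map_natCast (algebraMap ℚ_[p] K), ← map_pow, ← map_mul, ha]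
    have h := Subalgebra.algebraMap_mem (Algebra.adjoin ℤ_[p] {g}) a
    rw [IsScalarTower.algebraMap_apply ℤ_[p] ℚ_[p] K] at h
    exact h
  | add x y _ _ hx hy =>
    obtain ⟨k, hk⟩ := hx
    obtain ⟨l, hl⟩ := hy
    refine ⟨k + l, ?_⟩
    have : (p : K) ^ (k + l) * (x + y) = p ^ l * (p ^ k * x) + p ^ k * (p ^ l * y) := by ring
    rw [this]
    exact add_mem (mul_mem (hp _) hk) (mul_mem (hp _) hl)
  | mul x y _ _ hx hy =>
    obtain ⟨k, hk⟩ := hx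
    obtain ⟨l, hl⟩ := hy
    refine ⟨k + l, ?_⟩
    have : (p : K) ^ (k + l) * (x * y) = (p ^ k * x) * (p ^ l * y) := by ring
    rw [this]
    exact mul_mem hk hl

/-- Since `p ^ φ(m) ≡ 1` modulo `m`, this power of Frobenius fixes `g`; it fixes `ℤ_[p]` modulo `p`
and is a ring map modulo `p`, so it is the identity on `ℤ_[p][g] / p`. -/
theorem dvd_frobenius_sub (hm : m.Coprime p) (hg : g ^ m = 1) (r : Algebra.adjoin ℤ_[p] {g}) :
    ((p : ℕ) : Algebra.adjoin ℤ_[p] {g}) ∣ r ^ p ^ m.totient - r := by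
  obtain ⟨r, hr⟩ := r
  induction hr using Algebra.adjoin_induction with
  | mem x hx =>
    obtain rfl := Set.mem_singleton_iff.1 hx
    convert dvd_zero _
    rw [sub_eq_zero]
    ext
    change x ^ p ^ m.totient = x
    have h := Nat.ModEq.pow_totient hm.symm
    rw [pow_eq_pow_mod _ hg, h, ← pow_eq_pow_mod _ hg, pow_one]
  | algebraMap a =>
    have h : (p : ℤ_[p]) ∣ a ^ p ^ m.totient - a := by
      rw [← Ideal.mem_span_singleton, ← PadicInt.maximalIdeal_eq_span_p, ← PadicInt.ker_toZMod,
        RingHom.mem_ker, map_sub, map_pow, ZMod.pow_card_pow, sub_self]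
    have h2 := map_dvd (algebraMap ℤ_[p] (Algebra.adjoin ℤ_[p] {g})) h
    rw [map_natCast, map_sub, map_pow] at h2
    exact h2
  | add x y hx hy hx' hy' =>
    obtain ⟨c, hc⟩ := exists_add_pow_prime_pow_eq (Fact.out : p.Prime)
      (⟨x, hx⟩ : Algebra.adjoin ℤ_[p] {g}) ⟨y, hy⟩ m.totient
    have h : (⟨x + y, add_mem hx hy⟩ : Algebra.adjoin ℤ_[p] {g}) = ⟨x, hx⟩ + ⟨y, hy⟩ := rfl
    rw [h, hc]
    have h3 := (hx'.add hy').add (dvd_mul_right (p : Algebra.adjoin ℤ_[p] {g}) (⟨x, hx⟩ * ⟨y, hy⟩ * c))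
    convert h3 using 1
    ring
  | mul x y hx hy hx' hy' =>
    have h : (⟨x * y, mul_mem hx hy⟩ : Algebra.adjoin ℤ_[p] {g}) = ⟨x, hx⟩ * ⟨y, hy⟩ := rfl
    rw [h, mul_pow]
    have h3 := (hx'.mul_right ((⟨y, hy⟩ : Algebra.adjoin ℤ_[p] {g}) ^ p ^ m.totient)).add
      (hy'.mul_left ⟨x, hx⟩)
    convert h3 using 1
    ring

theorem dvd_frobenius_iterate_sub (hm : m.Coprime p) (hg : g ^ m = 1)
    (r : Algebra.adjoin ℤ_[p] {g}) (j : ℕ) :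
    ((p : ℕ) : Algebra.adjoin ℤ_[p] {g}) ∣ r ^ (p ^ m.totient) ^ j - r := by
  induction j with
  | zero => simp
  | succ j ih =>
    have h := (dvd_frobenius_sub hm hg (r ^ (p ^ m.totient) ^ j)).add ih
    rwa [← pow_mul, ← pow_succ, sub_add_sub_cancel] at h

/-- Reducedness of `ℤ_[p][g] / p`: an iterate of Frobenius acting as the identity kills no nonzero
class. -/
theorem exists_eq_p_mul_of_pow (hm : m.Coprime p) (hg : g ^ m = 1) {r : K}
    (hr : r ∈ Algebra.adjoin ℤ_[p] {g}) (j : ℕ) {s : K} (hs : s ∈ Algebra.adjoin ℤ_[p] {g})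
    (h : r ^ (p ^ m.totient) ^ j = p * s) : ∃ t ∈ Algebra.adjoin ℤ_[p] {g}, r = p * t := by
  have h1 := dvd_frobenius_iterate_sub hm hg ⟨r, hr⟩ j
  have h2 : ((p : ℕ) : Algebra.adjoin ℤ_[p] {g}) ∣
      (⟨r, hr⟩ : Algebra.adjoin ℤ_[p] {g}) ^ (p ^ m.totient) ^ j :=
    ⟨⟨s, hs⟩, Subtype.ext h⟩
  obtain ⟨t, ht⟩ := (dvd_sub_right h2).1 h1
  exact ⟨t, t.2, congrArg Subtype.val ht⟩

/-- One denominator serves all integers because they form a finite `ℤ_[p]`-module. -/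
theorem exists_pow_mul_mem_of_integral (hgen : ℚ_[p]⟮g⟯ = ⊤) :
    ∃ k : ℕ, ∀ x : K, IsIntegral ℤ_[p] x → (p : K) ^ k * x ∈ Algebra.adjoin ℤ_[p] {g} := by
  have hfin : Module.Finite ℤ_[p] (integralClosure ℤ_[p] K) :=
    IsIntegralClosure.finite ℤ_[p] ℚ_[p] K _
  obtain ⟨s, hs⟩ := hfin.fg_top
  choose k hk using exists_pow_mul_mem_adjoin (p := p) hgen
  refine ⟨∑ y ∈ s, k y, fun x hx => ?_⟩
  have hx' : (⟨x, hx⟩ : integralClosure ℤ_[p] K) ∈ Submodule.span ℤ_[p] (s : Set (integralClosure ℤ_[p] K)) := by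
    rw [hs]; trivial
  have key : ∀ z : integralClosure ℤ_[p] K, z ∈ Submodule.span ℤ_[p] (s : Set (integralClosure ℤ_[p] K)) →
      (p : K) ^ (∑ y ∈ s, k y) * z ∈ Algebra.adjoin ℤ_[p] {g} := by
    intro z hz
    induction hz using Submodule.span_induction with
    | mem z hz =>
      obtain ⟨l, hl⟩ := Nat.exists_eq_add_of_le
        (Finset.single_le_sum (f := fun y : integralClosure ℤ_[p] K => k y) (fun _ _ => Nat.zero_le _) hz)
      rw [hl, pow_add, mul_comm ((p : K) ^ _), mul_assoc]
      exact mul_mem (pow_mem (_root_.natCast_mem _ _) _) (hk _)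
    | zero => simp
    | add x y _ _ hx hy =>
      rw [Subalgebra.coe_add, mul_add]
      exact add_mem hx hy
    | smul a x _ hx =>
      rw [Subalgebra.coe_smul, mul_smul_comm]
      exact Subalgebra.smul_mem _ hx a
  exact key _ hx'

/-- Denominators are removed one factor `p` at a time. If `p y` lies in `ℤ_[p][g]`, a high power of
it is `p` times an element of that ring, as `p ^ k` clears the denominators of all powers of `y`;
reducedness modulo `p` then gives `y`. -/
theorem mem_adjoin_of_integral (hm : m.Coprime p) (hm0 : 0 < m) (hg : g ^ m = 1) (hgen : ℚ_[p]⟮g⟯ = ⊤) {x : K}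
    (hx : IsIntegral ℤ_[p] x) : x ∈ Algebra.adjoin ℤ_[p] {g} := by
  obtain ⟨k, hk⟩ := exists_pow_mul_mem_of_integral (p := p) hgen
  have hp0 := natCast_prime_ne_zero p K
  have step : ∀ y : K, IsIntegral ℤ_[p] y → (p : K) * y ∈ Algebra.adjoin ℤ_[p] {g} →
      y ∈ Algebra.adjoin ℤ_[p] {g} := by
    intro y hy hpy
    have hQ : 1 < p ^ m.totient := Nat.one_lt_pow (Nat.totient_pos.2 hm0).ne'
      (Fact.out : p.Prime).one_lt
    obtain ⟨j, hj⟩ : ∃ j, k + 1 ≤ (p ^ m.totient) ^ j :=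
      ⟨k + 1, (Nat.lt_pow_self hQ).le⟩
    obtain ⟨l, hl⟩ := Nat.exists_eq_add_of_le hj
    obtain ⟨t, ht, h⟩ := exists_eq_p_mul_of_pow hm hg hpy j
      (s := p ^ l * (p ^ k * y ^ (p ^ m.totient) ^ j))
      (mul_mem (pow_mem (_root_.natCast_mem _ _) _) (hk _ (hy.pow _))) (by
        rw [mul_pow]
        conv_lhs => rw [hl]
        rw [hl]
        ring)
    rwa [mul_right_injective₀ hp0 h]
  have : ∀ l : ℕ, (p : K) ^ l * x ∈ Algebra.adjoin ℤ_[p] {g} → x ∈ Algebra.adjoin ℤ_[p] {g} := by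
    intro l
    induction l with
    | zero => simp
    | succ l ih =>
      intro h
      refine ih (step _ ?_ ?_)
      · exact ((val_le_one_iff.1 val_p_lt_one.le).pow _).mul hx
      · rwa [← mul_assoc, ← pow_succ']
  exact this k (hk x hx)

/-- A high power of a non-unit is divisible by `p`, so by reducedness modulo `p` the non-unit itself
is. -/
theorem isUniformizer_p_of_adjoin (hm : m.Coprime p) (hm0 : 0 < m) (hg : g ^ m = 1) (hgen : ℚ_[p]⟮g⟯ = ⊤) :
    IsUniformizer p (p : K) := by
  have hp0 := natCast_prime_ne_zero p K
  refine isUniformizer_iff.2 ⟨hp0, val_p_lt_one, fun x hx => ?_⟩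
  have hQ : 1 < p ^ m.totient := Nat.one_lt_pow (Nat.totient_pos.2 hm0).ne'
      (Fact.out : p.Prime).one_lt
  obtain ⟨l, hl⟩ := exists_pow_lt_of_lt_one (val_pos_iff.2 hp0 : 0 < val p K (p : K)) hx
  obtain ⟨j, hj⟩ : ∃ j, l ≤ (p ^ m.totient) ^ j := ⟨l, (Nat.lt_pow_self hQ).le⟩
  have h1 : val p K (x ^ (p ^ m.totient) ^ j) ≤ val p K (p : K) := by
    rw [map_pow]
    exact (pow_le_pow_of_le_one zero_le hx.le hj).trans hl.le
  obtain ⟨z, hz, hz'⟩ := exists_eq_mul_of_val_le hp0 h1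
  obtain ⟨t, ht, rfl⟩ := exists_eq_p_mul_of_pow hm hg
    (mem_adjoin_of_integral hm hm0 hg hgen (val_le_one_iff.1 hx.le)) j
    (mem_adjoin_of_integral hm hm0 hg hgen (val_le_one_iff.1 hz)) hz'
  rw [map_mul]
  refine mul_le_of_le_one_right' (val_le_one_iff.2 ?_)
  refine (integralClosure ℤ_[p] K).mem_carrier.1 (Algebra.adjoin_le ?_ ht)
  rintro _ rfl
  exact IsIntegral.of_pow hm0 (by rw [hg]; exact isIntegral_one)

end Adjoin

theorem isUnramifiedExt_iff : IsUnramifiedExt p ℚ_[p] K ↔ IsUniformizer p (p : K) := by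
  -- The trivial root of unity `g = 1` settles the base field.
  have h0 : IsUniformizer p (p : ℚ_[p]) :=
    isUniformizer_p_of_adjoin (g := 1) (m := 1) (by simp) one_pos (by simp) (by
      rw [IntermediateField.adjoin_one]
      exact IntermediateField.bot_eq_top_iff_finrank_eq_one.2 (Module.finrank_self _))
  constructor
  · intro h
    simpa using h p h0
  · intro h ϖ hϖ
    refine h.of_val_eq ?_
    rw [← map_natCast (algebraMap ℚ_[p] K)]
    exact (val_map_eq_iff (Algebra.ofId ℚ_[p] K)).2 (h0.val_eq hϖ)

theorem isUnramifiedExt_adjoin {g : K} {m : ℕ} (hm : m.Coprime p) (hm0 : 0 < m) (hg : g ^ m = 1) :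
    IsUnramifiedExt p ℚ_[p] ℚ_[p]⟮g⟯ := by
  rw [isUnramifiedExt_iff]
  refine isUniformizer_p_of_adjoin (g := AdjoinSimple.gen ℚ_[p] g) hm hm0 ?_ ?_
  · ext; simpa using hg
  · rw [← IntermediateField.lift_inj, IntermediateField.lift_adjoin_simple,
      IntermediateField.lift_top, AdjoinSimple.coe_gen]

variable (p K) in
/-- A root of unity of order prime to `p` whose powers represent all nonzero residues. -/
def zeta : K := (exists_primitiveRoot p K).choose

variable (p K) in
/-- The order of `zeta`. -/
def zetaOrder : ℕ := (exists_primitiveRoot p K).choose_spec.choose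

theorem zeta_spec : 0 < zetaOrder p K ∧ (zetaOrder p K).Coprime p ∧
    IsPrimitiveRoot (zeta p K) (zetaOrder p K) ∧
    ∀ x : K, val p K x = 1 → ∃ i : ℕ, val p K (zeta p K ^ i - x) < 1 :=
  (exists_primitiveRoot p K).choose_spec.choose_spec

theorem zeta_pow : zeta p K ^ zetaOrder p K = 1 := zeta_spec.2.2.1.pow_eq_one

theorem val_eq_one_of_pow {x : K} {m : ℕ} (hm0 : 0 < m) (hx : x ^ m = 1) : val p K x = 1 := by
  have h : val p K x ^ m = 1 := by rw [← map_pow, hx, map_one]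
  exact (pow_eq_one_iff_of_nonneg zero_le hm0.ne').1 h

theorem val_zeta_pow (i : ℕ) : val p K (zeta p K ^ i) = 1 := by
  rw [map_pow, val_eq_one_of_pow (zeta_spec (p := p) (K := K)).1 zeta_pow, one_pow]

/-- Some power of `zeta` has the residue of `x`, and the quotient is a root of unity of order prime
to `p` with residue `1`. -/
theorem exists_eq_zeta_pow {x : K} {m : ℕ} (hm : m.Coprime p) (hm0 : 0 < m) (hx : x ^ m = 1) :
    ∃ i, x = zeta p K ^ i := by
  obtain ⟨i, hi⟩ := (zeta_spec (p := p) (K := K)).2.2.2 x (val_eq_one_of_pow hm0 hx)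
  refine ⟨i, ?_⟩
  have hx0 : x ≠ 0 := by
    rintro rfl
    simp [hm0.ne'] at hx
  have h1 : zeta p K ^ i * x⁻¹ = 1 := by
    refine eq_one_of_val_sub_one_lt (p := p) (m := zetaOrder p K * m)
      (Nat.Coprime.mul_left zeta_spec.2.1 hm) ?_ ?_
    · rw [mul_pow, ← pow_mul, mul_comm i, mul_assoc, pow_mul, zeta_pow, one_pow, one_mul,
        mul_comm (zetaOrder p K), pow_mul, inv_pow, hx, inv_one, one_pow]
    · have : zeta p K ^ i * x⁻¹ - 1 = (zeta p K ^ i - x) * x⁻¹ := by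
        rw [sub_mul, mul_inv_cancel₀ hx0]
      rw [this, map_mul, map_inv₀, val_eq_one_of_pow hm0 hx, inv_one, mul_one]
      exact hi
  rw [mul_inv_eq_one₀ hx0] at h1
  exact h1.symm

/-- The ring of integers is generated by `zeta` and a uniformizer. -/
theorem mem_span_of_integral {ϖ : K} (hϖ : IsUniformizer p ϖ) {e : ℕ}
    (he : val p K (p : K) = val p K ϖ ^ e) {x : K} (hx : IsIntegral ℤ_[p] x) :
    x ∈ Submodule.span ℤ_[p] (Set.range fun ik : ℕ × Fin e => zeta p K ^ ik.1 * ϖ ^ (ik.2 : ℕ)) := by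
  set M := Submodule.span ℤ_[p] (Set.range fun ik : ℕ × Fin e => zeta p K ^ ik.1 * ϖ ^ (ik.2 : ℕ))
    with hM
  -- Successive approximation modulo `ϖ ^ j`. At `j = e` the error is a multiple of `p`, and
  -- Nakayama's lemma over `ℤ_[p]` removes it.
  have h1 : ∀ j ≤ e, ∀ x : K, val p K x ≤ 1 → ∃ m ∈ M, ∃ y : K, val p K y ≤ 1 ∧ x = m + ϖ ^ j * y := by
    intro j
    induction j with
    | zero => exact fun _ x hx => ⟨0, zero_mem _, x, hx, by simp⟩
    | succ j ih =>
      intro hj x hx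
      obtain ⟨m, hm, y, hy, rfl⟩ := ih (by omega) x hx
      rcases hy.lt_or_eq with hy | hy
      · obtain ⟨z, hz, rfl⟩ := exists_eq_mul_of_val_le hϖ.ne_zero
          ((isUniformizer_iff.1 hϖ).2.2 y hy)
        exact ⟨m, hm, z, hz, by ring⟩
      · obtain ⟨i, hi⟩ := (zeta_spec (p := p) (K := K)).2.2.2 y hy
        rw [Valuation.map_sub_swap] at hi
        obtain ⟨z, hz, hz'⟩ := exists_eq_mul_of_val_le hϖ.ne_zero
          ((isUniformizer_iff.1 hϖ).2.2 _ hi)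
        refine ⟨m + zeta p K ^ i * ϖ ^ j, add_mem hm (Submodule.subset_span ⟨(i, ⟨j, by omega⟩), rfl⟩),
          z, hz, ?_⟩
        rw [sub_eq_iff_eq_add] at hz'
        rw [hz']
        ring
  have hfin : Module.Finite ℤ_[p] (integralClosure ℤ_[p] K) :=
    IsIntegralClosure.finite ℤ_[p] ℚ_[p] K _
  have h2 : Subalgebra.toSubmodule (integralClosure ℤ_[p] K) ≤ M := by
    refine Submodule.le_of_le_smul_of_le_jacobson_bot (I := IsLocalRing.maximalIdeal ℤ_[p])
      (Module.Finite.iff_fg.1 hfin) (IsLocalRing.jacobson_eq_maximalIdeal _ bot_ne_top).ge ?_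
    intro x hx
    obtain ⟨m, hm, y, hy, rfl⟩ := h1 e le_rfl x (val_le_one_iff.2 hx)
    refine Submodule.add_mem_sup hm ?_
    obtain ⟨z, hz, hz'⟩ := exists_eq_mul_of_val_le (natCast_prime_ne_zero p K)
      (x := ϖ ^ e * y) (by rw [map_mul, map_pow, he]; exact mul_le_of_le_one_right' hy)
    rw [hz']
    have h3 : (p : K) * z = (p : ℤ_[p]) • z := by rw [Algebra.smul_def, map_natCast]
    rw [h3]
    refine Submodule.smul_mem_smul ?_ (val_le_one_iff.1 hz)
    rw [PadicInt.maximalIdeal_eq_span_p]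
    exact Ideal.mem_span_singleton_self _
  exact h2 hx

theorem exists_pow_mul_integral (x : K) : ∃ k : ℕ, IsIntegral ℤ_[p] ((p : K) ^ k * x) := by
  rcases eq_or_ne x 0 with rfl | hx
  · exact ⟨0, by simpa using isIntegral_zero⟩
  obtain ⟨k, hk⟩ := exists_pow_lt_of_lt_one (inv_pos.2 ((val_pos_iff (p := p)).2 hx)) (val_p_lt_one (p := p) (A := K))
  refine ⟨k, val_le_one_iff.1 ?_⟩
  rw [map_mul, map_pow]
  have := mul_le_mul_left hk.le (val p K x)
  rwa [inv_mul_cancel₀ (val_pos_iff.2 hx).ne'] at this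

/-- In an unramified subfield `p` is a uniformizer, so its integers are spanned by powers of its own
`zeta` (`e = 1`), which is a power of the `zeta` of `K`. -/
theorem maxUnramified_eq : maxUnramified p K = ℚ_[p]⟮zeta p K⟯ := by
  refine le_antisymm (sSup_le ?_)
    (le_sSup (show IsUnramifiedExt p ℚ_[p] ℚ_[p]⟮zeta p K⟯ from
      isUnramifiedExt_adjoin zeta_spec.2.1 zeta_spec.1 zeta_pow))
  intro E hE x hx
  have hE' : IsUniformizer p (p : E) := isUnramifiedExt_iff.1 hE
  obtain ⟨k, hk⟩ := exists_pow_mul_integral (p := p) (⟨x, hx⟩ : E)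
  have h1 := mem_span_of_integral hE' (e := 1) (by simp) hk
  have h2 : ∀ y : E, y ∈ Submodule.span ℤ_[p]
      (Set.range fun ik : ℕ × Fin 1 => zeta p E ^ ik.1 * (p : E) ^ (ik.2 : ℕ)) →
      (y : K) ∈ ℚ_[p]⟮zeta p K⟯ := by
    intro y hy
    induction hy using Submodule.span_induction with
    | mem y hy =>
      obtain ⟨⟨i, j⟩, rfl⟩ := hy
      obtain ⟨l, hl⟩ := exists_eq_zeta_pow (p := p) (K := K) (x := (zeta p E : K)) (m := zetaOrder p E)
        zeta_spec.2.1 zeta_spec.1 (by exact_mod_cast congrArg Subtype.val (zeta_pow (p := p) (K := E)))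
      have : j = 0 := Subsingleton.elim _ _
      subst this
      simp only [Fin.val_zero, pow_zero, mul_one, IntermediateField.coe_pow, hl]
      exact pow_mem (pow_mem (IntermediateField.mem_adjoin_simple_self _ _) _) _
    | zero => exact zero_mem _
    | add x y _ _ hx hy => exact add_mem hx hy
    | smul a x _ hx =>
      have : ((a • x : E) : K) = (a : ℚ_[p]) • (x : K) := by
        rw [Algebra.smul_def, Algebra.smul_def, IsScalarTower.algebraMap_apply ℤ_[p] ℚ_[p] E]
        rfl
      rw [this]
      exact IntermediateField.smul_mem _ hx
  have h3 := h2 _ h1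
  have hp0 := natCast_prime_ne_zero p K
  have h4 : x = ((p : K) ^ k)⁻¹ * ((p : K) ^ k * x) := by
    rw [inv_mul_cancel_left₀ (pow_ne_zero _ hp0)]
  rw [h4]
  refine mul_mem (inv_mem (pow_mem (_root_.natCast_mem _ _) _)) ?_
  simpa using h3

theorem isUniformizer_p_maxUnramified : IsUniformizer p (p : maxUnramified p K) := by
  rw [← isUnramifiedExt_iff, maxUnramified_eq]
  exact isUnramifiedExt_adjoin zeta_spec.2.1 zeta_spec.1 zeta_pow

theorem zeta_mem_maxUnramified : zeta p K ∈ maxUnramified p K := by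
  rw [maxUnramified_eq]
  exact IntermediateField.mem_adjoin_simple_self _ _

theorem mem_maxUnramified_of_pow {x : K} {m : ℕ} (hm : m.Coprime p) (hm0 : 0 < m)
    (hx : x ^ m = 1) : x ∈ maxUnramified p K := by
  obtain ⟨i, rfl⟩ := exists_eq_zeta_pow hm hm0 hx
  exact pow_mem zeta_mem_maxUnramified _

end Unramified

/-! ### Perfectness of the unramified trace pairing -/

section Trace
variable {p : ℕ} [Fact p.Prime]
variable {L : Type*} [Field L] [Algebra ℚ_[p] L] [Algebra ℤ_[p] L]
  [IsScalarTower ℤ_[p] ℚ_[p] L] [FiniteDimensional ℚ_[p] L]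

theorem isMaximal_span_p (h : IsUniformizer p (p : L)) :
    (Ideal.map (algebraMap ℤ_[p] (integralClosure ℤ_[p] L)) (IsLocalRing.maximalIdeal ℤ_[p])).IsMaximal := by
  rw [PadicInt.maximalIdeal_eq_span_p, Ideal.map_span, Set.image_singleton, map_natCast]
  have hmem : ∀ x : integralClosure ℤ_[p] L,
      x ∈ Ideal.span {((p : ℕ) : integralClosure ℤ_[p] L)} ↔ val p L x < 1 := by
    intro x
    rw [Ideal.mem_span_singleton]
    constructor
    · rintro ⟨y, rfl⟩
      change val p L (p * y) < 1
      rw [map_mul]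
      exact (mul_le_of_le_one_right' (val_le_one_iff.2 y.2)).trans_lt val_p_lt_one
    · intro hx
      obtain ⟨z, hz, hz'⟩ := exists_eq_mul_of_val_le h.ne_zero ((isUniformizer_iff.1 h).2.2 _ hx)
      exact ⟨⟨z, val_le_one_iff.1 hz⟩, Subtype.ext hz'⟩
  rw [Ideal.isMaximal_iff]
  refine ⟨?_, fun I x hI hx hxI => ?_⟩
  · rw [hmem]; simp
  · rw [hmem, not_lt] at hx
    have hx0 : (x : L) ≠ 0 := by rw [← val_pos_iff (p := p)]; exact one_pos.trans_le hx
    have hx' : IsIntegral ℤ_[p] (x : L)⁻¹ := by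
      rw [← val_le_one_iff, map_inv₀]
      exact inv_le_one_of_one_le₀ hx
    have : (⟨_, hx'⟩ : integralClosure ℤ_[p] L) * x = 1 := Subtype.ext (inv_mul_cancel₀ hx0)
    rw [← this]
    exact I.mul_mem_left _ hxI

theorem trace_surjective_of_isField {k l : Type*} [CommRing k] [CommRing l] [Algebra k l] [Finite k]
    [Module.Finite k l] (hk : IsField k) (hl : IsField l) :
    Function.Surjective (Algebra.trace k l) := by
  let _ := hk.toField
  let _ := hl.toField
  exact Algebra.trace_surjective k l

/-- Modulo `p` the trace becomes that of an extension of finite fields, which is surjective; `z`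
lifts an element of trace `1`. -/
theorem exists_trace_not_dvd (h : IsUniformizer p (p : L)) :
    ∃ z : L, IsIntegral ℤ_[p] z ∧ ¬ IsIntegral ℤ_[p] ((p : ℚ_[p])⁻¹ * Algebra.trace ℚ_[p] L z) := by
  have hfin : Module.Finite ℤ_[p] (integralClosure ℤ_[p] L) :=
    IsIntegralClosure.finite ℤ_[p] ℚ_[p] L _
  have : Module.IsTorsionFree ℤ_[p] L := .trans_faithfulSMul ℤ_[p] ℚ_[p] L
  have hfree : Module.Free ℤ_[p] (integralClosure ℤ_[p] L) :=
    IsIntegralClosure.module_free ℤ_[p] ℚ_[p] L _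
  have hloc : IsLocalization (Algebra.algebraMapSubmonoid (integralClosure ℤ_[p] L)
      (nonZeroDivisors ℤ_[p])) L := IsIntegralClosure.isLocalization ℤ_[p] ℚ_[p] L _
  have hmax := isMaximal_span_p h
  have : Finite (ℤ_[p] ⧸ IsLocalRing.maximalIdeal ℤ_[p]) :=
    Finite.of_equiv (ZMod p) PadicInt.residueField.symm.toEquiv
  obtain ⟨y, hy⟩ := trace_surjective_of_isField
    ((Ideal.Quotient.maximal_ideal_iff_isField_quotient _).1
      (inferInstance : (IsLocalRing.maximalIdeal ℤ_[p]).IsMaximal))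
    ((Ideal.Quotient.maximal_ideal_iff_isField_quotient _).1 hmax) 1
  obtain ⟨z, rfl⟩ := Ideal.Quotient.mk_surjective y
  rw [Algebra.trace_quotient_mk] at hy
  refine ⟨z, z.2, fun hz => ?_⟩
  have h1 : Algebra.trace ℚ_[p] L (z : L) = (Algebra.trace ℤ_[p] (integralClosure ℤ_[p] L) z : ℚ_[p]) :=
    Algebra.trace_localization ℤ_[p] (nonZeroDivisors ℤ_[p]) z
  rw [h1] at hz
  obtain ⟨w, hw⟩ := IsIntegrallyClosed.isIntegral_iff.1 hz
  have h2 : Algebra.trace ℤ_[p] (integralClosure ℤ_[p] L) z = p * w := by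
    have : ((p * w : ℤ_[p]) : ℚ_[p]) = p * ((p : ℚ_[p])⁻¹ *
        (Algebra.trace ℤ_[p] (integralClosure ℤ_[p] L) z : ℚ_[p])) := by
      rw [← hw]; simp
    rw [mul_inv_cancel_left₀ (by exact_mod_cast (Fact.out : p.Prime).ne_zero)] at this
    exact (Subtype.coe_injective this).symm
  rw [h2, ← map_one (Ideal.Quotient.mk _), Ideal.Quotient.eq, PadicInt.maximalIdeal_eq_span_p,
    Ideal.mem_span_singleton] at hy
  have h3 := (dvd_sub_right (dvd_mul_right (p : ℤ_[p]) w)).1 hy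
  exact PadicInt.prime_p.not_isUnit (isUnit_of_dvd_one h3)

/-- The trace pairing of an unramified extension is perfect. -/
theorem isIntegral_of_trace (h : IsUniformizer p (p : L)) {x : L}
    (hx : ∀ y : L, IsIntegral ℤ_[p] y → IsIntegral ℤ_[p] (Algebra.trace ℚ_[p] L (y * x))) :
    IsIntegral ℤ_[p] x := by
  by_contra hx1
  have hx2 := hx1
  have hx0 : x ≠ 0 := by
    rintro rfl
    exact hx1 isIntegral_zero
  rw [← val_le_one_iff, not_le] at hx1
  -- Values are powers of that of `p`, so a non-integral `x` has `p x` of value at least `1`. Hence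
  -- `z / p` is an integral multiple of `x`, contradicting the choice of `z`.
  have hpx : 1 ≤ val p L (p * x) := by
    obtain ⟨n, hn⟩ := h.exists_zpow hx0
    rw [map_mul, hn, ← zpow_one_add₀ h.val_pos.ne']
    rw [hn] at hx1
    have : n < 0 := by
      by_contra! hn0
      exact hx1.not_ge (zpow_le_one₀ h.val_pos h.val_lt_one.le hn0)
    exact one_le_zpow_of_nonpos₀ h.val_pos h.val_lt_one.le (by omega)
  obtain ⟨z, hz, hz'⟩ := exists_trace_not_dvd h
  refine hz' ?_
  have h1 := hx ((p * x)⁻¹ * z) (val_le_one_iff.1 (by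
    rw [map_mul, map_inv₀]
    exact mul_le_one' (inv_le_one_of_one_le₀ hpx) (val_le_one_iff.2 hz)))
  have h2 : ((p * x)⁻¹ * z) * x = (p : ℚ_[p])⁻¹ • z := by
    rw [Algebra.smul_def, map_inv₀, map_natCast]
    have := h.ne_zero
    field_simp
  rwa [h2, map_smul, smul_eq_mul] at h1

end Trace

/-! ### Sums of powers of a uniformizer with unramified-type coefficients -/

section Expansion
variable {p : ℕ} [Fact p.Prime]
variable {A : Type*} [DivisionRing A] [Algebra ℚ_[p] A] [Algebra ℤ_[p] A]
  [IsScalarTower ℤ_[p] ℚ_[p] A] [FiniteDimensional ℚ_[p] A]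
variable {L : Type*} [Field L] [Algebra ℚ_[p] L] [Algebra ℤ_[p] L]
  [IsScalarTower ℤ_[p] ℚ_[p] L] [FiniteDimensional ℚ_[p] L]

/-- Nonzero terms of pairwise distinct values cannot cancel, so the sum takes the largest value. -/
theorem val_le_val_sum {ι : Type*} (s : Finset ι) (f : ι → A)
    (h : ∀ i ∈ s, ∀ j ∈ s, f i ≠ 0 → val p A (f i) = val p A (f j) → i = j) :
    ∀ i ∈ s, val p A (f i) ≤ val p A (∑ j ∈ s, f j) := by
  classical
  intro i hi
  obtain ⟨k, hk, hmax⟩ := Finset.exists_max_image s (fun j => val p A (f j)) ⟨i, hi⟩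
  rcases eq_or_ne (f k) 0 with h0 | h0
  · have := hmax i hi
    rw [h0, map_zero] at this
    exact this.trans zero_le
  · rw [Valuation.map_sum_eq_of_lt _ hk fun j hj => ?_]
    · exact hmax i hi
    · rw [Finset.mem_sdiff, Finset.mem_singleton] at hj
      refine (hmax j hj.1).lt_of_ne fun heq => hj.2 ?_
      exact (h k hk j hj.1 h0 heq.symm).symm

theorem exists_zpow_map (φ : L →ₐ[ℚ_[p]] A) {ϖ : L} (h : IsUniformizer p ϖ) {x : L} (hx : x ≠ 0) :
    ∃ n : ℤ, val p A (φ x) = val p A (φ ϖ) ^ n := by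
  obtain ⟨n, hn⟩ := h.exists_zpow hx
  refine ⟨n, ?_⟩
  rw [← map_zpow₀, ← map_zpow₀, val_map_eq_iff, map_zpow₀, hn]

variable {ρ : A} (hρ : IsUniformizer p ρ) {ϖ : L} (hϖ : IsUniformizer p ϖ) {E : ℕ}
  (φ : L →ₐ[ℚ_[p]] A) (hE : val p A (φ ϖ) = val p A ρ ^ E)

include hρ hϖ hE

/-- The value of the `j`-th nonzero term is a power of `val ρ` with exponent congruent to `N + j`
modulo `E`, so the values are distinct. -/
theorem val_term_le (N : ℕ) (α : Fin E → L) (i : Fin E) :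
    val p A (φ (α i) * ρ ^ (N + i : ℕ)) ≤ val p A (∑ j, φ (α j) * ρ ^ (N + j : ℕ)) := by
  refine val_le_val_sum Finset.univ (fun j : Fin E => φ (α j) * ρ ^ (N + j : ℕ)) ?_ i (Finset.mem_univ _)
  have key : ∀ j : Fin E, α j ≠ 0 → ∃ n : ℤ,
      val p A (φ (α j) * ρ ^ (N + j : ℕ)) = val p A ρ ^ (E * n + (N + j)) := by
    intro j hj
    obtain ⟨n, hn⟩ := exists_zpow_map φ hϖ hj
    refine ⟨n, ?_⟩
    rw [map_mul, hn, hE, map_pow, zpow_add₀ hρ.val_pos.ne', zpow_mul, zpow_natCast]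
    norm_cast
  intro i _ j _ hi hij
  have hi0 : α i ≠ 0 := by
    rintro h0
    exact hi (by simp [h0])
  have hj0 : α j ≠ 0 := by
    rintro h0
    rw [h0, map_zero, zero_mul, map_zero, map_eq_zero] at hij
    exact hi hij
  obtain ⟨m, hm⟩ := key i hi0
  obtain ⟨n, hn⟩ := key j hj0
  rw [hm, hn, zpow_right_inj₀ hρ.val_pos hρ.val_lt_one.ne] at hij
  have hij' : (E : ℤ) * (m - n) = j - i := by linarith
  have h1 := i.2
  have h2 := j.2
  have h3 : (E : ℤ) ∣ (j : ℤ) - i := ⟨_, hij'.symm⟩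
  have h4 : |(j : ℤ) - i| < E := by rw [abs_lt]; omega
  have h5 := Int.eq_zero_of_abs_lt_dvd h3 h4
  ext
  omega

theorem eq_zero_of_sum_eq_zero (N : ℕ) (α : Fin E → L)
    (h : ∑ j, φ (α j) * ρ ^ (N + j : ℕ) = 0) : α = 0 := by
  ext i
  have := val_term_le hρ hϖ φ hE N α i
  rw [h, map_zero, nonpos_iff_eq_zero, map_eq_zero, mul_eq_zero] at this
  rcases this with h1 | h1
  · simpa using h1
  · exact absurd h1 (pow_ne_zero _ hρ.ne_zero)

theorem isIntegral_of_sum (N : ℕ) (α : Fin E → L)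
    (h : val p A (∑ j, φ (α j) * ρ ^ (N + j : ℕ)) ≤ val p A ρ ^ N) (i : Fin E) :
    IsIntegral ℤ_[p] (α i) := by
  have h1 := (val_term_le hρ hϖ φ hE N α i).trans h
  rcases eq_or_ne (α i) 0 with h0 | h0
  · rw [h0]; exact isIntegral_zero
  obtain ⟨n, hn⟩ := exists_zpow_map φ hϖ h0
  rw [map_mul, map_pow, hn, hE, ← zpow_natCast, ← zpow_natCast, ← zpow_natCast, ← zpow_mul,
    ← zpow_add₀ hρ.val_pos.ne', zpow_le_zpow_iff_right_of_lt_one₀ hρ.val_pos hρ.val_lt_one] at h1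
  have h2 := i.2
  have hn0 : 0 ≤ n := by
    by_contra! h3
    have : (E : ℤ) * n ≤ E * (-1) := mul_le_mul_of_nonneg_left (by omega) (by omega)
    push_cast at h1
    omega
  rw [← val_le_one_iff, ← val_map_le_one_iff φ, hn]
  exact zpow_le_one₀ ((val_pos_iff).2 (by simpa using hϖ.ne_zero))
    ((val_map_lt_one_iff φ).2 hϖ.val_lt_one).le hn0

end Expansion

/-! ### The degree formula over the unramified part -/

section Degree
variable {p : ℕ} [Fact p.Prime]
variable {K : Type*} [Field K] [Algebra ℚ_[p] K] [Algebra ℤ_[p] K]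
  [IsScalarTower ℤ_[p] ℚ_[p] K] [FiniteDimensional ℚ_[p] K]

/-- Integers of `K` are polynomials in a uniformizer with coefficients in the unramified part. -/
theorem exists_expansion {ϖ : K} (hϖ : IsUniformizer p ϖ) {e : ℕ}
    (he : val p K (p : K) = val p K ϖ ^ e) {x : K} (hx : IsIntegral ℤ_[p] x) :
    ∃ α : Fin e → integralClosure ℤ_[p] (maxUnramified p K),
      x = ∑ k, ((α k : maxUnramified p K) : K) * ϖ ^ (k : ℕ) := by
  have h := mem_span_of_integral hϖ he hx
  clear hx
  induction h using Submodule.span_induction with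
  | mem x hx =>
    obtain ⟨⟨i, k⟩, rfl⟩ := hx
    have hz : IsIntegral ℤ_[p] (⟨zeta p K, zeta_mem_maxUnramified⟩ : maxUnramified p K) :=
      IsIntegral.of_pow (zeta_spec (p := p) (K := K)).1 (by
        convert isIntegral_one
        ext
        exact zeta_pow)
    refine ⟨Pi.single k ⟨_, hz.pow i⟩, ?_⟩
    rw [Finset.sum_eq_single k]
    · simp
    · intro j _ hj
      simp [Pi.single_eq_of_ne hj]
    · simp
  | zero => exact ⟨0, by simp⟩
  | add x y _ _ hx hy =>
    obtain ⟨α, rfl⟩ := hx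
    obtain ⟨β, rfl⟩ := hy
    exact ⟨α + β, by simp [add_mul, Finset.sum_add_distrib]⟩
  | smul a x _ hx =>
    obtain ⟨α, rfl⟩ := hx
    refine ⟨a • α, ?_⟩
    rw [Finset.smul_sum]
    refine Finset.sum_congr rfl fun k _ => ?_
    rw [← smul_mul_assoc]
    rfl

theorem finrank_eq_mul_finrank {ϖ : K} (hϖ : IsUniformizer p ϖ) {e : ℕ}
    (he : val p K (p : K) = val p K ϖ ^ e) :
    Module.finrank ℚ_[p] K = e * Module.finrank ℚ_[p] (maxUnramified p K) := by
  let T : (Fin e → maxUnramified p K) →ₗ[ℚ_[p]] K :=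
    { toFun := fun α => ∑ k, (α k : K) * ϖ ^ (k : ℕ)
      map_add' := fun α β => by simp [add_mul, Finset.sum_add_distrib]
      map_smul' := fun a α => by simp [Finset.smul_sum] }
  have hT : ∀ α, T α = ∑ k, (α k : K) * ϖ ^ (k : ℕ) := fun _ => rfl
  have hbij : Function.Bijective T := by
    constructor
    · rw [injective_iff_map_eq_zero]
      intro α hα
      refine eq_zero_of_sum_eq_zero hϖ isUniformizer_p_maxUnramified (maxUnramified p K).val
        (E := e) (by simpa using he) 0 α ?_
      rw [hT] at hα
      simpa using hα
    · intro x
      obtain ⟨k, hk⟩ := exists_pow_mul_integral (p := p) x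
      obtain ⟨α, hα⟩ := exists_expansion hϖ he hk
      refine ⟨((p : ℚ_[p]) ^ k)⁻¹ • fun i => (α i : maxUnramified p K), ?_⟩
      rw [map_smul, hT, ← hα, Algebra.smul_def, map_inv₀, map_pow, map_natCast,
        inv_mul_cancel_left₀ (pow_ne_zero _ (natCast_prime_ne_zero p K))]
  have h := (LinearEquiv.ofBijective T hbij).finrank_eq
  rw [← h, Module.finrank_pi_fintype]
  simp

end Degree

attribute [local instance] LieRing.ofAssociativeRing

namespace Frame

variable {p : ℕ} [Fact p.Prime] {F W D : Type*}
  [Field F] [Algebra ℚ_[p] F] [Algebra ℤ_[p] F] [IsScalarTower ℤ_[p] ℚ_[p] F]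
  [FiniteDimensional ℚ_[p] F]
  [Field W] [Algebra F W] [Algebra ℚ_[p] W] [Algebra ℤ_[p] W] [IsScalarTower ℤ_[p] ℚ_[p] W]
  [IsScalarTower ℚ_[p] F W] [FiniteDimensional ℚ_[p] W]
  [DivisionRing D] [Algebra F D] [Algebra ℚ_[p] D] [Algebra ℤ_[p] D]
  [IsScalarTower ℤ_[p] ℚ_[p] D] [IsScalarTower ℚ_[p] F D] [FiniteDimensional ℚ_[p] D]
  (S : Frame p F W D)

/-! ### The cyclic extension W/F and the ramification of D -/

section Structure
variable {S} {e : ℕ}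

theorem exists_uniformizer (he : IsRamificationIndex p F e) : ∃ ϖ : F, IsUniformizer p ϖ ∧
    val p F (p : F) = val p F ϖ ^ e ∧ 0 < e := by
  obtain ⟨ϖ, u, h1, hu0, hu1, hu2, h2⟩ := he
  have hu : val p F u = 1 := by
    refine le_antisymm (val_le_one_iff.2 hu1) ?_
    have := val_le_one_iff.2 hu2
    rwa [map_inv₀, inv_le_one₀ (val_pos_iff.2 hu0)] at this
  have h3 : val p F (p : F) = val p F ϖ ^ e := by rw [h2, map_mul, hu, one_mul, map_pow]
  refine ⟨ϖ, h1, h3, Nat.pos_of_ne_zero ?_⟩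
  rintro rfl
  have := val_p_lt_one (p := p) (A := F)
  rw [h3, pow_zero] at this
  exact lt_irrefl _ this

theorem val_p_eq_of_le {ϖ : F} (h : val p F (p : F) = val p F ϖ ^ e) :
    val p W (p : W) = val p W (algebraMap F W ϖ) ^ e := by
  have h1 := (val_map_eq_iff (IsScalarTower.toAlgHom ℚ_[p] F W) (x := (p : F)) (y := ϖ ^ e)).2
    (by rw [h, map_pow])
  simpa using h1

variable (S) in
include S in
theorem finrank_maxUnramified (he : IsRamificationIndex p F e) :
    Module.finrank ℚ_[p] (maxUnramified p W) = S.d * Module.finrank ℚ_[p] (maxUnramified p F) := by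
  obtain ⟨ϖ, h1, h2, he0⟩ := exists_uniformizer he
  have hF := finrank_eq_mul_finrank h1 h2
  have hW := finrank_eq_mul_finrank (S.unramified ϖ h1) (val_p_eq_of_le h2)
  have := Module.finrank_mul_finrank ℚ_[p] F W
  have : e * Module.finrank ℚ_[p] (maxUnramified p W)
      = e * (S.d * Module.finrank ℚ_[p] (maxUnramified p F)) := by
    rw [← hW, ← this, hF, d]; ring
  exact Nat.eq_of_mul_eq_mul_left he0 this

-- A uniformizer of `F` remains one in `W`, so the integers of `W` are polynomials in it over
-- `W_ur`, which `zeta` generates over `ℚ_[p]`.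
variable (S) in
include S in
theorem adjoin_zeta_eq_top (he : IsRamificationIndex p F e) : F⟮zeta p W⟯ = ⊤ := by
  obtain ⟨ϖ, h1, h2, he0⟩ := exists_uniformizer he
  rw [eq_top_iff]
  intro x _
  obtain ⟨k, hk⟩ := exists_pow_mul_integral (p := p) x
  obtain ⟨α, hα⟩ := exists_expansion (S.unramified ϖ h1) (val_p_eq_of_le h2) hk
  have hur : maxUnramified p W ≤ F⟮zeta p W⟯.restrictScalars ℚ_[p] := by
    rw [maxUnramified_eq, IntermediateField.adjoin_simple_le_iff]
    exact IntermediateField.mem_adjoin_simple_self F _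
  have h3 : (p : W) ^ k * x ∈ F⟮zeta p W⟯ := by
    rw [hα]
    refine sum_mem fun i _ => mul_mem (hur (α i : maxUnramified p W).2) (pow_mem ?_ _)
    exact IntermediateField.algebraMap_mem _ _
  have hp0 := natCast_prime_ne_zero p W
  have h4 : x = ((p : W) ^ k)⁻¹ * ((p : W) ^ k * x) := by
    rw [inv_mul_cancel_left₀ (pow_ne_zero _ hp0)]
  rw [h4]
  exact mul_mem (inv_mem (pow_mem (_root_.natCast_mem _ _) _)) h3

variable (S) in
include S in
theorem finiteDimensional : FiniteDimensional F W :=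
  Module.Finite.of_restrictScalars_finite ℚ_[p] F W

variable (S) in
include S in
theorem isGalois (he : IsRamificationIndex p F e) : IsGalois F W := by
  have := S.finiteDimensional
  have hn : NeZero (zetaOrder p W) := ⟨zeta_spec.1.ne'⟩
  have : IsCyclotomicExtension {zetaOrder p W} F W := by
    rw [IsCyclotomicExtension.iff_singleton]
    refine ⟨⟨zeta p W, zeta_spec.2.2.1⟩, fun x => ?_⟩
    have hx : x ∈ Algebra.adjoin F {zeta p W} := by
      rw [← IntermediateField.adjoin_simple_toSubalgebra_of_isAlgebraic
        (Algebra.IsAlgebraic.isAlgebraic _), adjoin_zeta_eq_top S he]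
      trivial
    exact Algebra.adjoin_mono (by simpa using zeta_pow) hx
  exact IsCyclotomicExtension.isGalois {zetaOrder p W} F W

theorem d_pos : 0 < S.d := by
  have := S.finiteDimensional
  exact Module.finrank_pos

theorem orderOf_σ (he : IsRamificationIndex p F e) : orderOf S.σ = S.d := by
  have := S.finiteDimensional
  have := S.isGalois he
  have h : Subgroup.zpowers S.σ = ⊤ := by
    rw [eq_top_iff]
    exact fun g _ => S.generates g
  rw [← Nat.card_zpowers, h, d, ← IsGalois.card_aut_eq_finrank]
  exact Nat.card_congr Subgroup.topEquiv.toEquiv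

theorem σ_pow_eq_one_of_zeta (he : IsRamificationIndex p F e) {i : ℕ}
    (h : (S.σ ^ i) (zeta p W) = zeta p W) : S.σ ^ i = 1 := by
  have h1 : IntermediateField.fixedField (Subgroup.zpowers (S.σ ^ i)) = ⊤ := by
    rw [eq_top_iff, ← S.adjoin_zeta_eq_top he, IntermediateField.adjoin_simple_le_iff]
    rw [IntermediateField.mem_fixedField_iff]
    rintro f ⟨n, rfl⟩
    change (S.σ ^ i) ^ n ∈ MulAction.stabilizer (W ≃ₐ[F] W) (zeta p W)
    exact Subgroup.zpow_mem _ h _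
  ext x
  have hx : x ∈ IntermediateField.fixedField (Subgroup.zpowers (S.σ ^ i)) := by rw [h1]; trivial
  rw [IntermediateField.mem_fixedField_iff] at hx
  exact hx _ (Subgroup.mem_zpowers _)

theorem d_dvd_of_zeta (he : IsRamificationIndex p F e) {i : ℕ}
    (h : (S.σ ^ i) (zeta p W) = zeta p W) : S.d ∣ i := by
  rw [← orderOf_σ he]
  exact orderOf_dvd_of_pow_eq_one (σ_pow_eq_one_of_zeta he h)

theorem σ_pow_d (he : IsRamificationIndex p F e) : S.σ ^ S.d = 1 := by
  rw [← orderOf_σ he, pow_orderOf_eq_one]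

variable (S) in
/-- The embedding `W → D` over `ℚ_[p]`. -/
def embQ : W →ₐ[ℚ_[p]] D := S.emb.restrictScalars ℚ_[p]

theorem π_mul (w : W) : S.π * S.emb w = S.emb (S.σ w) * S.π := by
  rw [← S.conj, inv_mul_cancel_right₀ S.isUniformizer.ne_zero]

theorem π_pow_mul (i : ℕ) (w : W) : S.π ^ i * S.emb w = S.emb ((S.σ ^ i) w) * S.π ^ i := by
  induction i generalizing w with
  | zero => simp
  | succ i ih => rw [pow_succ, mul_assoc, π_mul, ← mul_assoc, ih, mul_assoc, pow_succ]; rfl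

variable (S) in
/-- The embedding `W_ur → D` over `ℚ_[p]`. -/
def embUr : maxUnramified p W →ₐ[ℚ_[p]] D := S.embQ.comp (maxUnramified p W).val

theorem finrank_D (he : IsRamificationIndex p F e) : Module.finrank ℚ_[p] D =
    (S.d * e) * Module.finrank ℚ_[p] (maxUnramified p W) := by
  obtain ⟨ϖ, h1, h2, he0⟩ := exists_uniformizer he
  have hW := finrank_eq_mul_finrank (S.unramified ϖ h1) (val_p_eq_of_le h2)
  have h3 := Module.finrank_mul_finrank ℚ_[p] F W
  have h4 := Module.finrank_mul_finrank ℚ_[p] F D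
  rw [← h4, S.finrank_eq, pow_two, ← mul_assoc, h3, hW, d]
  ring

/-- Conjugation by a unit of `D` is trivial on residues because the residue ring is commutative, and
roots of unity of order prime to `p` are determined by their residues. -/
theorem val_sub_zeta_lt {x : W} {i : ℕ} {v : D} (hv : val p D v = 1)
    (h : v * S.emb (zeta p W) = S.emb x * v) (hx : x = (S.σ ^ i) (zeta p W)) : x = zeta p W := by
  have hz : zeta p W ≠ 0 := by
    intro h0
    have := val_zeta_pow (p := p) (K := W) 1
    simp [h0] at this
  have hzv : val p D (S.emb (zeta p W)) = 1 := by
    have := (val_map_eq_one_iff S.embQ).2 (val_zeta_pow (p := p) (K := W) 1)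
    rwa [pow_one] at this
  have h1 := val_mul_sub_mul_lt hv.le hzv.le
  rw [h, ← sub_mul, map_mul, hv, mul_one, ← map_sub] at h1
  have h2 : val p W (x - zeta p W) < 1 := (val_map_lt_one_iff S.embQ).1 h1
  have h3 : x * (zeta p W)⁻¹ = 1 := by
    refine eq_one_of_val_sub_one_lt (p := p) (m := zetaOrder p W) zeta_spec.2.1 ?_ ?_
    · rw [mul_pow, inv_pow, zeta_pow, hx, ← map_pow, zeta_pow, map_one, inv_one, mul_one]
    · have h4 : x * (zeta p W)⁻¹ - 1 = (x - zeta p W) * (zeta p W)⁻¹ := by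
        rw [sub_mul, mul_inv_cancel₀ hz]
      have h5 := val_zeta_pow (p := p) (K := W) 1
      rw [pow_one] at h5
      rw [h4, map_mul, map_inv₀, h5, inv_one, mul_one]
      exact h2
  exact (mul_inv_eq_one₀ hz).1 h3

variable (S) in
/-- The map `(α_j) ↦ ∑ α_j π ^ (N + j)`. -/
def expand (N E : ℕ) : (Fin E → maxUnramified p W) →ₗ[ℚ_[p]] D where
  toFun α := ∑ j, S.embUr (α j) * S.π ^ (N + j : ℕ)
  map_add' α β := by simp [add_mul, Finset.sum_add_distrib]
  map_smul' a α := by simp [Finset.smul_sum]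

theorem expand_injective {E : ℕ} (hE : val p D (p : D) = val p D S.π ^ E) (N : ℕ) :
    Function.Injective (S.expand N E) := by
  rw [injective_iff_map_eq_zero]
  intro α hα
  exact eq_zero_of_sum_eq_zero S.isUniformizer isUniformizer_p_maxUnramified S.embUr
    (by rw [map_natCast, hE]) N α hα

/-- Let a uniformizer `ϖ` of `F` have the value of `π ^ r`. The unit `π ^ r ϖ⁻¹` induces `σ ^ r` on
`W`, hence `d ∣ r`. Independence of the monomials over `W_ur` and the dimension of `D` give `r e ≤ d
e`, so `r = d`. -/
theorem val_p_eq (he : IsRamificationIndex p F e) :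
    val p D (p : D) = val p D S.π ^ (S.d * e) := by
  obtain ⟨ϖ, h1, h2, he0⟩ := exists_uniformizer he
  have hϖ0 : S.embQ (algebraMap F W ϖ) ≠ 0 := by simpa using h1.ne_zero
  have hϖ1 : val p D (S.embQ (algebraMap F W ϖ)) < 1 :=
    (val_map_lt_one_iff S.embQ).2 (S.unramified ϖ h1).val_lt_one
  obtain ⟨r, hr⟩ := S.isUniformizer.exists_zpow hϖ0
  have hr0 : 0 < r := by
    by_contra! h
    rw [hr] at hϖ1
    exact hϖ1.not_ge (one_le_zpow_of_nonpos₀ S.isUniformizer.val_pos S.isUniformizer.val_lt_one.le h)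
  lift r to ℕ using hr0.le
  rw [zpow_natCast] at hr
  have hcast : S.embQ (algebraMap F W ϖ) = algebraMap F D ϖ := S.emb.commutes ϖ
  have hp : val p D (p : D) = val p D S.π ^ (r * e) := by
    rw [pow_mul, ← hr, ← map_pow, ← map_pow, ← map_natCast S.embQ p, val_map_eq_iff, map_pow]
    exact val_p_eq_of_le h2
  have hdvd : S.d ∣ r := by
    refine d_dvd_of_zeta he (val_sub_zeta_lt (S := S) (v := S.π ^ r * (algebraMap F D ϖ)⁻¹) ?_ ?_ rfl)
    · rw [map_mul, map_inv₀, ← hcast, hr, map_pow, mul_inv_cancel₀]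
      exact pow_ne_zero _ S.isUniformizer.val_pos.ne'
    · rw [← map_inv₀, mul_assoc, Algebra.commutes, ← mul_assoc, π_pow_mul, mul_assoc]
  have hle : r * e ≤ S.d * e := by
    have h3 := LinearMap.finrank_le_finrank_of_injective (expand_injective (S := S) hp 0)
    rw [Module.finrank_pi_fintype, finrank_D (S := S) he, Finset.sum_const, Finset.card_univ,
      Fintype.card_fin, smul_eq_mul] at h3
    exact Nat.le_of_mul_le_mul_right h3 Module.finrank_pos
  have hrd : r = S.d := le_antisymm (Nat.le_of_mul_le_mul_right hle he0)
    (Nat.le_of_dvd (by exact_mod_cast hr0) hdvd)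
  rw [hp, hrd]

theorem expand_bijective (he : IsRamificationIndex p F e) (N : ℕ) :
    Function.Bijective (S.expand N (S.d * e)) := by
  have hi := expand_injective (S := S) (val_p_eq he) N
  refine ⟨hi, (LinearMap.injective_iff_surjective_of_finrank_eq_finrank ?_).1 hi⟩
  rw [Module.finrank_pi_fintype, finrank_D (S := S) he]
  simp

/-- For `x = w π ^ i` the commutator of `zeta` and `x` is `(zeta - σ ^ i (zeta)) x`. It has reduced
trace zero, and the scalar factor is invertible, so it can be absorbed into `w`. -/
theorem trd_emb_mul_pow (he : IsRamificationIndex p F e) {i : ℕ} (hi : ¬ S.d ∣ i) (w : W) :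
    S.trd (S.emb w * S.π ^ i) = 0 := by
  have hz : zeta p W ≠ 0 := by
    intro h0
    have := val_zeta_pow (p := p) (K := W) 1
    simp [h0] at this
  have hne : (S.σ ^ i) (zeta p W) ≠ zeta p W := fun h => hi (d_dvd_of_zeta he h)
  have key : ∀ w : W, S.trd (S.emb ((zeta p W - (S.σ ^ i) (zeta p W)) * w) * S.π ^ i) = 0 := by
    intro w
    have h1 := S.trd_mul_comm (S.emb (zeta p W)) (S.emb w * S.π ^ i)
    rw [← sub_eq_zero, ← trd_sub] at h1
    rw [← h1]
    congr 1
    rw [mul_assoc (S.emb w), π_pow_mul, ← mul_assoc, ← mul_assoc, ← sub_mul, ← map_mul, ← map_mul,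
      ← map_sub]
    congr 2
    ring
  have h2 := key ((zeta p W - (S.σ ^ i) (zeta p W))⁻¹ * w)
  rwa [mul_inv_cancel_left₀ (sub_ne_zero.2 hne.symm)] at h2

end Structure

/-! ### Traces and partial traces on W_ur / O -/

section Quotients
variable {S} {e : ℕ}

theorem _root_.NormOne.ModInt.mk_eq_zero_iff {K : Type*} [Field K] [Algebra ℤ_[p] K] {x : K} :
    (Submodule.Quotient.mk x : ModInt p K) = 0 ↔ IsIntegral ℤ_[p] x := by
  rw [Submodule.Quotient.mk_eq_zero, Submodule.mem_one]
  constructor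
  · rintro ⟨y, rfl⟩; exact y.2
  · intro h; exact ⟨⟨x, h⟩, rfl⟩

theorem _root_.NormOne.ModInt.exists_mk {K : Type*} [Field K] [Algebra ℤ_[p] K] (l : ModInt p K) :
    ∃ x : K, l = Submodule.Quotient.mk x := by
  obtain ⟨x, rfl⟩ := Submodule.Quotient.mk_surjective _ l
  exact ⟨x, rfl⟩

theorem coe_sig (i : ℕ) (x : maxUnramified p W) : (S.sig i x : W) = (S.σ ^ i) (x : W) := rfl

theorem coe_inc (x : maxUnramified p F) : (S.inc x : W) = algebraMap F W x := rfl

theorem sig_add (i j : ℕ) (x : maxUnramified p W) : S.sig (i + j) x = S.sig i (S.sig j x) := by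
  ext; rw [coe_sig, coe_sig, coe_sig, pow_add]; rfl

theorem sig_d (he : IsRamificationIndex p F e) (x : maxUnramified p W) : S.sig S.d x = x := by
  ext; rw [coe_sig, σ_pow_d he]; rfl

theorem sig_inc (i : ℕ) (x : maxUnramified p F) : S.sig i (S.inc x) = S.inc x := by
  ext; rw [coe_sig, coe_inc, AlgEquiv.commutes]

theorem sigw_mk (i : ℕ) (x : maxUnramified p W) :
    S.sigw i (Submodule.Quotient.mk x) = Submodule.Quotient.mk (S.sig i x) := rfl

theorem incw_mk (x : maxUnramified p F) :
    S.incw (Submodule.Quotient.mk x) = Submodule.Quotient.mk (S.inc x) := rfl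

theorem tr_mk (x : maxUnramified p W) : S.tr (Submodule.Quotient.mk x) =
    Submodule.Quotient.mk (Algebra.trace ℚ_[p] (maxUnramified p W) x) := rfl

theorem coe_sigO (i : ℕ) (α : S.O) : (S.sigO i α : maxUnramified p W) = S.sig i α := rfl

theorem sigw_zero (l : S.qW) : S.sigw 0 l = l := by
  obtain ⟨x, rfl⟩ := ModInt.exists_mk l
  rfl

theorem sigw_add (i j : ℕ) (l : S.qW) : S.sigw (i + j) l = S.sigw i (S.sigw j l) := by
  obtain ⟨x, rfl⟩ := ModInt.exists_mk l
  rw [sigw_mk, sigw_mk, sigw_mk, sig_add]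

theorem sigw_d (he : IsRamificationIndex p F e) (l : S.qW) : S.sigw S.d l = l := by
  obtain ⟨x, rfl⟩ := ModInt.exists_mk l
  rw [sigw_mk, sig_d he]

theorem sigw_incw (i : ℕ) (l : S.qF) : S.sigw i (S.incw l) = S.incw l := by
  obtain ⟨x, rfl⟩ := ModInt.exists_mk l
  rw [incw_mk, sigw_mk, sig_inc]

theorem sigw_smul (i : ℕ) (α : S.O) (l : S.qW) :
    S.sigw i (α • l) = S.sigO i α • S.sigw i l := by
  obtain ⟨x, rfl⟩ := ModInt.exists_mk l
  rw [ModInt.smul_mk, sigw_mk, sigw_mk, ModInt.smul_mk, coe_sigO, map_mul]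

theorem sigO_add (i j : ℕ) (α : S.O) : S.sigO (i + j) α = S.sigO i (S.sigO j α) :=
  Subtype.ext (sig_add i j _)

theorem sigO_incO (i : ℕ) (α : S.OF) : S.sigO i (S.incO α) = S.incO α :=
  Subtype.ext (sig_inc i _)

theorem incw_injective : Function.Injective S.incw := by
  rw [injective_iff_map_eq_zero]
  intro l hl
  obtain ⟨x, rfl⟩ := ModInt.exists_mk l
  rw [incw_mk, ModInt.mk_eq_zero_iff, ← val_le_one_iff, val_map_le_one_iff, val_le_one_iff] at hl
  exact ModInt.mk_eq_zero_iff.2 hl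

theorem tr_sigw (i : ℕ) (l : S.qW) : S.tr (S.sigw i l) = S.tr l := by
  obtain ⟨x, rfl⟩ := ModInt.exists_mk l
  rw [sigw_mk, tr_mk, tr_mk]
  congr 1
  exact Algebra.trace_eq_of_algEquiv (AlgEquiv.ofBijective (S.sig i)
    (AlgHom.bijective (S.sig i))) x

/-- Nondegeneracy of the trace pairing, used to extract identities in `W_ur / O` from values of a
form. -/
theorem eq_zero_of_tr {l : S.qW} (h : ∀ α : S.O, S.tr (α • l) = 0) : l = 0 := by
  obtain ⟨x, rfl⟩ := ModInt.exists_mk l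
  rw [ModInt.mk_eq_zero_iff]
  refine isIntegral_of_trace isUniformizer_p_maxUnramified fun y hy => ?_
  have := h ⟨y, hy⟩
  rwa [ModInt.smul_mk, tr_mk, ModInt.mk_eq_zero_iff] at this

/-- As many distinct endomorphisms as the degree exhaust the automorphism group and make the
extension Galois. -/
theorem _root_.NormOne.trace_eq_sum_of_injective {K L : Type*} [Field K] [Field L] [Algebra K L]
    [FiniteDimensional K L] {n : ℕ} (τ : Fin n → L →ₐ[K] L) (hτ : Function.Injective τ)
    (hn : Module.finrank K L = n) (x : L) :
    algebraMap K L (Algebra.trace K L x) = ∑ i, τ i x := by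
  let τ' : Fin n → L ≃ₐ[K] L := fun i => AlgEquiv.ofBijective (τ i) (AlgHom.bijective _)
  have hτ' : Function.Injective τ' := fun i j h => hτ (AlgHom.ext fun x => congrArg (fun g => g x) h)
  have hcard : Fintype.card (L ≃ₐ[K] L) ≤ n := hn ▸ AlgEquiv.card_le
  have hbij : Function.Bijective τ' := by
    rw [Fintype.bijective_iff_injective_and_card]
    refine ⟨hτ', le_antisymm ?_ (by simpa using hcard)⟩
    exact Fintype.card_le_of_injective _ hτ'
  have : IsGalois K L := IsGalois.of_card_aut_eq_finrank K L (by
    rw [hn, Nat.card_eq_fintype_card, ← Fintype.card_of_bijective hbij, Fintype.card_fin])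
  rw [trace_eq_sum_automorphisms]
  exact (Fintype.sum_bijective τ' hbij (fun i => τ i x) (fun g => g x) fun _ => rfl).symm

/-- The maps `1, σ, …, σ ^ (d - 1)` already differ on `zeta`, and `W_ur` has degree `d` over `F_ur`,
so their sum is the full trace. -/
theorem incw_Tr (he : IsRamificationIndex p F e) (l : S.qW) :
    S.incw (S.Tr l) = S.partialTrace l S.d := by
  obtain ⟨x, rfl⟩ := ModInt.exists_mk l
  let _ : Algebra (maxUnramified p F) (maxUnramified p W) := S.inc.toRingHom.toAlgebra
  have _ : IsScalarTower ℚ_[p] (maxUnramified p F) (maxUnramified p W) :=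
    IsScalarTower.of_algebraMap_eq fun x => (S.inc.commutes x).symm
  have _ : FiniteDimensional (maxUnramified p F) (maxUnramified p W) :=
    Module.Finite.of_restrictScalars_finite ℚ_[p] _ _
  have h1 : S.Tr (Submodule.Quotient.mk x) = Submodule.Quotient.mk
    (Algebra.trace (maxUnramified p F) (maxUnramified p W) x) := rfl
  have h2 : Module.finrank (maxUnramified p F) (maxUnramified p W) = S.d := by
    have h3 := Module.finrank_mul_finrank ℚ_[p] (maxUnramified p F) (maxUnramified p W)
    rw [S.finrank_maxUnramified he, mul_comm] at h3
    exact Nat.eq_of_mul_eq_mul_right Module.finrank_pos h3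
  let τ : Fin S.d → (maxUnramified p W →ₐ[maxUnramified p F] maxUnramified p W) := fun i =>
    { S.sig i with commutes' := fun c => sig_inc i c }
  have hτ : ∀ i x, τ i x = S.sig i x := fun _ _ => rfl
  have hτi : Function.Injective τ := by
    have key : ∀ i j : Fin S.d, i < j → τ i ≠ τ j := by
      intro i j hij h
      have h4 : S.sig i ⟨zeta p W, zeta_mem_maxUnramified⟩ = S.sig j ⟨zeta p W, zeta_mem_maxUnramified⟩ := by
        rw [← hτ, ← hτ, h]
      have h5 : (S.σ ^ (i : ℕ)) (zeta p W) = (S.σ ^ (j : ℕ)) (zeta p W) := congrArg Subtype.val h4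
      obtain ⟨k, hk⟩ := Nat.exists_eq_add_of_lt hij
      rw [hk, add_assoc, pow_add] at h5
      have h6 := d_dvd_of_zeta he ((S.σ ^ (i : ℕ)).injective h5).symm
      have := Nat.le_of_dvd (Nat.succ_pos k) h6
      have := j.2
      omega
    intro i j h
    rcases lt_trichotomy i j with h' | h' | h'
    · exact absurd h (key i j h')
    · exact h'
    · exact absurd h.symm (key j i h')
  have h7 : S.inc (Algebra.trace (maxUnramified p F) (maxUnramified p W) x) =
      ∑ i ∈ Finset.range S.d, S.sig i x := by
    rw [Finset.sum_range]
    exact trace_eq_sum_of_injective τ hτi h2 x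
  rw [h1, incw_mk, h7, partialTrace]
  simp_rw [sigw_mk]
  exact map_sum (Submodule.mkQ (1 : Submodule (integralClosure ℤ_[p] (maxUnramified p W))
    (maxUnramified p W))) _ _

/-! Partial traces. -/

/-- The identity behind antisymmetry, the cyclic identity and their converse. -/
theorem partialTrace_add (l : S.qW) (i j : ℕ) :
    S.partialTrace l (i + j) = S.partialTrace l i + S.sigw i (S.partialTrace l j) := by
  rw [partialTrace, partialTrace, partialTrace, Finset.sum_range_add, map_sum]
  simp_rw [sigw_add]

theorem partialTrace_d_mul (he : IsRamificationIndex p F e) (l : S.qW) (k : ℕ) :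
    S.partialTrace l (S.d * k) = k • S.incw (S.Tr l) := by
  induction k with
  | zero => simp [partialTrace]
  | succ k ih =>
    rw [mul_add, mul_one, add_comm, partialTrace_add, ih, ← incw_Tr he, map_nsmul, sigw_incw,
      succ_nsmul, add_comm]

theorem partialTrace_add_d_mul (he : IsRamificationIndex p F e) (l : S.qW) (i k : ℕ) :
    S.partialTrace l (i + S.d * k) = S.partialTrace l i + k • S.incw (S.Tr l) := by
  rw [partialTrace_add, partialTrace_d_mul he, map_nsmul, sigw_incw]

theorem partialTrace_add' (l m : S.qW) (i : ℕ) :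
    S.partialTrace (l + m) i = S.partialTrace l i + S.partialTrace m i := by
  simp [partialTrace, Finset.sum_add_distrib]

theorem partialTrace_smul (c : S.OF) (l : S.qW) (i : ℕ) :
    S.partialTrace (S.incO c • l) i = S.incO c • S.partialTrace l i := by
  rw [partialTrace, partialTrace, Finset.smul_sum]
  refine Finset.sum_congr rfl fun j _ => ?_
  rw [sigw_smul, sigO_incO]

variable (S) in
/-- `partialTrace` as an additive map. -/
def partialTraceHom (i : ℕ) : S.qW →+ S.qW where
  toFun l := S.partialTrace l i
  map_zero' := by simp [partialTrace]
  map_add' l m := partialTrace_add' l m i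

theorem partialTraceHom_apply (i : ℕ) (l : S.qW) : S.partialTraceHom i l = S.partialTrace l i := rfl

variable (S) in
/-- The map induced by the trace from `W_ur` to `F_ur`, as an endomorphism. -/
def trw : S.qW →+ S.qW := (S.incw.toAddMonoidHom).comp S.Tr.toAddMonoidHom

theorem trw_apply (l : S.qW) : S.trw l = S.incw (S.Tr l) := rfl

theorem trw_smul (he : IsRamificationIndex p F e) (c : S.OF) (l : S.qW) :
    S.trw (S.incO c • l) = S.incO c • S.trw l := by
  rw [trw_apply, trw_apply, incw_Tr he, incw_Tr he, partialTrace_smul]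

theorem padicInt_smul_smul (z : ℤ_[p]) (α : S.O) (l : S.qW) : (z • α) • l = z • α • l := by
  obtain ⟨x, rfl⟩ := ModInt.exists_mk l
  rw [ModInt.smul_mk, ModInt.smul_mk]
  change Submodule.Quotient.mk ((z • (α : maxUnramified p W)) * x) = _
  rw [smul_mul_assoc]
  rfl

variable (S) in
/-- The bilinear map `(α, β) ↦ tr(l α σ ^ i (β))`. -/
def pairing (i : ℕ) (l : S.qW) : S.O →ₗ[ℤ_[p]] S.O →ₗ[ℤ_[p]] ModInt p ℚ_[p] :=
  LinearMap.mk₂ ℤ_[p] (fun α β => S.tr ((α * S.sigO i β) • l))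
    (fun α α' β => by rw [add_mul, add_smul, map_add])
    (fun z α β => by
      rw [smul_mul_assoc, padicInt_smul_smul]
      exact map_smul S.tr z _)
    (fun α β β' => by rw [map_add, mul_add, add_smul, map_add])
    (fun z α β => by
      rw [map_smul (S.sigO i) z β, mul_smul_comm, padicInt_smul_smul]
      exact map_smul S.tr z _)

theorem pairing_apply (i : ℕ) (l : S.qW) (α β : S.O) :
    S.pairing i l α β = S.tr ((α * S.sigO i β) • l) := rfl

end Quotients

/-! ### Monomial coordinates on π ^ N O_D and the form of a sequence -/

section Lattice
variable {S} {e : ℕ}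

theorem toD_add (α β : S.O) : S.toD (α + β) = S.toD α + S.toD β := map_add S.embUr _ _

theorem toD_mul (α β : S.O) : S.toD (α * β) = S.toD α * S.toD β := map_mul S.embUr _ _

theorem toD_smul (z : ℤ_[p]) (α : S.O) : S.toD (z • α) = z • S.toD α :=
  map_smul (S.embUr.restrictScalars ℤ_[p]) z _

theorem toD_natCast (n : ℕ) : S.toD (n : S.O) = n := map_natCast S.embUr n

theorem toD_incO (c : S.OF) : S.toD (S.incO c) = algebraMap F D ((c : maxUnramified p F) : F) :=
  S.emb.commutes _

theorem π_pow_mul_toD (i : ℕ) (β : S.O) : S.π ^ i * S.toD β = S.toD (S.sigO i β) * S.π ^ i :=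
  π_pow_mul i _

theorem val_toD_le (α : S.O) : val p D (S.toD α) ≤ 1 :=
  (val_map_le_one_iff S.embUr).2 (val_le_one_iff.2 α.2)

theorem val_π_pow_le {i j : ℕ} (h : i ≤ j) : val p D S.π ^ j ≤ val p D S.π ^ i :=
  pow_le_pow_of_le_one zero_le S.isUniformizer.val_lt_one.le h

variable (S) in
/-- The lattice `π ^ N O_D`. -/
def lattice (N : ℕ) : Submodule ℤ_[p] D where
  carrier := {x | val p D x ≤ val p D S.π ^ N}
  zero_mem' := by simp
  add_mem' hx hy := (val p D).map_add_le hx hy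
  smul_mem' z x hx := by
    change val p D (z • x) ≤ _
    rw [Algebra.smul_def, map_mul]
    exact (mul_le_of_le_one_left' (val_algebraMap_le z)).trans hx

variable {N : ℕ}

theorem mem_lattice {x : D} : x ∈ S.lattice N ↔ val p D x ≤ val p D S.π ^ N := Iff.rfl

theorem toD_mul_pow_mem (α : S.O) {i : ℕ} (hi : N ≤ i) : S.toD α * S.π ^ i ∈ S.lattice N := by
  rw [mem_lattice, map_mul, map_pow]
  exact (mul_le_of_le_one_left' (val_toD_le α)).trans (val_π_pow_le hi)

variable (S N) in
/-- The map `α ↦ α π ^ (N + i)`. -/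
def mono (i : ℕ) : S.O →ₗ[ℤ_[p]] S.lattice N where
  toFun α := ⟨S.toD α * S.π ^ (N + i), toD_mul_pow_mem α (Nat.le_add_right _ _)⟩
  map_add' α β := Subtype.ext ((congrArg (· * _) (toD_add α β)).trans (add_mul _ _ _))
  map_smul' z α := Subtype.ext ((congrArg (· * _) (toD_smul z α)).trans (smul_mul_assoc _ _ _))

theorem coe_mono (i : ℕ) (α : S.O) : (S.mono N i α : D) = S.toD α * S.π ^ (N + i) := rfl

variable (S N) in
/-- The map `(α_i) ↦ ∑ α_i π ^ (N + i)` on integral coefficients. -/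
def monoSum (E : ℕ) : (Fin E → S.O) →ₗ[ℤ_[p]] S.lattice N :=
  ∑ i : Fin E, (S.mono N i).comp (LinearMap.proj i)

theorem monoSum_apply (E : ℕ) (α : Fin E → S.O) :
    S.monoSum N E α = ∑ i : Fin E, S.mono N i (α i) := by
  simp [monoSum]

theorem coe_monoSum (E : ℕ) (α : Fin E → S.O) :
    (S.monoSum N E α : D) = S.expand N E (fun i => α i) := by
  rw [monoSum_apply, AddSubmonoidClass.coe_finsetSum]
  rfl

/-- The `d e` consecutive powers of `π` are a basis of `D` over `W_ur`, and since terms cannot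
cancel, an element of the lattice has integral coefficients. -/
theorem monoSum_bijective (he : IsRamificationIndex p F e) :
    Function.Bijective (S.monoSum N (S.d * e)) := by
  constructor
  · intro α β h
    have h1 := congrArg Subtype.val h
    rw [coe_monoSum, coe_monoSum] at h1
    have h2 := (expand_bijective (S := S) he N).1 h1
    ext1 i
    exact Subtype.ext (congrFun h2 i)
  · intro x
    obtain ⟨α, hα⟩ := (expand_bijective (S := S) he N).2 x
    have hint : ∀ i, IsIntegral ℤ_[p] (α i) := by
      refine isIntegral_of_sum S.isUniformizer (isUniformizer_p_maxUnramified (K := W)) S.embUr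
        (by rw [map_natCast, val_p_eq (S := S) he]) N α ?_
      have := x.2
      rw [← hα] at this
      exact this
    refine ⟨fun i => ⟨α i, hint i⟩, Subtype.ext ?_⟩
    rw [coe_monoSum]
    exact hα

variable (N) in
/-- The coefficients of an element of the lattice. -/
def coeffs (he : IsRamificationIndex p F e) : S.lattice N ≃ₗ[ℤ_[p]] (Fin (S.d * e) → S.O) :=
  (LinearEquiv.ofBijective _ (monoSum_bijective (S := S) (N := N) he)).symm

theorem coeffs_mono (he : IsRamificationIndex p F e) (i : Fin (S.d * e)) (α : S.O) :
    coeffs N he (S.mono N i α) = Pi.single i α := by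
  rw [coeffs, LinearEquiv.symm_apply_eq, LinearEquiv.ofBijective_apply, monoSum_apply,
    Finset.sum_eq_single i]
  · rw [Pi.single_eq_same]
  · intro j _ hj
    rw [Pi.single_eq_of_ne hj, map_zero]
  · simp

theorem lattice_induction (he : IsRamificationIndex p F e) {P : S.lattice N → Prop}
    (hm : ∀ i α, P (S.mono N i α)) (ha : ∀ x y, P x → P y → P (x + y)) (x : S.lattice N) : P x := by
  obtain ⟨α, rfl⟩ := (monoSum_bijective (S := S) (N := N) he).2 x
  rw [monoSum_apply]
  refine Finset.sum_induction _ P ha ?_ fun i _ => hm i _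
  have := hm 0 0
  rwa [map_zero] at this

/-- The coefficients `p c_k`. -/
def relCoeff (c : Fin e → S.OF) (k : Fin e) : S.O := (p : S.O) * S.incO (c k)

/-- The relation for `τ = π ^ d` applied to the factor `π ^ (d e)`; its coefficients lie in `F`, so
they can be moved to the left of `α π ^ (N + i)`. -/
theorem mono_add (c : Fin e → S.OF)
    (hc : (S.π ^ S.d) ^ e =
      (p : D) * ∑ k : Fin e, algebraMap F D ((c k : maxUnramified p F) : F) * (S.π ^ S.d) ^ (k : ℕ))
    (i : ℕ) (α : S.O) : S.mono N (i + S.d * e) α =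
      ∑ k : Fin e, S.mono N (i + S.d * k) (relCoeff c k * α) := by
  ext
  rw [AddSubmonoidClass.coe_finsetSum, coe_mono]
  simp_rw [coe_mono]
  rw [← add_assoc, pow_add, pow_mul, hc, ← mul_assoc, Finset.mul_sum, Finset.mul_sum]
  refine Finset.sum_congr rfl fun k _ => ?_
  rw [relCoeff, toD_mul, toD_mul, toD_natCast, toD_incO, ← add_assoc, pow_add _ _ (S.d * k), pow_mul]
  have h1 := Nat.cast_comm p (S.toD α * S.π ^ (N + i))
  have h2 := Algebra.commutes ((c k : maxUnramified p F) : F) (S.toD α * S.π ^ (N + i))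
  rw [← mul_assoc, ← mul_assoc, ← h1, mul_assoc (p : D), ← h2]
  simp only [mul_assoc]

/-! The bilinear form attached to a sequence. -/

variable (S) in
/-- The value of `λ_{i,j}` prescribed by a sequence. -/
def lam (κ : ℕ → S.qW) (i j : ℕ) : S.qW :=
  if S.d ∣ i + j then S.partialTrace (κ ((i + j) / S.d)) i else 0

theorem lam_of_add_eq {κ : ℕ → S.qW} {i j n : ℕ} (h : i + j = S.d * n) :
    S.lam κ i j = S.partialTrace (κ n) i := by
  rw [lam, h, if_pos (dvd_mul_right _ _), Nat.mul_div_cancel_left _ d_pos]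

theorem lam_of_not_dvd {κ : ℕ → S.qW} {i j : ℕ} (h : ¬ S.d ∣ i + j) : S.lam κ i j = 0 := if_neg h

variable (N) in
/-- The bilinear form on the lattice attached to a sequence. -/
def form (he : IsRamificationIndex p F e) (κ : ℕ → S.qW) :
    S.lattice N →ₗ[ℤ_[p]] S.lattice N →ₗ[ℤ_[p]] ModInt p ℚ_[p] :=
  ∑ i : Fin (S.d * e), ∑ j : Fin (S.d * e), (S.pairing (N + i) (S.lam κ (N + i) (N + j))).compl₁₂
    ((LinearMap.proj i).comp (coeffs N he).toLinearMap)
    ((LinearMap.proj j).comp (coeffs N he).toLinearMap)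

theorem form_apply (he : IsRamificationIndex p F e) (κ : ℕ → S.qW) (x y : S.lattice N) :
    form N he κ x y = ∑ i : Fin (S.d * e), ∑ j : Fin (S.d * e),
      S.pairing (N + i) (S.lam κ (N + i) (N + j)) (coeffs N he x i) (coeffs N he y j) := by
  simp only [form, LinearMap.sum_apply]
  rfl

theorem form_mono_of_lt (he : IsRamificationIndex p F e) (κ : ℕ → S.qW) (i j : Fin (S.d * e))
    (α β : S.O) : form N he κ (S.mono N i α) (S.mono N j β) =
      S.pairing (N + i) (S.lam κ (N + i) (N + j)) α β := by
  rw [form_apply, Finset.sum_eq_single i, Finset.sum_eq_single j, coeffs_mono, coeffs_mono,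
    Pi.single_eq_same, Pi.single_eq_same]
  · intro k _ hk
    rw [coeffs_mono, coeffs_mono, Pi.single_eq_of_ne hk, map_zero]
  · simp
  · intro k _ hk
    refine Finset.sum_eq_zero fun l _ => ?_
    rw [coeffs_mono, coeffs_mono, Pi.single_eq_of_ne hk, map_zero, LinearMap.zero_apply]
  · simp

end Lattice

theorem _root_.NormOne.eq_zero_of_nsmul_eq_zero {M : Type*} [AddCommGroup M] [Module ℤ_[p] M] {m : ℕ}
    (hm : m.Coprime p) {x : M} (h : m • x = 0) : x = 0 := by
  have hu : IsUnit (m : ℤ_[p]) := by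
    rw [PadicInt.isUnit_iff, PadicInt.norm_natCast_eq_one_iff]
    exact hm.symm
  rw [← Nat.cast_smul_eq_nsmul ℤ_[p]] at h
  exact hu.smul_eq_zero.1 h

/-! ### Antisymmetry, cyclicity and invariance of the form -/

section Cocycle
variable {S} {e N : ℕ}

theorem smul_smul' (α β : S.O) (l : S.qW) : α • β • l = (α * β) • l := by
  obtain ⟨x, rfl⟩ := ModInt.exists_mk l
  rw [ModInt.smul_mk, ModInt.smul_mk, ModInt.smul_mk, MulMemClass.coe_mul, mul_assoc]

/-- The recurrence and torsion conditions on a sequence, for indices `n` such that `2 N ≤ d n`. -/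
structure Compat (S : Frame p F W D) (N : ℕ) (c : Fin e → S.OF) (κ : ℕ → S.qW) : Prop where
  rel : ∀ n, 2 * N ≤ S.d * n → κ (n + e) = ∑ k : Fin e, relCoeff c k • κ (n + k)
  tors : ∀ n, 2 * N ≤ S.d * n → n • S.trw (κ n) = 0

theorem relCoeff_eq (c : Fin e → S.OF) (k : Fin e) : relCoeff c k = S.incO ((p : S.OF) * c k) := by
  rw [relCoeff, map_mul, map_natCast]

theorem lam_add_left (he : IsRamificationIndex p F e) {c : Fin e → S.OF} {κ : ℕ → S.qW}
    (h : Compat S N c κ) {i j : ℕ} (hi : N ≤ i) (hj : N ≤ j) :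
    S.lam κ (i + S.d * e) j = ∑ k : Fin e, relCoeff c k • S.lam κ (i + S.d * k) j := by
  by_cases hd : S.d ∣ i + j
  · obtain ⟨n, hn⟩ := hd
    have hn' : 2 * N ≤ S.d * n := by omega
    have hk : ∀ k, S.lam κ (i + S.d * k) j
        = S.partialTrace (κ (n + k)) i + k • S.trw (κ (n + k)) := by
      intro k
      rw [lam_of_add_eq (n := n + k) (by rw [mul_add]; omega), partialTrace_add_d_mul he, trw_apply]
    have hpos : ∀ k, 2 * N ≤ S.d * (n + k) := fun k => by rw [mul_add]; omega
    have htr : S.trw (κ (n + e)) = ∑ k : Fin e, relCoeff c k • S.trw (κ (n + k)) := by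
      rw [h.rel n hn', map_sum]
      refine Finset.sum_congr rfl fun k _ => ?_
      rw [relCoeff_eq, trw_smul he]
    have hpt : S.partialTrace (κ (n + e)) i = ∑ k : Fin e, relCoeff c k • S.partialTrace (κ (n + k)) i := by
      rw [h.rel n hn', ← partialTraceHom_apply, map_sum]
      refine Finset.sum_congr rfl fun k _ => ?_
      rw [partialTraceHom_apply, relCoeff_eq, partialTrace_smul]
    -- The torsion condition at index `n + k` trades the varying factor `k` for the constant `-n`,
    -- so the recurrence for the traces can be applied.
    have hneg : ∀ k, k • S.trw (κ (n + k)) = - (n • S.trw (κ (n + k))) := by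
      intro k
      rw [eq_neg_iff_add_eq_zero, ← add_smul, add_comm k]
      exact h.tors _ (hpos k)
    simp_rw [hk, smul_add, Finset.sum_add_distrib, ← hpt, hneg, htr, smul_neg,
      Finset.sum_neg_distrib, Finset.smul_sum]
    congr 2
    refine Finset.sum_congr rfl fun k _ => ?_
    rw [smul_comm]
  · rw [lam_of_not_dvd, Finset.sum_eq_zero]
    · intro k _
      rw [lam_of_not_dvd, smul_zero]
      rwa [add_right_comm, Nat.dvd_add_left (dvd_mul_right _ _)]
    · rwa [add_right_comm, Nat.dvd_add_left (dvd_mul_right _ _)]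

/-- Shifting `j` keeps the length `i` of the partial trace, so the recurrence alone suffices. -/
theorem lam_add_right {c : Fin e → S.OF} {κ : ℕ → S.qW}
    (h : Compat S N c κ) {i j : ℕ} (hi : N ≤ i) (hj : N ≤ j) :
    S.lam κ i (j + S.d * e) = ∑ k : Fin e, relCoeff c k • S.lam κ i (j + S.d * k) := by
  by_cases hd : S.d ∣ i + j
  · obtain ⟨n, hn⟩ := hd
    have hn' : 2 * N ≤ S.d * n := by omega
    have hk : ∀ k, S.lam κ i (j + S.d * k) = S.partialTrace (κ (n + k)) i := by
      intro k
      rw [lam_of_add_eq (n := n + k) (by rw [mul_add]; omega)]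
    simp_rw [hk]
    rw [h.rel n hn', ← partialTraceHom_apply, map_sum]
    refine Finset.sum_congr rfl fun k _ => ?_
    rw [partialTraceHom_apply, relCoeff_eq, partialTrace_smul]
  · rw [lam_of_not_dvd, Finset.sum_eq_zero]
    · intro k _
      rw [lam_of_not_dvd, smul_zero]
      rwa [← add_assoc, Nat.dvd_add_left (dvd_mul_right _ _)]
    · rwa [← add_assoc, Nat.dvd_add_left (dvd_mul_right _ _)]

theorem sigO_add_d_mul (he : IsRamificationIndex p F e) (i k : ℕ) (β : S.O) :
    S.sigO (i + S.d * k) β = S.sigO i β := by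
  refine Subtype.ext (Subtype.ext ?_)
  rw [coe_sigO, coe_sigO, coe_sig, coe_sig, pow_add, pow_mul, σ_pow_d he, one_pow, mul_one]

theorem pairing_add_left (he : IsRamificationIndex p F e) {c : Fin e → S.OF} {κ : ℕ → S.qW}
    (h : Compat S N c κ) {i j : ℕ} (hi : N ≤ i) (hj : N ≤ j) (α β : S.O) :
    S.pairing (i + S.d * e) (S.lam κ (i + S.d * e) j) α β =
      ∑ k : Fin e, S.pairing (i + S.d * k) (S.lam κ (i + S.d * k) j) (relCoeff c k * α) β := by
  rw [pairing_apply, lam_add_left he h hi hj, Finset.smul_sum, map_sum]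
  refine Finset.sum_congr rfl fun k _ => ?_
  rw [pairing_apply, sigO_add_d_mul he, sigO_add_d_mul he, smul_smul']
  congr 2
  ring

theorem pairing_add_right {c : Fin e → S.OF} {κ : ℕ → S.qW}
    (h : Compat S N c κ) {i j : ℕ} (hi : N ≤ i) (hj : N ≤ j) (α β : S.O) :
    S.pairing i (S.lam κ i (j + S.d * e)) α β =
      ∑ k : Fin e, S.pairing i (S.lam κ i (j + S.d * k)) α (relCoeff c k * β) := by
  rw [pairing_apply, lam_add_right h hi hj, Finset.smul_sum, map_sum]
  refine Finset.sum_congr rfl fun k _ => ?_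
  rw [pairing_apply, smul_smul', map_mul (S.sigO i), relCoeff_eq, sigO_incO]
  congr 2
  ring

variable {c : Fin e → S.OF}
  (hc : (S.π ^ S.d) ^ e =
      (p : D) * ∑ k : Fin e, algebraMap F D ((c k : maxUnramified p F) : F) * (S.π ^ S.d) ^ (k : ℕ))
include hc

/-- Exponents outside the coordinate range are lowered by the relation for `τ`, which the prescribed
values respect in each index by `pairing_add_left` and `pairing_add_right`. -/
theorem form_mono (he : IsRamificationIndex p F e) {κ : ℕ → S.qW} (h : Compat S N c κ) (i j : ℕ)
    (α β : S.O) : form N he κ (S.mono N i α) (S.mono N j β) =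
      S.pairing (N + i) (S.lam κ (N + i) (N + j)) α β := by
  have hlt : ∀ k : Fin e, S.d * (k : ℕ) < S.d * e := fun k =>
    Nat.mul_lt_mul_of_pos_left k.2 d_pos
  have h1 : ∀ i j : ℕ, j < S.d * e → ∀ α β, form N he κ (S.mono N i α) (S.mono N j β) =
      S.pairing (N + i) (S.lam κ (N + i) (N + j)) α β := by
    intro i j hj
    induction i using Nat.strong_induction_on with
    | _ i ih =>
      intro α β
      rcases lt_or_ge i (S.d * e) with hi | hi
      · exact form_mono_of_lt he κ ⟨i, hi⟩ ⟨j, hj⟩ α β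
      · obtain ⟨i, rfl⟩ := Nat.exists_eq_add_of_le' hi
        rw [mono_add c hc, map_sum, LinearMap.sum_apply, ← add_assoc,
          pairing_add_left he h (Nat.le_add_right _ _) (Nat.le_add_right _ _)]
        refine Finset.sum_congr rfl fun k _ => ?_
        rw [ih _ (by have := hlt k; omega), add_assoc]
  induction j using Nat.strong_induction_on generalizing β with
  | _ j ih =>
    rcases lt_or_ge j (S.d * e) with hj | hj
    · exact h1 i j hj α β
    · obtain ⟨j, rfl⟩ := Nat.exists_eq_add_of_le' hj
      rw [mono_add c hc, map_sum, ← add_assoc N j,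
        pairing_add_right h (Nat.le_add_right _ _) (Nat.le_add_right _ _)]
      refine Finset.sum_congr rfl fun k _ => ?_
      rw [ih _ (by have := hlt k; omega), add_assoc]

omit hc in
theorem sigO_of_dvd (he : IsRamificationIndex p F e) {i : ℕ} (h : S.d ∣ i) (β : S.O) :
    S.sigO i β = β := by
  obtain ⟨k, rfl⟩ := h
  have := sigO_add_d_mul (S := S) he 0 k β
  rw [zero_add] at this
  exact this

omit hc in
-- Applying `σ ^ i` inside the second trace makes both coefficients `α σ ^ i (β)`; what they
-- multiply adds up to `κ_n(i) + σ ^ i (κ_n(j)) = κ_n(d n) = n Tr(κ_n) = 0`.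
theorem pairing_antisymm (he : IsRamificationIndex p F e) {κ : ℕ → S.qW} (h : Compat S N c κ)
    {i j : ℕ} (hi : N ≤ i) (hj : N ≤ j) (α β : S.O) :
    S.pairing i (S.lam κ i j) α β + S.pairing j (S.lam κ j i) β α = 0 := by
  by_cases hd : S.d ∣ i + j
  · have hd' := hd
    obtain ⟨n, hn⟩ := hd
    rw [lam_of_add_eq hn, lam_of_add_eq (n := n) (by omega), pairing_apply, pairing_apply,
      ← tr_sigw i ((β * S.sigO j α) • S.partialTrace (κ n) j), sigw_smul, map_mul (S.sigO i), ← sigO_add,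
      sigO_of_dvd he hd', mul_comm (S.sigO i β) α, ← map_add, ← smul_add, ← partialTrace_add, hn,
      partialTrace_d_mul he]
    have := h.tors n (by omega)
    rw [trw_apply] at this
    rw [this, smul_zero, map_zero]
  · rw [lam_of_not_dvd hd, lam_of_not_dvd (by rwa [add_comm]), pairing_apply, pairing_apply,
      smul_zero, smul_zero, map_zero, add_zero]

theorem form_antisymm (he : IsRamificationIndex p F e) {κ : ℕ → S.qW} (h : Compat S N c κ)
    (x y : S.lattice N) : form N he κ x y + form N he κ y x = 0 := by
  refine lattice_induction (P := fun x => form N he κ x y + form N he κ y x = 0) he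
    (fun i α => ?_) (fun x x' hx hx' => ?_) x
  · refine lattice_induction (P := fun y => form N he κ (S.mono N i α) y
      + form N he κ y (S.mono N i α) = 0) he (fun j β => ?_) (fun y y' hy hy' => ?_) y
    · rw [form_mono hc he h, form_mono hc he h]
      exact pairing_antisymm he h (Nat.le_add_right _ _) (Nat.le_add_right _ _) α β
    · rw [map_add, map_add, LinearMap.add_apply, add_add_add_comm, hy, hy', add_zero]
  · rw [map_add, map_add, LinearMap.add_apply, add_add_add_comm, hx, hx', add_zero]

theorem form_self (hp : p ≠ 2) (he : IsRamificationIndex p F e) {κ : ℕ → S.qW}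
    (h : Compat S N c κ) (x : S.lattice N) : form N he κ x x = 0 := by
  refine eq_zero_of_nsmul_eq_zero (p := p) (m := 2) ?_ ?_
  · exact (Nat.coprime_primes Nat.prime_two Fact.out).2 hp.symm
  · rw [two_nsmul]
    exact form_antisymm hc he h x x

omit hc in
theorem mul_mem_lattice {x y : D} (hx : x ∈ S.lattice N) (hy : y ∈ S.lattice N) :
    x * y ∈ S.lattice N := by
  rw [mem_lattice] at *
  rw [map_mul]
  exact (mul_le_mul' hx hy).trans
    (mul_le_of_le_one_left' (pow_le_one₀ zero_le S.isUniformizer.val_lt_one.le))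

omit hc in
variable (S N) in
/-- Multiplication on the lattice. -/
def mulL : S.lattice N →ₗ[ℤ_[p]] S.lattice N →ₗ[ℤ_[p]] S.lattice N :=
  LinearMap.mk₂ ℤ_[p] (fun x y => ⟨x * y, mul_mem_lattice x.2 y.2⟩)
    (fun _ _ _ => Subtype.ext (add_mul _ _ _)) (fun _ _ _ => Subtype.ext (smul_mul_assoc _ _ _))
    (fun _ _ _ => Subtype.ext (mul_add _ _ _)) (fun _ _ _ => Subtype.ext (mul_smul_comm _ _ _))

omit hc in
theorem coe_mulL (x y : S.lattice N) : (S.mulL N x y : D) = x * y := rfl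

omit hc in
theorem mulL_mono (i j : ℕ) (α β : S.O) : S.mulL N (S.mono N i α) (S.mono N j β) =
    S.mono N (i + (N + j)) (α * S.sigO (N + i) β) := by
  ext
  rw [coe_mulL, coe_mono, coe_mono, coe_mono, toD_mul, mul_assoc, ← mul_assoc (S.π ^ _),
    π_pow_mul_toD, ← add_assoc, pow_add S.π (N + i), mul_assoc, mul_assoc]

/-- After applying `σ ^ I` and `σ ^ (I + J)` to the last two traces, all three have the coefficient
`α σ ^ I (β) σ ^ (I + J) (γ)`. The first and third partial traces combine to `κ_n(I + d n) =
κ_n(I)`, which with the second gives `κ_n(d n) = 0`. -/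
theorem form_cyclic_mono (he : IsRamificationIndex p F e) {κ : ℕ → S.qW} (h : Compat S N c κ)
    (i j k : ℕ) (α β γ : S.O) :
    form N he κ (S.mulL N (S.mono N i α) (S.mono N j β)) (S.mono N k γ)
      + form N he κ (S.mulL N (S.mono N j β) (S.mono N k γ)) (S.mono N i α)
      + form N he κ (S.mulL N (S.mono N k γ) (S.mono N i α)) (S.mono N j β) = 0 := by
  rw [mulL_mono, mulL_mono, mulL_mono, form_mono hc he h, form_mono hc he h, form_mono hc he h,
    ← add_assoc N i, ← add_assoc N j, ← add_assoc N k]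
  generalize hI : N + i = I
  generalize hJ : N + j = J
  generalize hK : N + k = K
  by_cases hd : S.d ∣ I + J + K
  · have hd' := hd
    obtain ⟨n, hn⟩ := hd
    rw [lam_of_add_eq hn, lam_of_add_eq (n := n) (by omega), lam_of_add_eq (n := n) (by omega),
      pairing_apply, pairing_apply, pairing_apply,
      ← tr_sigw I ((β * S.sigO J γ * S.sigO (J + K) α) • S.partialTrace (κ n) (J + K)),
      ← tr_sigw (I + J) ((γ * S.sigO K α * S.sigO (K + I) β) • S.partialTrace (κ n) (K + I)),
      sigw_smul, sigw_smul]
    simp only [map_mul, ← sigO_add]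
    rw [sigO_of_dvd he (show S.d ∣ I + (J + K) by rwa [← add_assoc]), sigO_of_dvd he hd',
      show I + J + (K + I) = I + S.d * n by omega, sigO_add_d_mul he,
      show S.sigO I β * S.sigO (I + J) γ * α = α * S.sigO I β * S.sigO (I + J) γ by ring,
      show S.sigO (I + J) γ * α * S.sigO I β = α * S.sigO I β * S.sigO (I + J) γ by ring,
      ← map_add, ← map_add, ← smul_add, ← smul_add]
    have h1 : S.partialTrace (κ n) I + S.sigw I (S.partialTrace (κ n) (J + K))
        = n • S.trw (κ n) := by
      rw [← partialTrace_add, ← add_assoc, hn, partialTrace_d_mul he, trw_apply]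
    have h2 : S.partialTrace (κ n) (I + J) + S.sigw (I + J) (S.partialTrace (κ n) (K + I))
        = S.partialTrace (κ n) I + n • S.trw (κ n) := by
      rw [← partialTrace_add, show I + J + (K + I) = I + S.d * n by omega,
        partialTrace_add_d_mul he, trw_apply]
    have h3 := h.tors n (by omega)
    rw [h3] at h1 h2
    rw [add_zero] at h2
    rw [add_right_comm, h2, h1, smul_zero, map_zero]
  · rw [lam_of_not_dvd hd, lam_of_not_dvd (by rwa [show J + K + I = I + J + K by omega]),
      lam_of_not_dvd (by rwa [show K + I + J = I + J + K by omega])]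
    simp only [pairing_apply, smul_zero, map_zero, add_zero]

theorem form_cyclic (he : IsRamificationIndex p F e) {κ : ℕ → S.qW} (h : Compat S N c κ)
    (x y z : S.lattice N) : form N he κ (S.mulL N x y) z + form N he κ (S.mulL N y z) x
      + form N he κ (S.mulL N z x) y = 0 := by
  have hadd : ∀ {a b c a' b' c' : ModInt p ℚ_[p]}, a + b + c = 0 → a' + b' + c' = 0 →
      (a + a') + (b + b') + (c + c') = 0 := by
    intro a b c a' b' c' h h'
    calc (a + a') + (b + b') + (c + c') = (a + b + c) + (a' + b' + c') := by abel
      _ = 0 := by rw [h, h', add_zero]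
  refine lattice_induction (P := fun x => form N he κ (S.mulL N x y) z
    + form N he κ (S.mulL N y z) x + form N he κ (S.mulL N z x) y = 0) he
    (fun i α => ?_) (fun x x' hx hx' => ?_) x
  · refine lattice_induction (P := fun y => form N he κ (S.mulL N (S.mono N i α) y) z
      + form N he κ (S.mulL N y z) (S.mono N i α) + form N he κ (S.mulL N z (S.mono N i α)) y = 0) he
      (fun j β => ?_) (fun y y' hy hy' => ?_) y
    · refine lattice_induction (P := fun z => form N he κ (S.mulL N (S.mono N i α) (S.mono N j β)) z
        + form N he κ (S.mulL N (S.mono N j β) z) (S.mono N i α)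
        + form N he κ (S.mulL N z (S.mono N i α)) (S.mono N j β) = 0) he
        (fun k γ => form_cyclic_mono hc he h i j k α β γ) (fun z z' hz hz' => ?_) z
      rw [map_add, map_add, map_add, map_add, LinearMap.add_apply, LinearMap.add_apply, map_add,
        LinearMap.add_apply]
      exact hadd hz hz'
    · rw [map_add, map_add, map_add, map_add, LinearMap.add_apply, LinearMap.add_apply, map_add,
        LinearMap.add_apply]
      exact hadd hy hy'
  · rw [map_add, map_add, map_add, map_add, LinearMap.add_apply, LinearMap.add_apply, map_add,
      LinearMap.add_apply]
    exact hadd hx hx'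

/-! Conjugation. -/

omit hc in
variable (N) in
/-- The map `x ↦ γ' x γ` on the lattice. -/
def conjL (γ' γ : S.O) : S.lattice N →ₗ[ℤ_[p]] S.lattice N where
  toFun x := ⟨S.toD γ' * x * S.toD γ, by
    rw [mem_lattice, map_mul, map_mul]
    exact (mul_le_of_le_one_right' (val_toD_le γ)).trans
      ((mul_le_of_le_one_left' (val_toD_le γ')).trans x.2)⟩
  map_add' x y := Subtype.ext ((congrArg (· * _) (mul_add _ _ _)).trans (add_mul _ _ _))
  map_smul' z x := Subtype.ext
    ((congrArg (· * _) (mul_smul_comm z _ _)).trans (smul_mul_assoc _ _ _))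

omit hc in
theorem coe_conjL (γ' γ : S.O) (x : S.lattice N) :
    (conjL N γ' γ x : D) = S.toD γ' * x * S.toD γ := rfl

omit hc in
theorem conjL_mono (γ' γ : S.O) (i : ℕ) (α : S.O) :
    conjL N γ' γ (S.mono N i α) = S.mono N i (γ' * α * S.sigO (N + i) γ) := by
  ext
  rw [coe_conjL, coe_mono, coe_mono, toD_mul, toD_mul, mul_assoc, mul_assoc, mul_assoc,
    π_pow_mul_toD]
  simp only [mul_assoc]

/-- Conjugation multiplies `α` by `γ' σ ^ I (γ)` and `β` by `γ' σ ^ J (γ)`. When `d ∣ I + J` these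
factors cancel in `α σ ^ I (β)`; otherwise both sides vanish. -/
theorem form_conjL (he : IsRamificationIndex p F e) {κ : ℕ → S.qW} (h : Compat S N c κ)
    {γ' γ : S.O} (hγ : γ' * γ = 1) (x y : S.lattice N) :
    form N he κ (conjL N γ' γ x) (conjL N γ' γ y) = form N he κ x y := by
  refine lattice_induction (P := fun x => form N he κ (conjL N γ' γ x) (conjL N γ' γ y)
    = form N he κ x y) he (fun i α => ?_) (fun x x' hx hx' => ?_) x
  · refine lattice_induction (P := fun y => form N he κ (conjL N γ' γ (S.mono N i α))
      (conjL N γ' γ y) = form N he κ (S.mono N i α) y) he (fun j β => ?_) (fun y y' hy hy' => ?_) y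
    · rw [conjL_mono, conjL_mono, form_mono hc he h, form_mono hc he h, pairing_apply,
        pairing_apply]
      generalize N + i = I
      generalize N + j = J
      by_cases hd : S.d ∣ I + J
      · congr 2
        have h1 : S.sigO I γ' * S.sigO I γ = 1 := by rw [← map_mul, hγ, map_one]
        simp only [map_mul]
        rw [← sigO_add, sigO_of_dvd he hd]
        calc γ' * α * S.sigO I γ * (S.sigO I γ' * S.sigO I β * γ)
            = (γ' * γ) * (S.sigO I γ' * S.sigO I γ) * (α * S.sigO I β) := by ring
          _ = α * S.sigO I β := by rw [hγ, h1, one_mul, one_mul]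
      · rw [lam_of_not_dvd hd, smul_zero, smul_zero]
    · rw [map_add (conjL N γ' γ), map_add, map_add, hy, hy']
  · rw [map_add (conjL N γ' γ), map_add, map_add, LinearMap.add_apply, LinearMap.add_apply, hx, hx']

end Cocycle

/-! ### From compatible sequences to cocycles -/

section Main
variable {S} {e N f : ℕ} {c : Fin e → S.OF} {κ : ℕ → S.qW}

theorem natCast_mul_smul (n : ℕ) (α : S.O) (l : S.qW) : ((n : S.O) * α) • l = n • α • l := by
  rw [← smul_smul']
  exact Nat.cast_smul_eq_nsmul S.O n (α • l)

/-- With `two_mul_le_of_le`, this identifies the range `2 N ≤ d n` of `Compat` for `N = d f + 1`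
with `n ≥ 2 f + 1`. -/
theorem le_of_two_mul_le {n : ℕ} (h : 2 * (S.d * f + 1) ≤ S.d * n) : 2 * f + 1 ≤ n := by
  by_contra! h'
  have : S.d * n ≤ S.d * (2 * f) := Nat.mul_le_mul_left _ (by omega)
  have h2 : S.d * (2 * f) = 2 * (S.d * f) := by ring
  omega

theorem two_mul_le_of_le (hd : 2 ≤ S.d) {n : ℕ} (h : 2 * f + 1 ≤ n) :
    2 * (S.d * f + 1) ≤ S.d * n := by
  have : S.d * (2 * f + 1) ≤ S.d * n := Nat.mul_le_mul_left _ h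
  have h2 : S.d * (2 * f + 1) = 2 * (S.d * f) + S.d := by ring
  omega

theorem IsCompatible.compat (h : S.IsCompatible f c κ) : Compat S (S.d * f + 1) c κ where
  rel n hn := by
    rw [(h n (le_of_two_mul_le hn)).1, Finset.smul_sum]
    refine Finset.sum_congr rfl fun k _ => ?_
    rw [relCoeff, natCast_mul_smul]
  tors n hn := by
    rw [trw_apply, ← map_nsmul, (h n (le_of_two_mul_le hn)).2, map_zero]

theorem Compat.isCompatible (hd : 2 ≤ S.d) (h : Compat S (S.d * f + 1) c κ) :
    S.IsCompatible f c κ := by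
  intro n hn
  have hn' := two_mul_le_of_le hd hn
  refine ⟨?_, incw_injective ?_⟩
  · rw [h.rel n hn', Finset.smul_sum]
    refine Finset.sum_congr rfl fun k _ => ?_
    rw [relCoeff, natCast_mul_smul]
  · rw [map_nsmul, map_zero]
    exact h.tors n hn'

variable (S N) in
/-- The inclusion of the Lie algebra into the lattice. -/
def lieIncl : S.lieAlg N →ₗ[ℤ_[p]] S.lattice N where
  toFun u := ⟨u, by
    obtain ⟨⟨y, hy, h⟩, -⟩ := u.2
    rw [h, mem_lattice, map_mul, map_pow]
    exact mul_le_of_le_one_right' (val_le_one_iff.2 hy)⟩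
  map_add' _ _ := rfl
  map_smul' _ _ := rfl

theorem coe_lieIncl (u : S.lieAlg N) : (S.lieIncl N u : D) = u := rfl

theorem lieIncl_lie (u v : S.lieAlg N) : S.lieIncl N ⁅u, v⁆ =
    S.mulL N (S.lieIncl N u) (S.lieIncl N v) - S.mulL N (S.lieIncl N v) (S.lieIncl N u) := by
  ext
  rw [coe_lieIncl, LieSubalgebra.coe_bracket, LieRing.of_associative_ring_bracket]
  rfl

/-- Roots of unity of order prime to `p` lie in `W_ur`, so conjugation by them acts on monomial
coordinates. -/
theorem exists_unit_of_mem_delta {g : W} (hg : g ∈ S.delta) :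
    ∃ γ' γ : S.O, γ' * γ = 1 ∧ S.toD γ = S.emb g ∧ S.toD γ' = (S.emb g)⁻¹ := by
  obtain ⟨⟨m, hm0, hm, h⟩, -⟩ := hg
  have hlift : ∀ x : W, x ^ m = 1 → ∃ γ : S.O, ((γ : maxUnramified p W) : W) = x := by
    intro x hx
    refine ⟨⟨⟨x, mem_maxUnramified_of_pow hm hm0 hx⟩, IsIntegral.of_pow hm0 ?_⟩, rfl⟩
    convert isIntegral_one
    exact Subtype.ext hx
  obtain ⟨γ, hγ⟩ := hlift g h
  obtain ⟨γ', hγ'⟩ := hlift g⁻¹ (by rw [inv_pow, h, inv_one])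
  have hg0 : g ≠ 0 := by
    rintro rfl
    simp [hm0.ne'] at h
  refine ⟨γ', γ, Subtype.ext (Subtype.ext ?_), ?_, ?_⟩
  · change ((γ' : maxUnramified p W) : W) * ((γ : maxUnramified p W) : W) = 1
    rw [hγ, hγ', inv_mul_cancel₀ hg0]
  · rw [toD, hγ]
  · rw [toD, hγ', map_inv₀]

variable (hc : (S.π ^ S.d) ^ e =
      (p : D) * ∑ k : Fin e, algebraMap F D ((c k : maxUnramified p F) : F) * (S.π ^ S.d) ^ (k : ℕ))
include hc

theorem exists_cocycle (hp : p ≠ 2) (he : IsRamificationIndex p F e)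
    (h : Compat S (S.d * f + 1) c κ) : ∃ C : S.Form (S.d * f + 1),
      IsTwoCocycle C ∧ IsDeltaInvariant C ∧ IsDefiningSequence C κ := by
  refine ⟨(form _ he κ).compl₁₂ (S.lieIncl _) (S.lieIncl _), ⟨fun x => ?_, fun x y z => ?_⟩,
    ?_, ?_⟩
  · exact form_self hc hp he h _
  -- The Lie cocycle identity is the cyclic identity for `(x, y, z)` minus that for `(y, x, z)`.
  · simp only [LinearMap.compl₁₂_apply, lieIncl_lie, map_sub, LinearMap.sub_apply]
    have h1 := form_cyclic hc he h (S.lieIncl _ x) (S.lieIncl _ y) (S.lieIncl _ z)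
    have h2 := form_cyclic hc he h (S.lieIncl _ y) (S.lieIncl _ x) (S.lieIncl _ z)
    rw [← sub_zero (0 : ModInt p ℚ_[p])]
    nth_rewrite 1 [← h1]
    rw [← h2]
    abel
  · intro g hg u v u' v' hu hv
    obtain ⟨γ', γ, hγ, hγ1, hγ2⟩ := exists_unit_of_mem_delta hg
    have hconj : ∀ w w' : S.lieAlg (S.d * f + 1), (w' : D) = (S.emb g)⁻¹ * w * S.emb g →
        S.lieIncl _ w' = conjL _ γ' γ (S.lieIncl _ w) := by
      intro w w' hw
      ext
      rw [coe_conjL, coe_lieIncl, coe_lieIncl, hγ1, hγ2, hw]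
    rw [LinearMap.compl₁₂_apply, LinearMap.compl₁₂_apply, hconj u u' hu, hconj v v' hv]
    exact form_conjL hc he h hγ _ _
  · intro i j hi hj
    refine ⟨fun α _ β _ u v hu hv => ?_, fun _ hdi hdj => ?_⟩
    · obtain ⟨i, rfl⟩ := Nat.exists_eq_add_of_le hi
      obtain ⟨j, rfl⟩ := Nat.exists_eq_add_of_le hj
      have hu' : S.lieIncl _ u = S.mono _ i α := Subtype.ext hu
      have hv' : S.lieIncl _ v = S.mono _ j β := Subtype.ext hv
      rw [LinearMap.compl₁₂_apply, hu', hv', form_mono hc he h]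
      rfl
    -- A partial trace whose length is divisible by `d` is a multiple of the full trace, hence comes
    -- from `F_ur`.
    · rw [if_pos (dvd_add hdi hdj)]
      obtain ⟨k, rfl⟩ := hdi
      rw [partialTrace_d_mul he, ← map_nsmul]
      exact ⟨_, rfl⟩

-- Supplies test elements with arbitrary coefficient in `O`.
omit hc in
theorem toD_mul_pow_mem_lieAlg (he : IsRamificationIndex p F e) {i : ℕ} (hi : N ≤ i)
    (hdi : ¬ S.d ∣ i) (α : S.O) : S.toD α * S.π ^ i ∈ S.lieAlg N := by
  refine ⟨?_, trd_emb_mul_pow he hdi _⟩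
  have h1 : val p D (S.toD α * S.π ^ i) ≤ val p D (S.π ^ N) := by
    rw [map_pow]
    exact toD_mul_pow_mem α hi
  obtain ⟨z, hz, h⟩ := exists_eq_mul_of_val_le (pow_ne_zero N S.isUniformizer.ne_zero) h1
  exact ⟨z, val_le_one_iff.1 hz, h⟩

/-! ### From cocycles to compatible sequences -/

section Converse
variable {C : S.Form (S.d * f + 1)} (he : IsRamificationIndex p F e)
  (hC : ∀ x, C x x = 0) (hκ : IsDefiningSequence C κ)
include hκ

omit hc in
theorem apply_eq_tr {i j n : ℕ} (hi : S.d * f + 1 ≤ i) (hj : S.d * f + 1 ≤ j)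
    (hn : i + j = S.d * n) (hdi : ¬ S.d ∣ i) (hdj : ¬ S.d ∣ j) (α β : S.O)
    {u v : S.lieAlg (S.d * f + 1)} (hu : (u : D) = S.toD α * S.π ^ i)
    (hv : (v : D) = S.toD β * S.π ^ j) :
    C u v = S.tr ((α * S.sigO i β) • S.partialTrace (κ n) i) := by
  have h := (hκ i j hi hj).1 α (fun h => absurd h hdi) β (fun h => absurd h hdj) u v hu hv
  rw [h]
  change S.tr (_ • S.lam κ i j) = _
  rw [lam_of_add_eq hn]

-- Alternation on `α π ^ i` and `π ^ j` says that `κ_n(i) + σ ^ i (κ_n(j)) = n Tr(κ_n)` pairs to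
-- zero with every `α`.
include he hC in
omit hc in
theorem nsmul_trw_eq_zero {i j n : ℕ} (hi : S.d * f + 1 ≤ i) (hj : S.d * f + 1 ≤ j)
    (hn : i + j = S.d * n) (hdi : ¬ S.d ∣ i) : n • S.trw (κ n) = 0 := by
  have hdj : ¬ S.d ∣ j := fun h => hdi ((Nat.dvd_add_left h).1 ⟨n, hn⟩)
  rw [trw_apply, ← partialTrace_d_mul he, ← hn, partialTrace_add]
  refine eq_zero_of_tr fun α => ?_
  have hanti : ∀ u v : S.lieAlg (S.d * f + 1), C u v + C v u = 0 := by
    intro u v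
    have := hC (u + v)
    rwa [map_add, map_add, LinearMap.add_apply, LinearMap.add_apply, hC, hC, zero_add, add_zero,
      add_comm] at this
  have h := hanti ⟨_, toD_mul_pow_mem_lieAlg he hi hdi α⟩ ⟨_, toD_mul_pow_mem_lieAlg he hj hdj 1⟩
  rw [apply_eq_tr hκ hi hj hn hdi hdj α 1 rfl rfl,
    apply_eq_tr hκ hj hi (by rw [add_comm, hn]) hdj hdi 1 α rfl rfl,
    ← tr_sigw i ((1 * S.sigO j α) • _), sigw_smul, one_mul, ← sigO_add,
    sigO_of_dvd he ⟨n, hn⟩, map_one, mul_one, ← map_add, ← smul_add] at h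
  exact h

-- Both sides compute `C` on `α π ^ (i + d e)` and `π ^ j`, the right one after rewriting with the
-- relation for `τ`; nondegeneracy removes `α`.
include he hc in
theorem partialTrace_rel {i j n : ℕ} (hi : S.d * f + 1 ≤ i) (hj : S.d * f + 1 ≤ j)
    (hn : i + j = S.d * n) (hdi : ¬ S.d ∣ i) :
    S.partialTrace (κ (n + e)) (i + S.d * e) =
      ∑ k : Fin e, relCoeff c k • S.partialTrace (κ (n + k)) (i + S.d * k) := by
  have hdj : ¬ S.d ∣ j := fun h => hdi ((Nat.dvd_add_left h).1 ⟨n, hn⟩)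
  have hdk : ∀ k, ¬ S.d ∣ i + S.d * k := fun k => by rwa [Nat.dvd_add_left (dvd_mul_right _ _)]
  have hik : ∀ k, S.d * f + 1 ≤ i + S.d * k := fun k => hi.trans (Nat.le_add_right _ _)
  have hnk : ∀ k, i + S.d * k + j = S.d * (n + k) := fun k => by rw [mul_add]; omega
  rw [← sub_eq_zero]
  refine eq_zero_of_tr fun α => ?_
  have h1 : (⟨_, toD_mul_pow_mem_lieAlg he (hik e) (hdk e) α⟩ : S.lieAlg (S.d * f + 1)) =
      ∑ k : Fin e, ⟨_, toD_mul_pow_mem_lieAlg he (hik k) (hdk k) (relCoeff c k * α)⟩ := by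
    obtain ⟨i, rfl⟩ := Nat.exists_eq_add_of_le hi
    have h2 := congrArg Subtype.val (mono_add (N := S.d * f + 1) c hc i α)
    rw [AddSubmonoidClass.coe_finsetSum] at h2
    ext
    rw [AddSubmonoidClass.coe_finsetSum]
    simp_rw [coe_mono, ← add_assoc] at h2
    exact h2
  have h2 := congrArg (fun u => C u ⟨_, toD_mul_pow_mem_lieAlg he hj hdj 1⟩) h1
  simp only [map_sum, LinearMap.sum_apply] at h2
  rw [apply_eq_tr hκ (hik e) hj (hnk e) (hdk e) hdj α 1 rfl rfl] at h2
  rw [smul_sub, map_sub, sub_eq_zero, Finset.smul_sum, map_sum]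
  rw [map_one, mul_one] at h2
  rw [h2]
  refine Finset.sum_congr rfl fun k _ => ?_
  rw [apply_eq_tr hκ (hik k) hj (hnk k) (hdk k) hdj _ 1 rfl rfl, map_one, mul_one, smul_smul',
    mul_comm]

include he hc in
/-- The defect `ε` of the recurrence satisfies `ε(i) = n Tr(ε)`. -/
theorem partialTrace_defect (htors : ∀ m, 2 * (S.d * f + 1) ≤ S.d * m → m • S.trw (κ m) = 0)
    {i j n : ℕ} (hi : S.d * f + 1 ≤ i) (hj : S.d * f + 1 ≤ j)
    (hn : i + j = S.d * n) (hdi : ¬ S.d ∣ i) :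
    S.partialTrace (κ (n + e) - ∑ k : Fin e, relCoeff c k • κ (n + k)) i =
      n • S.trw (κ (n + e) - ∑ k : Fin e, relCoeff c k • κ (n + k)) := by
  have h := partialTrace_rel hc he hκ hi hj hn hdi
  -- With `-n` in place of `k`, including `k = e`, the trace terms assemble into `n Tr(ε)`.
  have hneg : ∀ k, k • S.trw (κ (n + k)) = - (n • S.trw (κ (n + k))) := by
    intro k
    rw [eq_neg_iff_add_eq_zero, ← add_smul, add_comm k]
    exact htors _ (by have := Nat.mul_le_mul_left S.d (Nat.le_add_right n k); omega)
  simp_rw [partialTrace_add_d_mul he, ← trw_apply, hneg, smul_add, smul_neg,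
    Finset.sum_add_distrib, Finset.sum_neg_distrib] at h
  have h1 : S.partialTrace (κ (n + e) - ∑ k : Fin e, relCoeff c k • κ (n + k)) i =
      S.partialTrace (κ (n + e)) i - ∑ k : Fin e, relCoeff c k • S.partialTrace (κ (n + k)) i := by
    rw [← partialTraceHom_apply, map_sub, map_sum]
    congr 1
    refine Finset.sum_congr rfl fun k _ => ?_
    rw [partialTraceHom_apply, relCoeff_eq, partialTrace_smul]
  have h2 : n • S.trw (κ (n + e) - ∑ k : Fin e, relCoeff c k • κ (n + k)) =
      n • S.trw (κ (n + e)) - ∑ k : Fin e, relCoeff c k • n • S.trw (κ (n + k)) := by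
    rw [map_sub, map_sum, smul_sub, Finset.smul_sum]
    congr 1
    refine Finset.sum_congr rfl fun k _ => ?_
    rw [relCoeff_eq, trw_smul he, smul_comm]
  rw [h1, h2, sub_eq_sub_iff_sub_eq_sub, sub_eq_add_neg, h]
  abel

omit hc hκ in
theorem partialTrace_one_add (he : IsRamificationIndex p F e) (l : S.qW) (k : ℕ) :
    S.partialTrace l (1 + S.d * k) = l + k • S.trw l := by
  rw [partialTrace_add_d_mul he, trw_apply]
  congr 1
  simp [partialTrace, sigw_zero]

include he hC hc in
theorem compat_of_isDefiningSequence (hd : 2 ≤ S.d) (hex : S.d = 2 → ¬ p ∣ 2 * f + 1) :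
    Compat S (S.d * f + 1) c κ := by
  have hd1 : ∀ a, ¬ S.d ∣ 1 + S.d * a := fun a h => by
    rw [Nat.dvd_add_left (dvd_mul_right _ _), Nat.dvd_one] at h
    omega
  -- The least admissible exponent `d f + 1` is prime to the divisibility obstruction as `d ≥ 2`,
  -- and `2 (d f + 1) ≤ d m` makes its partner admissible.
  have htors : ∀ m, 2 * (S.d * f + 1) ≤ S.d * m → m • S.trw (κ m) = 0 := fun m hm =>
    nsmul_trw_eq_zero he hC hκ (i := 1 + S.d * f) (j := S.d * m - (1 + S.d * f)) (by omega)
      (by omega) (by omega) (hd1 f)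
  refine ⟨fun n hn => ?_, htors⟩
  have hfn : 2 * f + 1 ≤ n := le_of_two_mul_le hn
  have key : ∀ i, S.d * f + 1 ≤ i → i + (S.d * f + 1) ≤ S.d * n → ¬ S.d ∣ i →
      S.partialTrace (κ (n + e) - ∑ k : Fin e, relCoeff c k • κ (n + k)) i =
      n • S.trw (κ (n + e) - ∑ k : Fin e, relCoeff c k • κ (n + k)) := fun i hi hi' hdi =>
    partialTrace_defect hc he hκ htors (j := S.d * n - i) hi (by omega) (by omega) hdi
  rw [← sub_eq_zero]
  generalize κ (n + e) - ∑ k : Fin e, relCoeff c k • κ (n + k) = ε at key ⊢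
  have h1 := key (1 + S.d * f) (by omega) (by omega) (hd1 f)
  rw [partialTrace_one_add he] at h1
  rcases hd.eq_or_lt with hd2 | hd3
  -- Case `d = 2`: `ε = (n - f) Tr(ε)` is fixed by `σ`, so `Tr(ε) = 2 ε`.
  · have hT : ∀ i, S.sigw i (S.trw ε) = S.trw ε := fun i => sigw_incw i _
    have hσ : S.sigw 1 ε = ε := by
      have h2 : ε = n • S.trw ε - f • S.trw ε := eq_sub_of_add_eq h1
      rw [h2, map_sub, map_nsmul, map_nsmul, hT]
    have hTε : S.trw ε = 2 • ε := by
      rw [trw_apply, incw_Tr he, ← hd2, partialTrace, Finset.sum_range_succ, Finset.sum_range_one,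
        sigw_zero, hσ, two_nsmul]
    rcases hfn.eq_or_lt with hfn' | hfn'
    -- For `n = 2 f + 1` only `i = j = 2 f + 1` is available; the identity becomes `(2 f + 1) ε =
    -- 0`, which is where `p ∤ 2 f + 1` enters.
    · refine eq_zero_of_nsmul_eq_zero (p := p) (m := 2 * f + 1) ?_ ?_
      · exact ((Nat.Prime.coprime_iff_not_dvd Fact.out).2 (hex hd2.symm)).symm
      · rw [hTε, ← hfn'] at h1
        have h3 : (2 * f + 1) • ε = (2 * f + 1) • 2 • ε - (ε + f • 2 • ε) := by module
        rw [h3, h1, sub_self]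
    -- For larger `n` the exponent `i = 2 f + 3` is admissible too; subtracting gives `Tr(ε) = 0`,
    -- and then `ε = 0`.
    · have h2 := key (1 + S.d * (f + 1)) (by rw [mul_add]; omega) (by
        rw [← hd2]; omega) (hd1 _)
      rw [partialTrace_one_add he, ← h1, succ_nsmul, ← add_assoc, add_eq_left] at h2
      rw [h2, smul_zero, smul_zero, add_zero] at h1
      exact h1
  -- Case `d ≥ 3`: `i = d f + 2` is also admissible, and the two identities differ by `σ(ε)`, which
  -- therefore vanishes; so does `ε = σ ^ d (ε)`.
  · have hdn : S.d * (2 * f + 1) ≤ S.d * n := Nat.mul_le_mul_left _ hfn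
    have hdn' : S.d * (2 * f + 1) = 2 * (S.d * f) + S.d := by ring
    have h2 := key (1 + S.d * f + 1) (by omega) (by omega) (by
      rw [add_right_comm, Nat.dvd_add_left (dvd_mul_right _ _)]
      exact fun h => by have := Nat.le_of_dvd (by omega) h; omega)
    rw [add_right_comm, partialTrace_add_d_mul he, ← trw_apply, ← h1, partialTrace_add,
      add_assoc, add_comm (S.sigw 1 _), ← add_assoc] at h2
    have h3 : S.partialTrace ε 1 = ε := by simp [partialTrace, sigw_zero]
    rw [h3, add_eq_left] at h2
    rw [← sigw_d he ε, ← Nat.sub_add_cancel (show 1 ≤ S.d by omega), sigw_add, h2, map_zero]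

end Converse
end Main
end Frame
end NormOne
end

open NormOne in
theorem theorem7 (p : ℕ) [Fact p.Prime] (hp : p ≠ 2) (F W D : Type*)
    [Field F] [Algebra ℚ_[p] F] [Algebra ℤ_[p] F] [IsScalarTower ℤ_[p] ℚ_[p] F]
    [FiniteDimensional ℚ_[p] F]
    [Field W] [Algebra F W] [Algebra ℚ_[p] W] [Algebra ℤ_[p] W]
    [IsScalarTower ℤ_[p] ℚ_[p] W] [IsScalarTower ℚ_[p] F W] [FiniteDimensional ℚ_[p] W]
    [DivisionRing D] [Algebra F D] [Algebra ℚ_[p] D] [Algebra ℤ_[p] D]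
    [IsScalarTower ℤ_[p] ℚ_[p] D] [IsScalarTower ℚ_[p] F D] [FiniteDimensional ℚ_[p] D]
    [Algebra.IsCentral F D]
    (S : Frame p F W D) (hd : 2 ≤ S.d)
    (e : ℕ) (he : IsRamificationIndex p F e)
    (c : Fin e → S.OF)
    (hc : (S.π ^ S.d) ^ e =
      (p : D) * ∑ k : Fin e, algebraMap F D ((c k : maxUnramified p F) : F) * (S.π ^ S.d) ^ (k : ℕ))
    (f : ℕ) (κ : ℕ → S.qW) :
    (S.IsCompatible f c κ → ∃ C : S.Form (S.d * f + 1),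
      Frame.IsTwoCocycle C ∧ Frame.IsDeltaInvariant C ∧ Frame.IsRegular C ∧
        Frame.IsDefiningSequence C κ) ∧
    ((S.d = 2 → ¬ p ∣ 2 * f + 1) →
      (∃ C : S.Form (S.d * f + 1),
        Frame.IsTwoCocycle C ∧ Frame.IsDeltaInvariant C ∧ Frame.IsRegular C ∧
          Frame.IsDefiningSequence C κ) →
      S.IsCompatible f c κ) := by
  refine ⟨fun h => ?_, fun hex h => ?_⟩
  · obtain ⟨C, h1, h2, h3⟩ := Frame.exists_cocycle hc hp he h.compat
    exact ⟨C, h1, h2, ⟨κ, h3⟩, h3⟩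
  · obtain ⟨C, h1, -, -, h3⟩ := h
    exact (Frame.compat_of_isDefiningSequence hc he h1.1 h3 hd hex).isCompatible hd
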